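/- Let $G=(L\cup R,E)$ be a finite bipartite graph, given by adjacency lists (in any order), and let $d$ be its maximum degree and $\delta^R_{\max}$, $\delta^L_{\max}$ the maximum degrees of vertices of $R$ and of $L$. For $X\subseteq L$, $Y\subseteq R$, the induced subgraph $(X,Y)$ is a $k$-biplex if each vertex of $X$ has at most $k$ non-neighbours in $Y$ and each vertex of $Y$ at most $k$ in $X$; it is maximal if no other $k$-biplex contains it. Let $k\ge 1$ and $\theta_L,\theta_R\ge 2k+1$. A MaxBP is a maximal $k$-biplex with $|X|\ge\theta_L$, $|Y|\ge\theta_R$ that has the most edges among all such maximal $k$-biplexes. Let $\gamma_k$ be the largest positive real root of $x^{k+4}-2x^{k+3}+x^2-x+1$. *FastBB* explores branches $(S,C,D)$ (vertices that are included, undecided, excluded), for given bounds $LB_L,UB_L,LB_R,UB_R$ and a best biplex $H^*$. If $G[S\cup C]$ is a $k$-biplex, it becomes $H^*$ provided that it has more edges than $H^*$ and at least $LB_L$ left and $LB_R$ right vertices, and the branch ends. Otherwise put $\tau_L=\min_{u\in S\cap R}\delta(u,S\cup C)+k$ and $\tau_R=\min_{v\in S\cap L}\delta(v,S\cup C)+k$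 (with $\min\emptyset=\infty$), where $\delta(v,T)$ is the number of neighbours of $v$ in $T$. The branch is pruned if: $S$ is not a $k$-biplex; $|S\cap L|>UB_L$ or $|S\cap R|>UB_R$; $\tau_L<LB_L$ or $\tau_R<LB_R$; $|E(G[S\cup C])|\le|E(H^*)|$ or $\tau_L\tau_R\le |E(H^*)|$; or some $v\in D$ has at most $k$ non-neighbours on the other side of $S\cup C$ and is adjacent to every vertex there that has at least $k$ non-neighbours in $S\cup C$. Otherwise a pivot $\hat v$ with more than $k$, and the most, non-neighbours in $S\cup C$ is chosen, in $S$ if possible, else in $C$. Let $u_1,\dots,u_b$ be its non-neighbours in $C$ and $a=k-\overline\delta(\hat v,S)$, where $\overline\delta(\hat v,S)$ is the number of non-neighbours of $\hat v$ in $S$. With $(w_1,w_2,\dots)=(u_1,\dots,u_{a+1})$ if $\hat v\in S$ and $(\hat v,u_1,\dots,u_{a+1})$ if $\hat v\in C$, the $i$-th child branch includes $w_1,\dots,w_{i-1}$ and excludes $w_i$, and then drops from $C$ and $D$ each vertex that does not form a $k$-biplex with the included vertices. *PBIE* starts with $H^*_0=\emptyset$ and $LB^0_L=\delta^R_{\max}+k$.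 Its round $i\ge1$ uses $LB_L^i=\max\{LB_L^{i-1}/2,\theta_L\}$, $UB_L^i=LB_L^{i-1}$, $LB_R^i=\max\{|E(H^*_{i-1})|/UB_L^i,\theta_R\}$, $UB_R^i=\delta^L_{\max}+k$. It replaces $G$ by its $(LB_R^i-k,LB_L^i-k)$-core (the largest subgraph with left degrees at least the first and right degrees at least the second number). For each left vertex $v_j$ of the core it forms the subgraph of the core induced by $L_j$, the left vertices within two hops of $v_j$ ($v_j$ included) that do not precede $v_j$, and $R_j$, the neighbours of $L_j$; it removes each $v\in L_j\setminus\{v_j\}$ with $\delta(v,R_j)<LB_R^i-k$ or fewer than $LB_R^i-2k$ common neighbours with $v_j$ in $R_j$, and each $u\in R_j$ with $\delta(u,L_j)<LB_L^i-k$; and it runs FastBB there from the branch with $S=\{v_j\}$, $C$ the other remaining vertices and $D$ the left vertices of the core within two hops of $v_j$ that precede $v_j$. It stops after the first round with $LB_L^i\le\theta_L$ and returns $H^*$. Then: 1. $\gamma_k$ exists and $\gamma_k<2$ for every $k\ge 1$. 2. Every $k$-biplex with at least $p$ left and at least $q$ right vertices lies in the $(\max(q-k,0),\max(p-k,0))$-core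 of $G$. 3. Let $G_i=(L_i,R_i)$, where $L_i$ consists of the vertices of $L=\{v_1,\dots,v_{|L|}\}$ within two hops of $v_i$ in $G$ ($v_i$ included) that do not precede $v_i$, and $R_i$ of the neighbours of $L_i$. If $d\ge 2$, then $G_i$ has at most $d^3$ vertices. 4. For each MaxBP $(X,Y)$ there is an $i$ with $v_i\in X$, $X\subseteq L_i$, $Y\subseteq R_i$, and then each $v\in X$ has at least $\theta_R-k$ neighbours in $R_i$, and at least $\theta_R-2k$ of them are neighbours of $v_i$, and each $u\in Y$ has at least $\theta_L-k$ neighbours in $L_i$. 5. PBIE with FastBB returns a MaxBP, or the empty subgraph if there is no MaxBP. 6. There is an absolute constant $c$ such that, whenever $G$ has at least one edge, PBIE with FastBB takes at most $$c\cdot \log(\delta^R_{\max}+k)\cdot|L|\cdot d^4\cdot\gamma_k^{d^3}$$ elementary steps (arithmetic on numbers, comparisons, visits of list cells, reads and writes of memory cells). -/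

import Mathlib

namespace PBIE

/-! ### Bipartite graphs, `k`-biplexes and the problem -/

/-- The vertices of a bipartite graph with left side `L = Fin m` and right side `R = Fin n`. -/
abbrev Vertex (m n : ℕ) : Type := Fin m ⊕ Fin n

/-- A finite bipartite graph, given (as algorithms read it) by its adjacency lists, which may be
sorted in any way. -/
structure BipGraph (m n : ℕ) where
  adj : Vertex m n → List (Vertex m n)
  nodup : ∀ v, (adj v).Nodup
  symm : ∀ v w, w ∈ adj v → v ∈ adj w
  bip : ∀ v w, w ∈ adj v → v.isLeft ≠ w.isLeft

section Spec

variable {m n : ℕ} (G : BipGraph m n)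

/-- `(v, u) ∈ E` for `v ∈ L` and `u ∈ R`. -/
def Edge (v : Fin m) (u : Fin n) : Prop := Sum.inr u ∈ G.adj (Sum.inl v)

instance (v : Fin m) (u : Fin n) : Decidable (Edge G v u) :=
  decidable_of_iff (∃ x ∈ G.adj (Sum.inl v), x = Sum.inr u) (by simp [Edge])

/-- The neighbours in `Y` of `v ∈ L`. -/
def nbrR (v : Fin m) (Y : Finset (Fin n)) : Finset (Fin n) := Y.filter fun u => Edge G v u

/-- The neighbours in `X` of `u ∈ R`. -/
def nbrL (u : Fin n) (X : Finset (Fin m)) : Finset (Fin m) := X.filter fun v => Edge G v u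

/-- The non-neighbours in `Y` of `v ∈ L`. -/
def nonNbrR (v : Fin m) (Y : Finset (Fin n)) : Finset (Fin n) := Y.filter fun u => ¬ Edge G v u

/-- The non-neighbours in `X` of `u ∈ R`. -/
def nonNbrL (u : Fin n) (X : Finset (Fin m)) : Finset (Fin m) := X.filter fun v => ¬ Edge G v u

/-- The maximum degree of a vertex of `R`. -/
def maxDegR : ℕ := Finset.univ.sup fun u : Fin n => (nbrL G u Finset.univ).card

/-- The maximum degree of a vertex of `L`. -/
def maxDegL : ℕ := Finset.univ.sup fun v : Fin m => (nbrR G v Finset.univ).card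

/-- The maximum degree `d` of `G`. -/
def maxDeg : ℕ := max (maxDegL G) (maxDegR G)

/-- The number of edges of the subgraph induced by `X ⊆ L` and `Y ⊆ R`. -/
def numEdges (X : Finset (Fin m)) (Y : Finset (Fin n)) : ℕ := ∑ v ∈ X, (nbrR G v Y).card

/-- The subgraph induced by `X ⊆ L` and `Y ⊆ R` is a `k`-biplex. -/
def IsBiplex (k : ℕ) (X : Finset (Fin m)) (Y : Finset (Fin n)) : Prop :=
  (∀ v ∈ X, (nonNbrR G v Y).card ≤ k) ∧ (∀ u ∈ Y, (nonNbrL G u X).card ≤ k)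

/-- A maximal `k`-biplex: no other `k`-biplex contains it. -/
def IsMaximalBiplex (k : ℕ) (X : Finset (Fin m)) (Y : Finset (Fin n)) : Prop :=
  IsBiplex G k X Y ∧
    ∀ X' Y', IsBiplex G k X' Y' → X ⊆ X' → Y ⊆ Y' → X' = X ∧ Y' = Y

/-- A maximum `k`-biplex (MaxBP): it has the most edges among the maximal `k`-biplexes with at
least `θL` vertices on the left and at least `θR` on the right. -/
def IsMaxBP (k θL θR : ℕ) (X : Finset (Fin m)) (Y : Finset (Fin n)) : Prop :=
  (IsMaximalBiplex G k X Y ∧ θL ≤ X.card ∧ θR ≤ Y.card) ∧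
    ∀ X' Y', IsMaximalBiplex G k X' Y' → θL ≤ X'.card → θR ≤ Y'.card →
      numEdges G X' Y' ≤ numEdges G X Y

/-- Left side `L_i` of the `i`-th inclusion-exclusion subgraph: the vertices of `L` within two hops
of `v_i` (`v_i` included), without those that precede `v_i`. -/
def subL (i : Fin m) : Finset (Fin m) :=
  Finset.univ.filter fun w => i ≤ w ∧ (w = i ∨ ∃ u, Edge G i u ∧ Edge G w u)

/-- Right side `R_i` of the `i`-th inclusion-exclusion subgraph: all neighbours of `L_i`. -/
def subR (i : Fin m) : Finset (Fin n) :=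
  Finset.univ.filter fun u => ∃ w ∈ subL G i, Edge G w u

/-- The subgraph induced by `A ⊆ L` and `B ⊆ R` has left degrees at least `α` and right degrees at
least `β`. -/
def HasMinDegs (α β : ℕ) (A : Finset (Fin m)) (B : Finset (Fin n)) : Prop :=
  (∀ v ∈ A, α ≤ (nbrR G v B).card) ∧ (∀ u ∈ B, β ≤ (nbrL G u A).card)

/-- `(A, B)` is the `(α, β)`-core of `G`: the largest subgraph with left degrees at least `α` and
right degrees at least `β`. -/
def IsCore (α β : ℕ) (A : Finset (Fin m)) (B : Finset (Fin n)) : Prop :=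
  HasMinDegs G α β A B ∧ ∀ A' B', HasMinDegs G α β A' B' → A' ⊆ A ∧ B' ⊆ B

end Spec

/-- `γ_k`, the largest positive real root of `x^(k+4) - 2x^(k+3) + x^2 - x + 1`. -/
noncomputable def gammaRoot (k : ℕ) : ℝ :=
  sSup {x : ℝ | 0 < x ∧ x ^ (k + 4) - 2 * x ^ (k + 3) + x ^ 2 - x + 1 = 0}

/-! ### Step counting

A computation is a value together with the number of elementary steps spent on it. All data are
numbers, vertices, lists (linked lists) and memory cells indexed by vertices; every loop below is
one of the list traversals of this section, which pay for every list cell they visit. -/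

/-- A result together with the number of steps that were used to compute it. -/
structure Timed (α : Type) where
  val : α
  cost : ℕ

instance : Monad Timed where
  pure a := ⟨a, 0⟩
  bind x f := ⟨(f x.val).val, x.cost + (f x.val).cost⟩

/-- One step: a bounded number of elementary operations (arithmetic on numbers, comparisons,
Boolean operations, attaching a list cell, reading or writing a memory cell). -/
def op {α : Type} (a : α) : Timed α := ⟨a, 1⟩

def foldT {α β : Type} (f : β → α → Timed β) : β → List α → Timed β
  | b, [] => op b
  | b, a :: l => do
    let b' ← f b a
    let b'' ← op b'
    foldT f b'' l

def countT {α : Type} (p : α → Timed Bool) : List α → Timed ℕ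
  | [] => op 0
  | a :: l => do
    let b ← p a
    let c ← countT p l
    op (if b then c + 1 else c)

def filterT {α : Type} (p : α → Timed Bool) : List α → Timed (List α)
  | [] => op []
  | a :: l => do
    let b ← p a
    let r ← filterT p l
    op (if b then a :: r else r)

def allT {α : Type} (p : α → Timed Bool) : List α → Timed Bool
  | [] => op true
  | a :: l => do
    let b ← p a
    let r ← allT p l
    op (b && r)

def anyT {α : Type} (p : α → Timed Bool) : List α → Timed Bool
  | [] => op false
  | a :: l => do
    let b ← p a
    let r ← anyT p l
    op (b || r)

def lengthT {α : Type} (l : List α) : Timed ℕ := countT (fun _ => op true) l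

def appendT {α : Type} : List α → List α → Timed (List α)
  | [], l' => op l'
  | a :: l, l' => do
    let r ← appendT l l'
    op (a :: r)

def takeT {α : Type} : ℕ → List α → Timed (List α)
  | 0, _ => op []
  | _ + 1, [] => op []
  | i + 1, a :: l => do
    let r ← takeT i l
    op (a :: r)

section Algorithms

variable {m n : ℕ} (G : BipGraph m n)

def memT (x : Vertex m n) (l : List (Vertex m n)) : Timed Bool :=
  anyT (fun y => op (decide (x = y))) l

/-- Adjacency test, by a search in the adjacency list of `v`. -/
def adjT (v w : Vertex m n) : Timed Bool := memT w (G.adj v)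

/-- The vertices `v` and `w` lie on different sides and are not adjacent. -/
def nonAdjT (v w : Vertex m n) : Timed Bool :=
  if v.isLeft = w.isLeft then op false
  else do
    let b ← adjT G v w
    op (!b)

/-- Number of neighbours of `v` in `T`. -/
def degT (v : Vertex m n) (T : List (Vertex m n)) : Timed ℕ := countT (fun w => adjT G v w) T

/-- Number of non-neighbours of `v` in the part of `T` on the other side than `v`. -/
def nonDegT (v : Vertex m n) (T : List (Vertex m n)) : Timed ℕ :=
  countT (fun w => nonAdjT G v w) T

/-- Is `G[T]` a `k`-biplex? -/
def isBiplexT (k : ℕ) (T : List (Vertex m n)) : Timed Bool :=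
  allT (fun v => do
    let c ← nonDegT G v T
    op (decide (c ≤ k))) T

/-- Number of edges of `G[T]`. -/
def edgesT (T : List (Vertex m n)) : Timed ℕ :=
  foldT (fun e v =>
    if v.isLeft then do
      let c ← degT G v T
      op (e + c)
    else op e) 0 T

/-- Number of vertices of `T` on the left (`side = true`) or on the right (`side = false`). -/
def sideT (side : Bool) (T : List (Vertex m n)) : Timed ℕ :=
  countT (fun v => op (v.isLeft == side)) T

/-! ### FastBB -/

/-- Lower and upper bounds of the numbers of left and right vertices of the biplex searched for. -/
structure Bounds where
  lbL : ℚ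
  ubL : ℚ
  lbR : ℚ
  ubR : ℚ

/-- The best `k`-biplex found so far, with its number of edges. -/
structure Sol (m n : ℕ) where
  verts : List (Vertex m n)
  edges : ℕ

/-- `min δ(v, T) + k` over the vertices `v` of `S` on the given side; `none` stands for `∞` (no such
vertex). With `T = S ∪ C` this is `τ_L` for `side = false` and `τ_R` for `side = true`. -/
def tauT (k : ℕ) (side : Bool) (S T : List (Vertex m n)) : Timed (Option ℕ) :=
  foldT (fun t v =>
    if v.isLeft = side then do
      let c ← degT G v T
      op (match t with
        | none => some (c + k)
        | some x => some (min x (c + k)))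
    else op t) none S

/-- Pruning condition (4): some `v ∈ D` has at most `k` non-neighbours in `T = S ∪ C`, and is
adjacent to all vertices of `T` on the other side that have at least `k` non-neighbours in `T`. -/
def nonMaximalT (k : ℕ) (T D : List (Vertex m n)) : Timed Bool :=
  anyT (fun v => do
    let c ← nonDegT G v T
    let b ← allT (fun w =>
      if v.isLeft = w.isLeft then op true
      else do
        let cw ← nonDegT G w T
        let e ← adjT G v w
        op (decide (cw < k) || e)) T
    op (decide (c ≤ k) && b)) D

/-- Can the branch with partial set `S`, exclusion set `D` and `T = S ∪ C` be pruned? -/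
def pruneT (k : ℕ) (B : Bounds) (best : Sol m n) (S T D : List (Vertex m n)) : Timed Bool := do
  let biplex ← isBiplexT G k S
  let sL ← sideT true S
  let sR ← sideT false S
  let tauL ← tauT G k false S T
  let tauR ← tauT G k true S T
  let e ← edgesT G T
  let nonMax ← nonMaximalT G k T D
  let aboveUB ← op (decide (B.ubL < sL) || decide (B.ubR < sR))
  let belowL ← op (match tauL with
    | none => false
    | some t => decide ((t : ℚ) < B.lbL))
  let belowR ← op (match tauR with
    | none => false
    | some t => decide ((t : ℚ) < B.lbR))
  let fewEdges ← op (match tauL, tauR with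
    | some s, some t => decide (s * t ≤ best.edges)
    | _, _ => false)
  op (!biplex || aboveUB || belowL || belowR || decide (e ≤ best.edges) || fewEdges || nonMax)

/-- The first vertex of `l` with the most non-neighbours in `T`, if this number exceeds `k`. -/
def pivotT (k : ℕ) (T l : List (Vertex m n)) : Timed (Option (Vertex m n × ℕ)) :=
  foldT (fun p v => do
    let c ← nonDegT G v T
    op (match p with
      | none => if k < c then some (v, c) else none
      | some (w, c') => if c' < c then some (v, c) else some (w, c'))) none l

/-- The vertices `c` of `l` for which `G[S ∪ {c}]` is a `k`-biplex. -/
def refineT (k : ℕ) (S l : List (Vertex m n)) : Timed (List (Vertex m n)) :=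
  filterT (fun c => isBiplexT G k (c :: S)) l

/-- Sym-BK branching along `v_1, v_2, …`: the `i`-th branch includes `v_1, …, v_{i-1}` and excludes
`v_i`; its candidate and exclusion sets are refined. `recur S C D best` treats one branch. -/
def symBKT (k : ℕ)
    (recur : List (Vertex m n) → List (Vertex m n) → List (Vertex m n) → Sol m n → Timed (Sol m n)) :
    List (Vertex m n) → List (Vertex m n) → List (Vertex m n) → List (Vertex m n) → Sol m n →
      Timed (Sol m n)
  | [], _, _, _, best => op best
  | v :: vs, S, C, D, best => do
    let C' ← filterT (fun x => op (decide (x ≠ v))) C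
    let Ci ← refineT G k S C'
    let Di ← refineT G k S (v :: D)
    let best' ← recur S Ci Di best
    symBKT k recur vs (v :: S) C' D best'

/-- The recursive procedure of FastBB at the branch `(S, C, D)`. A biplex is
recorded only if it satisfies the lower bounds. The first argument only bounds the depth of the recursion; since `C` shrinks in each recursive call, a value above the length of `C` is
never exhausted. -/
def fastBBRec (k : ℕ) (B : Bounds) : ℕ → List (Vertex m n) → List (Vertex m n) →
    List (Vertex m n) → Sol m n → Timed (Sol m n)
  | 0, _, _, _, best => op best
  | fuel + 1, S, C, D, best => do
    let T ← appendT S C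
    let done ← isBiplexT G k T
    if done then do
      let e ← edgesT G T
      let tL ← sideT true T
      let tR ← sideT false T
      op (if best.edges < e ∧ B.lbL ≤ tL ∧ B.lbR ≤ tR then ⟨T, e⟩ else best)
    else do
      let pruned ← pruneT G k B best S T D
      if pruned then op best
      else do
        let pS ← pivotT G k T S
        match pS with
        | some (v, _) => do
          let s ← nonDegT G v S
          let U ← filterT (fun w => nonAdjT G v w) C
          let order ← takeT (k - s + 1) U
          symBKT G k (fastBBRec k B fuel) order S C D best
        | none => do
          let pC ← pivotT G k T C
          match pC with
          | some (v, _) => do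
            let s ← nonDegT G v S
            let U ← filterT (fun w => nonAdjT G v w) C
            let us ← takeT (k - s + 1) U
            symBKT G k (fastBBRec k B fuel) (v :: us) S C D best
          | none => op best

/-! ### The framework PBIE -/

/-- Memory of the core computation: which vertices were removed, and how many neighbours of each
vertex were removed. Fresh memory is zero. -/
structure CoreMem (m n : ℕ) where
  removed : Vertex m n → Bool
  lost : Vertex m n → ℕ

/-- Does `v` have fewer remaining neighbours than required (`α` on the left, `β` on the right)? -/
def lowT (α β : ℚ) (mem : CoreMem m n) (v : Vertex m n) : Timed Bool := do
  let c ← lengthT (G.adj v)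
  op (decide ((c : ℚ) - (mem.lost v : ℚ) < if v.isLeft then α else β))

/-- Peeling with a stack of vertices to be removed. The first argument only bounds the number of
rounds. -/
def peelT (α β : ℚ) : ℕ → List (Vertex m n) → CoreMem m n → Timed (CoreMem m n)
  | 0, _, mem => op mem
  | _ + 1, [], mem => op mem
  | fuel + 1, v :: stack, mem => do
    let r ← op (mem.removed v)
    if r then peelT α β fuel stack mem
    else do
      let mem' ← op (⟨Function.update mem.removed v true, mem.lost⟩ : CoreMem m n)
      let q ← foldT (fun (q : List (Vertex m n) × CoreMem m n) w => do
        let mem'' ← op (⟨q.2.removed, Function.update q.2.lost w (q.2.lost w + 1)⟩ : CoreMem m n)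
        let b ← lowT G α β mem'' w
        op (if b then (w :: q.1, mem'') else (q.1, mem''))) (stack, mem') (G.adj v)
      peelT α β fuel q.1 q.2

/-- The list of all vertices of `L`. -/
def leftList (m n : ℕ) : List (Vertex m n) := (List.finRange m).map Sum.inl

/-- The `(α, β)`-core of `G`, as the memory that marks the removed vertices. (Isolated vertices of
`R` are never looked at.) At most `|L| + 3|E|` vertices are put on the stack. -/
def coreT (α β : ℚ) : Timed (CoreMem m n) := do
  let mem ← op (⟨fun _ => false, fun _ => 0⟩ : CoreMem m n)
  let stack ← foldT (fun stack v => do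
    let b ← lowT G α β mem v
    let stack' ← op (if b then v :: stack else stack)
    foldT (fun stack u => do
      let b ← lowT G α β mem u
      op (if b then u :: stack else stack)) stack' (G.adj v)) [] (leftList m n)
  peelT G α β (m + 3 * m * n + 1) stack mem

def insertT (x : Vertex m n) (l : List (Vertex m n)) : Timed (List (Vertex m n)) := do
  let b ← memT x l
  op (if b then l else x :: l)

/-- Adds to `acc` the neighbours of `v` in the core, without repetitions. -/
def addNbrsT (mem : CoreMem m n) (acc : List (Vertex m n)) (v : Vertex m n) :
    Timed (List (Vertex m n)) :=
  foldT (fun acc u => do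
    let r ← op (mem.removed u)
    if r then op acc else insertT u acc) acc (G.adj v)

/-- The inclusion-exclusion step for `v = v_j` in the core: build the subgraph of the vertices
within two hops of `v_j`, prune it by degrees, and run FastBB from the branch with `S = {v_j}`. The
exclusion set `D` holds the preceding vertices within two hops of `v_j`: no preceding vertex further
away is in a `k`-biplex with `v_j` that has more than `2k` right vertices. -/
def ieStepT (k : ℕ) (B : Bounds) (mem : CoreMem m n) (best : Sol m n) (j : Fin m) :
    Timed (Sol m n) := do
  let v ← op (Sum.inl j : Vertex m n)
  let r ← op (mem.removed v)
  if r then op best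
  else do
    let near ← addNbrsT G mem [] v
    let hop ← foldT (fun acc u => addNbrsT G mem acc u) [] near
    let later ← filterT (fun w => op (match w with
      | Sum.inl i => decide (j < i)
      | Sum.inr _ => false)) hop
    let D ← filterT (fun w => op (match w with
      | Sum.inl i => decide (i < j)
      | Sum.inr _ => false)) hop
    let Lj ← op (v :: later)
    let Rj ← foldT (fun acc w => addNbrsT G mem acc w) [] Lj
    let CL ← filterT (fun w => do
      let c ← degT G w Rj
      let c' ← countT (fun u => do
        let b ← adjT G w u
        let b' ← adjT G v u
        op (b && b')) Rj
      op (decide (B.lbR - k ≤ c) && decide (B.lbR - 2 * k ≤ c'))) later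
    let CR ← filterT (fun u => do
      let c ← degT G u Lj
      op (decide (B.lbL - k ≤ c))) Rj
    let C ← appendT CL CR
    fastBBRec G k B (C.length + 1) [v] C D best

/-- The progressive bounding loop, with `lbL` the lower bound of the left side in the preceding
round. A round is the last one if its lower bound has reached `θL`. The first argument only bounds
the number of rounds. -/
def pbLoopT (k θL θR dL : ℕ) : ℕ → ℚ → Sol m n → Timed (Sol m n)
  | 0, _, best => op best
  | fuel + 1, lbL, best => do
    let B ← op (⟨max (lbL / 2) θL, lbL, max ((best.edges : ℚ) / lbL) θR, (dL : ℚ) + k⟩ : Bounds)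
    let mem ← coreT G (B.lbR - k) (B.lbL - k)
    let best' ← foldT (fun b j => ieStepT G k B mem b j) best (List.finRange m)
    let finished ← op (decide (B.lbL ≤ θL))
    if finished then op best' else pbLoopT k θL θR dL fuel B.lbL best'

/-- PBIE with FastBB. The maximum degrees of both sides are found by a scan of the edges. -/
def pbieT (k θL θR : ℕ) : Timed (Sol m n) := do
  let dL ← foldT (fun x v => do
    let c ← lengthT (G.adj v)
    op (max x c)) 0 (leftList m n)
  let dR ← foldT (fun x v =>
    foldT (fun x u => do
      let c ← lengthT (G.adj u)
      op (max x c)) x (G.adj v)) 0 (leftList m n)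
  pbLoopT G k θL θR dL (dR + k + 1) ((dR : ℚ) + k) ⟨[], 0⟩

end Algorithms

/-- The left side of the output. -/
def Sol.left {m n : ℕ} (H : Sol m n) : Finset (Fin m) :=
  (H.verts.filterMap Sum.getLeft?).toFinset

/-- The right side of the output. -/
def Sol.right {m n : ℕ} (H : Sol m n) : Finset (Fin n) :=
  (H.verts.filterMap Sum.getRight?).toFinset

end PBIE

namespace PBIE

/-! ### The root `γ_k` -/

/-! Correctness. A `k`-biplex with more than `k` vertices on both sides gains an edge with every
vertex by which it can grow. So the biplexes with the most edges among all large `k`-biplexes,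
maximal or not, are MaxBPs (`isMaxBP_of_forall_le`), and it suffices that the search ends with at
least as many edges as such an optimum `(X, Y)`. Since `Y` has more than `2k` vertices, any two
vertices of `X` have a common neighbour in `Y`. Hence `(X, Y)` lies around the first vertex `v_j` of
`X`, and its own degrees protect it from the peeling (`coreT_keeps`) and from the degree filters
(`IsSetup.subset`).

Inside FastBB the branch to follow is the one with `S ⊆ P ⊆ S ∪ C`, where `P` is the vertex set of
the optimum. Each pruning test that fires there contradicts a property of `P`, unless the record is
already as good (`IsTarget.pruneT_eq_false`). The branching list always has a vertex outside `P`
(`orderT_val`), and the first such vertex singles out the child in which the inclusions persist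
(`symBKT_complete`, `IsTarget.le_fastBBRec`). In the outer loop the intervals from `LB_L` to `UB_L`
cover all possible values of `|X|`. In the round of `|X|` the bound `LB_R` is harmless because
`|E(H*)| ≤ |X| |Y| ≤ UB_L |Y|` (`IsOptimal.le_pbLoopT`).

Running time. No branching recurrence with characteristic root `γ_k` is solved; only `3 / 2 ≤ γ_k`
is used. A partial set that is branched on is a `k`-biplex containing `v_j`, so it has at most `d ^
2 + 1` left and `d + k` right vertices (`IsSetup.length_biplex_le`). If `k < d`, only `O(d ^ 2)` of
at most `3 d ^ 3` candidates are ever included together. A binary tree with `c` decisions and at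
most `M` inclusions on a path has at most `(1 + x) ^ c * x ^ (-M)` leaves for every `0 < x ≤ 1`.
With `x = 1 / 10` this is `1.331 ^ (d ^ 3)` times `10 ^ O(d ^ 2)` (`fastBBRec_cost_le`), which stays
below a constant times `(3 / 2) ^ (d ^ 3)` even after polynomial factors (`exists_stepBound_le`). If
`k ≥ d`, the degree filters leave no candidates at all. The lower bound is halved in each round, so
there are logarithmically many rounds. -/

theorem gammaRoot_isGreatest (k : ℕ) (hk : 1 ≤ k) :
    IsGreatest {x : ℝ | 0 < x ∧ x ^ (k + 4) - 2 * x ^ (k + 3) + x ^ 2 - x + 1 = 0}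
      (gammaRoot k) ∧ gammaRoot k < 2 ∧ 3 / 2 ≤ gammaRoot k := by
  set f : ℝ → ℝ := fun x => x ^ (k + 4) - 2 * x ^ (k + 3) + x ^ 2 - x + 1 with hf
  have hfc : Continuous f := by fun_prop
  have hfe : ∀ x, f x = x ^ (k + 3) * (x - 2) + (x ^ 2 - x + 1) := fun x => by
    simp only [hf]; ring
  have hbig : ∀ x : ℝ, 2 ≤ x → 0 < f x := fun x hx => by
    rw [hfe]
    have h1 : 0 ≤ x ^ (k + 3) * (x - 2) := mul_nonneg (by positivity) (by linarith)
    nlinarith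
  -- The value is `7 / 4 - (3 / 2) ^ (k + 3) / 2`, and `(3 / 2) ^ 4 = 81 / 16` exceeds `7 / 2`. The
  -- resulting root in `[3 / 2, 2]` gives the lower bound on `γ_k` that the running time needs.
  have hneg : f (3 / 2) ≤ 0 := by
    rw [hfe]
    have h1 : (3 / 2 : ℝ) ^ 4 ≤ (3 / 2) ^ (k + 3) :=
      pow_le_pow_right₀ (by norm_num) (by omega)
    norm_num at h1 ⊢
    linarith
  set s : Set ℝ := {x : ℝ | 0 < x ∧ f x = 0} with hs
  -- Zero is not a root, so `0 < x` may be weakened to the closed condition `0 ≤ x`; a closed set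
  -- contains its supremum.
  have hse : s = {x : ℝ | 0 ≤ x ∧ f x = 0} := by
    ext x
    simp only [hs, Set.mem_ofPred_eq]
    constructor
    · exact fun h => ⟨h.1.le, h.2⟩
    · rintro ⟨h1, h2⟩
      refine ⟨lt_of_le_of_ne h1 ?_, h2⟩
      rintro rfl
      simp [hf] at h2
  have hclosed : IsClosed s := by
    rw [hse]
    exact isClosed_Ici.inter (isClosed_singleton.preimage hfc)
  have hbdd : BddAbove s := ⟨2, fun x hx => by
    by_contra! h
    exact (hbig x h.le).ne' hx.2⟩
  obtain ⟨r, hr, hr0⟩ : ∃ r ∈ Set.Icc (3 / 2 : ℝ) 2, f r = 0 :=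
    intermediate_value_Icc (by norm_num) hfc.continuousOn ⟨hneg, (hbig 2 le_rfl).le⟩
  have hrs : r ∈ s := ⟨by linarith [hr.1], hr0⟩
  have hmem : gammaRoot k ∈ s := hclosed.csSup_mem ⟨r, hrs⟩ hbdd
  refine ⟨⟨hmem, fun x hx => le_csSup hbdd hx⟩, ?_, hr.1.trans (le_csSup hbdd hrs)⟩
  by_contra! h
  exact (hbig _ h).ne' hmem.2

/-! ### Biplexes, cores and the subgraphs around a vertex -/

section Graph

variable {m n : ℕ} (G : BipGraph m n)

theorem card_nbrR_add_card_nonNbrR (v : Fin m) (Y : Finset (Fin n)) :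
    (nbrR G v Y).card + (nonNbrR G v Y).card = Y.card :=
  Finset.card_filter_add_card_filter_not _

theorem card_nbrL_add_card_nonNbrL (u : Fin n) (X : Finset (Fin m)) :
    (nbrL G u X).card + (nonNbrL G u X).card = X.card :=
  Finset.card_filter_add_card_filter_not _

theorem card_nbrR_le_maxDeg (v : Fin m) : (nbrR G v Finset.univ).card ≤ maxDeg G :=
  (Finset.le_sup (f := fun v : Fin m => (nbrR G v Finset.univ).card)
    (Finset.mem_univ v)).trans (le_max_left _ _)

theorem card_nbrL_le_maxDeg (u : Fin n) : (nbrL G u Finset.univ).card ≤ maxDeg G :=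
  (Finset.le_sup (f := fun u : Fin n => (nbrL G u Finset.univ).card)
    (Finset.mem_univ u)).trans (le_max_right _ _)

theorem nbrR_mono (v : Fin m) {Y Y' : Finset (Fin n)} (h : Y ⊆ Y') : nbrR G v Y ⊆ nbrR G v Y' :=
  Finset.filter_subset_filter _ h

theorem nbrL_mono (u : Fin n) {X X' : Finset (Fin m)} (h : X ⊆ X') : nbrL G u X ⊆ nbrL G u X' :=
  Finset.filter_subset_filter _ h

variable {G}

theorem IsBiplex.hasMinDegs {k p q : ℕ} {X : Finset (Fin m)} {Y : Finset (Fin n)}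
    (h : IsBiplex G k X Y) (hp : p ≤ X.card) (hq : q ≤ Y.card) :
    HasMinDegs G (q - k) (p - k) X Y := by
  refine ⟨fun v hv => ?_, fun u hu => ?_⟩
  · have h1 := h.1 v hv
    have h2 := card_nbrR_add_card_nonNbrR G v Y
    omega
  · have h1 := h.2 u hu
    have h2 := card_nbrL_add_card_nonNbrL G u X
    omega

/-- Each vertex misses at most `k` vertices of the other side, so the biplex itself is one of the
subgraphs that the core dominates. Truncated subtraction plays the role of `max (q - k) 0`. -/
theorem IsBiplex.subset_core {k p q : ℕ} {A X : Finset (Fin m)} {B Y : Finset (Fin n)}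
    (hc : IsCore G (q - k) (p - k) A B) (h : IsBiplex G k X Y) (hp : p ≤ X.card)
    (hq : q ≤ Y.card) : X ⊆ A ∧ Y ⊆ B :=
  hc.2 X Y (h.hasMinDegs hp hq)

/-- Two left vertices of a `k`-biplex have all but `2k` right vertices as common neighbours. -/
theorem IsBiplex.card_common {k : ℕ} {X : Finset (Fin m)} {Y : Finset (Fin n)}
    (h : IsBiplex G k X Y) {v w : Fin m} (hv : v ∈ X) (hw : w ∈ X) :
    Y.card ≤ (nbrR G v Y ∩ nbrR G w Y).card + 2 * k := by
  have h1 := h.1 v hv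
  have h2 := h.1 w hw
  have h3 : Y ⊆ (nbrR G v Y ∩ nbrR G w Y) ∪ (nonNbrR G v Y ∪ nonNbrR G w Y) := by
    intro u hu
    simp only [nbrR, nonNbrR, Finset.mem_union, Finset.mem_inter, Finset.mem_filter]
    tauto
  have h4 := (Finset.card_le_card h3).trans (Finset.card_union_le _ _)
  have h5 := Finset.card_union_le (nonNbrR G v Y) (nonNbrR G w Y)
  omega

/-- Here `θ_R ≥ 2k + 1` enters: the count of common neighbours becomes positive, which confines a
large biplex to the two-hop neighbourhood of any of its left vertices. -/
theorem IsBiplex.exists_common {k : ℕ} {X : Finset (Fin m)} {Y : Finset (Fin n)}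
    (h : IsBiplex G k X Y) (hY : 2 * k + 1 ≤ Y.card) {v w : Fin m} (hv : v ∈ X) (hw : w ∈ X) :
    ∃ u ∈ Y, Edge G v u ∧ Edge G w u := by
  have h1 := h.card_common hv hw
  obtain ⟨u, hu⟩ : (nbrR G v Y ∩ nbrR G w Y).Nonempty := by
    rw [← Finset.card_pos]; omega
  simp only [nbrR, Finset.mem_inter, Finset.mem_filter] at hu
  exact ⟨u, hu.1.1, hu.1.2, hu.2.2⟩

theorem IsBiplex.exists_nbrL {k : ℕ} {X : Finset (Fin m)} {Y : Finset (Fin n)}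
    (h : IsBiplex G k X Y) (hX : k + 1 ≤ X.card) {u : Fin n} (hu : u ∈ Y) :
    ∃ v ∈ X, Edge G v u := by
  have h1 := h.2 u hu
  have h2 := card_nbrL_add_card_nonNbrL G u X
  obtain ⟨v, hv⟩ : (nbrL G u X).Nonempty := by
    rw [← Finset.card_pos]; omega
  exact ⟨v, (Finset.mem_filter.1 hv).1, (Finset.mem_filter.1 hv).2⟩

theorem IsBiplex.exists_nbrR {k : ℕ} {X : Finset (Fin m)} {Y : Finset (Fin n)}
    (h : IsBiplex G k X Y) (hY : k + 1 ≤ Y.card) {v : Fin m} (hv : v ∈ X) :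
    ∃ u ∈ Y, Edge G v u := by
  have h1 := h.1 v hv
  have h2 := card_nbrR_add_card_nonNbrR G v Y
  obtain ⟨u, hu⟩ : (nbrR G v Y).Nonempty := by
    rw [← Finset.card_pos]; omega
  exact ⟨u, (Finset.mem_filter.1 hu).1, (Finset.mem_filter.1 hu).2⟩

/-- If `i` is the first vertex of `X`, then dropping the vertices that precede `i` costs nothing.
Right vertices are reached because each of them has a neighbour in `X`. -/
theorem IsBiplex.subset_sub {k : ℕ} {X : Finset (Fin m)} {Y : Finset (Fin n)}
    (h : IsBiplex G k X Y) (hX : k + 1 ≤ X.card) (hY : 2 * k + 1 ≤ Y.card) {i : Fin m}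
    (hi : i ∈ X) (hmin : ∀ w ∈ X, i ≤ w) : X ⊆ subL G i ∧ Y ⊆ subR G i := by
  have hXL : X ⊆ subL G i := by
    intro w hw
    obtain ⟨u, -, h1, h2⟩ := h.exists_common hY hi hw
    simp only [subL, Finset.mem_filter, Finset.mem_univ, true_and]
    exact ⟨hmin w hw, Or.inr ⟨u, h1, h2⟩⟩
  refine ⟨hXL, fun u hu => ?_⟩
  obtain ⟨v, hv, hvu⟩ := h.exists_nbrL hX hu
  simp only [subR, Finset.mem_filter, Finset.mem_univ, true_and]
  exact ⟨v, hXL hv, hvu⟩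

theorem IsMaxBP.exists_sub {k θL θR : ℕ} (hL : 2 * k + 1 ≤ θL)
    (hR : 2 * k + 1 ≤ θR) {X : Finset (Fin m)} {Y : Finset (Fin n)}
    (h : IsMaxBP G k θL θR X Y) :
    ∃ i ∈ X, X ⊆ subL G i ∧ Y ⊆ subR G i ∧
      (∀ v ∈ X, θR ≤ (nbrR G v (subR G i)).card + k ∧
        θR ≤ (nbrR G v (subR G i) ∩ nbrR G i Finset.univ).card + 2 * k) ∧
      (∀ u ∈ Y, θL ≤ (nbrL G u (subL G i)).card + k) := by
  obtain ⟨⟨⟨hb, -⟩, hX, hY⟩, -⟩ := h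
  have hne : X.Nonempty := by rw [← Finset.card_pos]; omega
  obtain ⟨i, hi, hmin⟩ : ∃ i ∈ X, ∀ w ∈ X, i ≤ w :=
    ⟨X.min' hne, X.min'_mem hne, fun w hw => X.min'_le w hw⟩
  obtain ⟨hXL, hYR⟩ := hb.subset_sub (by omega) (by omega) hi hmin
  have hd := hb.hasMinDegs hX hY
  refine ⟨i, hi, hXL, hYR, fun v hv => ⟨?_, ?_⟩, fun u hu => ?_⟩
  · have h1 := hd.1 v hv
    have h2 := Finset.card_le_card (nbrR_mono G v hYR)
    omega
  · have h1 := hb.card_common hv hi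
    have h2 := Finset.card_le_card
      (Finset.inter_subset_inter (nbrR_mono G v hYR) (nbrR_mono G i (Finset.subset_univ Y)))
    omega
  · have h1 := hd.2 u hu
    have h2 := Finset.card_le_card (nbrL_mono G u hXL)
    omega

variable (G)

/-- Count two-hop paths from `v_i`: each of its at most `d` neighbours has already spent one edge on
`v_i`, which leaves `d - 1` continuations. -/
theorem card_subL_erase_le (i : Fin m) :
    ((subL G i).erase i).card ≤ maxDeg G * (maxDeg G - 1) := by
  have h1 : (subL G i).erase i ⊆
      (nbrR G i Finset.univ).biUnion fun u => (nbrL G u Finset.univ).erase i := by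
    intro w hw
    simp only [subL, Finset.mem_erase, Finset.mem_filter, Finset.mem_univ, true_and] at hw
    obtain ⟨hne, -, rfl | ⟨u, h1, h2⟩⟩ := hw
    · exact absurd rfl hne
    · simp only [Finset.mem_biUnion, nbrR, nbrL, Finset.mem_filter, Finset.mem_univ, true_and,
        Finset.mem_erase]
      exact ⟨u, h1, hne, h2⟩
  refine (Finset.card_le_card h1).trans ((Finset.card_biUnion_le_card_mul _ _ (maxDeg G - 1)
    fun u hu => ?_).trans (Nat.mul_le_mul_right _ (card_nbrR_le_maxDeg G i)))
  rw [Finset.card_erase_of_mem]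
  · exact Nat.sub_le_sub_right (card_nbrL_le_maxDeg G u) 1
  · simpa [nbrR, nbrL] using hu

/-- Every other vertex of `L_i` shares a neighbour with `v_i`, so it contributes at most `d - 1`
right vertices that are not adjacent to `v_i`. -/
theorem card_subR_le (i : Fin m) :
    (subR G i).card ≤ maxDeg G + ((subL G i).erase i).card * (maxDeg G - 1) := by
  have h1 : subR G i ⊆ nbrR G i Finset.univ ∪
      ((subL G i).erase i).biUnion fun w => nbrR G w Finset.univ \ nbrR G i Finset.univ := by
    intro u hu
    simp only [subR, Finset.mem_filter, Finset.mem_univ, true_and] at hu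
    obtain ⟨w, hw, hwu⟩ := hu
    simp only [Finset.mem_union, Finset.mem_biUnion, Finset.mem_sdiff, nbrR, Finset.mem_filter,
      Finset.mem_univ, true_and, Finset.mem_erase]
    by_cases h : Edge G i u
    · exact Or.inl h
    · refine Or.inr ⟨w, ⟨?_, hw⟩, hwu, h⟩
      rintro rfl
      exact h hwu
  refine (Finset.card_le_card h1).trans ((Finset.card_union_le _ _).trans
    (Nat.add_le_add (card_nbrR_le_maxDeg G i) (Finset.card_biUnion_le_card_mul _ _ _ ?_)))
  intro w hw
  simp only [subL, Finset.mem_erase, Finset.mem_filter, Finset.mem_univ, true_and] at hw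
  obtain ⟨hne, -, rfl | ⟨u, h1, h2⟩⟩ := hw
  · exact absurd rfl hne
  · have h3 : nbrR G w Finset.univ \ nbrR G i Finset.univ ⊆ (nbrR G w Finset.univ).erase u := by
      intro x hx
      simp only [Finset.mem_sdiff, nbrR, Finset.mem_filter, Finset.mem_univ, true_and,
        Finset.mem_erase] at hx ⊢
      refine ⟨?_, hx.1⟩
      rintro rfl
      exact hx.2 h1
    refine (Finset.card_le_card h3).trans ?_
    rw [Finset.card_erase_of_mem (by simpa [nbrR] using h2)]
    exact Nat.sub_le_sub_right (card_nbrR_le_maxDeg G w) 1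

/-- The two counts add up to `d ^ 3 - d ^ 2 + d + 1`, which is at most `d ^ 3` as soon as `d ^ 2 ≥ d
+ 1`, that is, for `d ≥ 2`. Writing `d = e + 2` removes the truncated subtraction. -/
theorem card_subL_add_card_subR_le (hd : 2 ≤ maxDeg G) (i : Fin m) :
    (subL G i).card + (subR G i).card ≤ maxDeg G ^ 3 := by
  have h1 := card_subL_erase_le G i
  have h2 := card_subR_le G i
  have h3 : (subL G i).card ≤ ((subL G i).erase i).card + 1 := by
    have := Finset.pred_card_le_card_erase (s := subL G i) (a := i)
    omega
  obtain ⟨e, he⟩ : ∃ e, maxDeg G = e + 2 := ⟨maxDeg G - 2, by omega⟩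
  rw [he] at h1 h2 ⊢
  have h4 : e + 2 - 1 = e + 1 := by omega
  rw [h4] at h1 h2
  nlinarith [Nat.mul_le_mul_right (e + 1) h1]

/-! ### Edge counts of biplexes -/

theorem numEdges_mono {X X' : Finset (Fin m)} {Y Y' : Finset (Fin n)} (hX : X ⊆ X')
    (hY : Y ⊆ Y') : numEdges G X Y ≤ numEdges G X' Y' :=
  (Finset.sum_le_sum fun _ _ => Finset.card_le_card (nbrR_mono G _ hY)).trans
    (Finset.sum_le_sum_of_subset hX)

theorem numEdges_le_mul (X : Finset (Fin m)) (Y : Finset (Fin n)) :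
    numEdges G X Y ≤ X.card * Y.card :=
  Finset.sum_le_card_nsmul _ _ _ fun _ _ => Finset.card_le_card (Finset.filter_subset _ Y)

variable {G}

theorem IsBiplex.numEdges_pos {k : ℕ} {X : Finset (Fin m)} {Y : Finset (Fin n)}
    (h : IsBiplex G k X Y) (hX : k + 1 ≤ X.card) (hY : k + 1 ≤ Y.card) :
    0 < numEdges G X Y := by
  obtain ⟨v, hv⟩ : X.Nonempty := by rw [← Finset.card_pos]; omega
  obtain ⟨u, hu, hvu⟩ := h.exists_nbrR hY hv
  exact Finset.sum_pos' (fun _ _ => Nat.zero_le _)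
    ⟨v, hv, Finset.card_pos.2 ⟨u, Finset.mem_filter.2 ⟨hu, hvu⟩⟩⟩

/-- A `k`-biplex with more than `k` vertices on both sides has more edges than any proper
sub-biplex of this size. -/
theorem IsBiplex.eq_of_numEdges_le {k : ℕ} {X X' : Finset (Fin m)} {Y Y' : Finset (Fin n)}
    (h : IsBiplex G k X' Y') (hXX : X ⊆ X') (hYY : Y ⊆ Y') (hX : k + 1 ≤ X.card)
    (hY : k + 1 ≤ Y.card) (he : numEdges G X' Y' ≤ numEdges G X Y) : X' = X ∧ Y' = Y := by
  have hXe : X' = X := by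
    by_contra hne
    obtain ⟨v, hv, hv'⟩ : ∃ v ∈ X', v ∉ X := by
      by_contra! hcon
      exact hne (Finset.Subset.antisymm hcon hXX)
    -- A new left vertex misses at most `k` vertices of `Y'`, hence sees one and brings an edge. New
    -- right vertices are treated in the same way below.
    obtain ⟨u, hu, hvu⟩ := h.exists_nbrR (hY.trans (Finset.card_le_card hYY)) hv
    have h1 : numEdges G X Y ≤ numEdges G X Y' := numEdges_mono G le_rfl hYY
    have h2 : numEdges G X Y' < numEdges G X' Y' :=
      Finset.sum_lt_sum_of_subset hXX hv hv'
        (Finset.card_pos.2 ⟨u, Finset.mem_filter.2 ⟨hu, hvu⟩⟩) fun _ _ _ => Nat.zero_le _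
    omega
  refine ⟨hXe, ?_⟩
  subst hXe
  by_contra hne
  obtain ⟨u, hu, hu'⟩ : ∃ u ∈ Y', u ∉ Y := by
    by_contra! hcon
    exact hne (Finset.Subset.antisymm hcon hYY)
  obtain ⟨v, hv, hvu⟩ := h.exists_nbrL hX hu
  have h2 : numEdges G X' Y < numEdges G X' Y' := by
    refine Finset.sum_lt_sum (fun v _ => Finset.card_le_card (nbrR_mono G v hYY))
      ⟨v, hv, Finset.card_lt_card ?_⟩
    refine (Finset.ssubset_iff_of_subset (nbrR_mono G v hYY)).2 ⟨u, ?_, ?_⟩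
    · exact Finset.mem_filter.2 ⟨hu, hvu⟩
    · exact fun hx => hu' (Finset.mem_filter.1 hx).1
  omega

/-- A biplex with the most edges among all biplexes that are large enough is a MaxBP. -/
theorem isMaxBP_of_forall_le {k θL θR : ℕ} (hL : k + 1 ≤ θL) (hR : k + 1 ≤ θR)
    {X : Finset (Fin m)} {Y : Finset (Fin n)} (h : IsBiplex G k X Y) (hX : θL ≤ X.card)
    (hY : θR ≤ Y.card)
    (hmax : ∀ X' Y', IsBiplex G k X' Y' → θL ≤ X'.card → θR ≤ Y'.card →
      numEdges G X' Y' ≤ numEdges G X Y) : IsMaxBP G k θL θR X Y := by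
  refine ⟨⟨⟨h, fun X' Y' h' hXX hYY => ?_⟩, hX, hY⟩, fun X' Y' h' h1 h2 => hmax X' Y' h'.1 h1 h2⟩
  exact h'.eq_of_numEdges_le hXX hYY (hL.trans hX) (hR.trans hY)
    (hmax X' Y' h' (hX.trans (Finset.card_le_card hXX)) (hY.trans (Finset.card_le_card hYY)))

end Graph

/-! ### Results and costs of the basic loops -/

section Timed

variable {α β : Type}

@[simp] theorem val_pure (a : α) : (pure a : Timed α).val = a := rfl

@[simp] theorem val_bind (x : Timed α) (f : α → Timed β) : (x >>= f).val = (f x.val).val := rfl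

@[simp] theorem cost_bind (x : Timed α) (f : α → Timed β) :
    (x >>= f).cost = x.cost + (f x.val).cost := rfl

@[simp] theorem val_op (a : α) : (op a).val = a := rfl

@[simp] theorem cost_op (a : α) : (op a).cost = 1 := rfl

theorem val_op_bind (a : α) (f : α → Timed β) : (op a >>= f).val = (f a).val := rfl

theorem cost_op_bind (a : α) (f : α → Timed β) : (op a >>= f).cost = 1 + (f a).cost := rfl

@[simp] theorem foldT_val (f : β → α → Timed β) (b : β) (l : List α) :
    (foldT f b l).val = l.foldl (fun b a => (f b a).val) b := by
  induction l generalizing b with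
  | nil => rfl
  | cons a l ih => simp [foldT, ih]

@[simp] theorem countT_val (p : α → Timed Bool) (l : List α) :
    (countT p l).val = l.countP fun a => (p a).val := by
  induction l with
  | nil => rfl
  | cons a l ih =>
    simp only [countT, val_bind, val_op, ih, List.countP_cons]
    split <;> simp

@[simp] theorem filterT_val (p : α → Timed Bool) (l : List α) :
    (filterT p l).val = l.filter fun a => (p a).val := by
  induction l with
  | nil => rfl
  | cons a l ih => simp only [filterT, val_bind, val_op, ih, List.filter_cons]

@[simp] theorem allT_val (p : α → Timed Bool) (l : List α) :
    (allT p l).val = l.all fun a => (p a).val := by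
  induction l with
  | nil => rfl
  | cons a l ih => simp [allT, ih]

@[simp] theorem anyT_val (p : α → Timed Bool) (l : List α) :
    (anyT p l).val = l.any fun a => (p a).val := by
  induction l with
  | nil => rfl
  | cons a l ih => simp [anyT, ih]

@[simp] theorem lengthT_val (l : List α) : (lengthT l).val = l.length := by
  simp [lengthT]

@[simp] theorem appendT_val (l l' : List α) : (appendT l l').val = l ++ l' := by
  induction l with
  | nil => rfl
  | cons a l ih => simp [appendT, ih]

@[simp] theorem takeT_val (i : ℕ) (l : List α) : (takeT i l).val = l.take i := by
  induction l generalizing i with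
  | nil => cases i <;> simp [takeT]
  | cons a l ih => cases i <;> simp [takeT, ih]

/-- The invariant `P` is carried along because the cost of the body may depend on the accumulator,
for example when it searches the list built so far. -/
theorem foldT_cost_le {f : β → α → Timed β} {l : List α} {K : ℕ} (P : β → Prop)
    (hf : ∀ b, ∀ a ∈ l, P b → (f b a).cost ≤ K ∧ P (f b a).val) {b : β} (hb : P b) :
    (foldT f b l).cost ≤ l.length * (K + 1) + 1 ∧ P (foldT f b l).val := by
  induction l generalizing b with
  | nil => exact ⟨by simp [foldT], hb⟩
  | cons a l ih =>
    have h1 := hf b a (by simp) hb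
    have h2 := ih (fun b a ha => hf b a (by simp [ha])) h1.2
    refine ⟨?_, h2.2⟩
    simp only [foldT, cost_bind, val_op, cost_op, List.length_cons]
    rw [add_mul]
    omega

theorem foldT_cost_le_const {f : β → α → Timed β} {l : List α} {K : ℕ}
    (hf : ∀ b, ∀ a ∈ l, (f b a).cost ≤ K) (b : β) :
    (foldT f b l).cost ≤ l.length * (K + 1) + 1 :=
  (foldT_cost_le (fun _ => True) (fun b a ha _ => ⟨hf b a ha, trivial⟩) trivial).1

theorem countT_cost_le {p : α → Timed Bool} {l : List α} {K : ℕ}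
    (hp : ∀ a ∈ l, (p a).cost ≤ K) : (countT p l).cost ≤ l.length * (K + 1) + 1 := by
  induction l with
  | nil => simp [countT]
  | cons a l ih =>
    have h1 := hp a (by simp)
    have h2 := ih fun a ha => hp a (by simp [ha])
    simp only [countT, cost_bind, cost_op, List.length_cons]
    rw [add_mul]
    omega

theorem filterT_cost_le {p : α → Timed Bool} {l : List α} {K : ℕ}
    (hp : ∀ a ∈ l, (p a).cost ≤ K) : (filterT p l).cost ≤ l.length * (K + 1) + 1 := by
  induction l with
  | nil => simp [filterT]
  | cons a l ih =>
    have h1 := hp a (by simp)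
    have h2 := ih fun a ha => hp a (by simp [ha])
    simp only [filterT, cost_bind, cost_op, List.length_cons]
    rw [add_mul]
    omega

theorem allT_cost_le {p : α → Timed Bool} {l : List α} {K : ℕ}
    (hp : ∀ a ∈ l, (p a).cost ≤ K) : (allT p l).cost ≤ l.length * (K + 1) + 1 := by
  induction l with
  | nil => simp [allT]
  | cons a l ih =>
    have h1 := hp a (by simp)
    have h2 := ih fun a ha => hp a (by simp [ha])
    simp only [allT, cost_bind, cost_op, List.length_cons]
    rw [add_mul]
    omega

theorem anyT_cost_le {p : α → Timed Bool} {l : List α} {K : ℕ}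
    (hp : ∀ a ∈ l, (p a).cost ≤ K) : (anyT p l).cost ≤ l.length * (K + 1) + 1 := by
  induction l with
  | nil => simp [anyT]
  | cons a l ih =>
    have h1 := hp a (by simp)
    have h2 := ih fun a ha => hp a (by simp [ha])
    simp only [anyT, cost_bind, cost_op, List.length_cons]
    rw [add_mul]
    omega

theorem lengthT_cost_le (l : List α) : (lengthT l).cost ≤ l.length * 2 + 1 :=
  countT_cost_le fun _ _ => le_rfl

theorem appendT_cost_le (l l' : List α) : (appendT l l').cost ≤ l.length + 1 := by
  induction l with
  | nil => simp [appendT]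
  | cons a l ih =>
    simp only [appendT, cost_bind, cost_op, List.length_cons]
    omega

theorem takeT_cost_le (i : ℕ) (l : List α) : (takeT i l).cost ≤ l.length + 1 := by
  induction l generalizing i with
  | nil => cases i <;> simp [takeT]
  | cons a l ih =>
    cases i with
    | zero => simp [takeT]
    | succ i =>
      have := ih i
      simp only [takeT, cost_bind, cost_op, List.length_cons]
      omega

end Timed

/-! ### Vertex sets

The two sides of a bipartite subgraph are handled together, as a finite set or a list without
repetitions of vertices. -/

section VertexSets

variable {m n : ℕ} (G : BipGraph m n)

instance (x : Vertex m n) (l : List (Vertex m n)) : Decidable (x ∈ l) :=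
  decidable_of_iff (∃ y ∈ l, y = x) (by simp)

/-- `v` and `w` are non-adjacent vertices on different sides. -/
def NonAdj (v w : Vertex m n) : Prop := v.isLeft ≠ w.isLeft ∧ w ∉ G.adj v

instance (v w : Vertex m n) : Decidable (NonAdj G v w) := inferInstanceAs (Decidable (_ ∧ _))

variable {G} in
theorem NonAdj.symm {v w : Vertex m n} (h : NonAdj G v w) : NonAdj G w v :=
  ⟨h.1.symm, fun hv => h.2 (G.symm _ _ hv)⟩

/-- The number of non-neighbours of `v` in `P`. -/
def nonDeg (v : Vertex m n) (P : Finset (Vertex m n)) : ℕ := (P.filter (NonAdj G v)).card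

/-- The number of neighbours of `v` in `P`. -/
def degIn (v : Vertex m n) (P : Finset (Vertex m n)) : ℕ := (P.filter (· ∈ G.adj v)).card

/-- The subgraph induced by `P` is a `k`-biplex. -/
def VBiplex (k : ℕ) (P : Finset (Vertex m n)) : Prop := ∀ v ∈ P, nonDeg G v P ≤ k

/-- The number of edges of the subgraph induced by `P`. -/
def vEdges (P : Finset (Vertex m n)) : ℕ := ∑ v ∈ P.filter (·.isLeft), degIn G v P

/-- The number of vertices of `P` on one side. -/
def sideCard (side : Bool) (P : Finset (Vertex m n)) : ℕ := (P.filter (·.isLeft = side)).card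

variable {G}

theorem nonDeg_mono (v : Vertex m n) {P Q : Finset (Vertex m n)} (h : P ⊆ Q) :
    nonDeg G v P ≤ nonDeg G v Q :=
  Finset.card_le_card (Finset.filter_subset_filter _ h)

theorem degIn_mono (v : Vertex m n) {P Q : Finset (Vertex m n)} (h : P ⊆ Q) :
    degIn G v P ≤ degIn G v Q :=
  Finset.card_le_card (Finset.filter_subset_filter _ h)

theorem sideCard_mono (side : Bool) {P Q : Finset (Vertex m n)} (h : P ⊆ Q) :
    sideCard side P ≤ sideCard side Q :=
  Finset.card_le_card (Finset.filter_subset_filter _ h)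

theorem vEdges_mono {P Q : Finset (Vertex m n)} (h : P ⊆ Q) : vEdges G P ≤ vEdges G Q :=
  (Finset.sum_le_sum fun v _ => degIn_mono v h).trans
    (Finset.sum_le_sum_of_subset (Finset.filter_subset_filter _ h))

theorem VBiplex.subset {k : ℕ} {P Q : Finset (Vertex m n)} (h : VBiplex G k Q) (hPQ : P ⊆ Q) :
    VBiplex G k P :=
  fun v hv => (nonDeg_mono v hPQ).trans (h v (hPQ hv))

theorem degIn_add_nonDeg (v : Vertex m n) (P : Finset (Vertex m n)) :
    degIn G v P + nonDeg G v P = sideCard (!v.isLeft) P := by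
  have h : (P.filter (·.isLeft = !v.isLeft)) =
      P.filter (· ∈ G.adj v) ∪ P.filter (NonAdj G v) := by
    ext w
    simp only [Finset.mem_filter, Finset.mem_union, NonAdj]
    have := G.bip v w
    cases hv : v.isLeft <;> cases hw : w.isLeft <;> simp_all <;> tauto
  rw [sideCard, h, Finset.card_union_of_disjoint]
  · rfl
  · rw [Finset.disjoint_left]
    simp only [Finset.mem_filter, NonAdj]
    tauto

/-! ### Dictionary between vertex sets and pairs of sides -/

theorem mem_adj_inl_iff (v : Fin m) (w : Vertex m n) :
    w ∈ G.adj (Sum.inl v) ↔ ∃ u, Edge G v u ∧ w = Sum.inr u := by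
  constructor
  · intro h
    have := G.bip _ _ h
    cases w with
    | inl w => simp at this
    | inr u => exact ⟨u, h, rfl⟩
  · rintro ⟨u, h, rfl⟩
    exact h

theorem mem_adj_inr_iff (u : Fin n) (w : Vertex m n) :
    w ∈ G.adj (Sum.inr u) ↔ ∃ v, Edge G v u ∧ w = Sum.inl v := by
  constructor
  · intro h
    have := G.bip _ _ h
    cases w with
    | inl w => exact ⟨w, G.symm _ _ h, rfl⟩
    | inr u => simp at this
  · rintro ⟨v, h, rfl⟩
    exact G.symm _ _ h

theorem degIn_inl (v : Fin m) (X : Finset (Fin m)) (Y : Finset (Fin n)) :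
    degIn G (Sum.inl v) (X.disjSum Y) = (nbrR G v Y).card := by
  refine (congrArg Finset.card ?_).trans (Finset.card_map Function.Embedding.inr)
  ext w
  cases w <;> simp [nbrR, mem_adj_inl_iff]

theorem degIn_inr (u : Fin n) (X : Finset (Fin m)) (Y : Finset (Fin n)) :
    degIn G (Sum.inr u) (X.disjSum Y) = (nbrL G u X).card := by
  refine (congrArg Finset.card ?_).trans (Finset.card_map Function.Embedding.inl)
  ext w
  cases w <;> simp [nbrL, mem_adj_inr_iff]

theorem nonDeg_inl (v : Fin m) (X : Finset (Fin m)) (Y : Finset (Fin n)) :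
    nonDeg G (Sum.inl v) (X.disjSum Y) = (nonNbrR G v Y).card := by
  refine (congrArg Finset.card ?_).trans (Finset.card_map Function.Embedding.inr)
  ext w
  cases w <;> simp [nonNbrR, NonAdj, mem_adj_inl_iff]

theorem nonDeg_inr (u : Fin n) (X : Finset (Fin m)) (Y : Finset (Fin n)) :
    nonDeg G (Sum.inr u) (X.disjSum Y) = (nonNbrL G u X).card := by
  refine (congrArg Finset.card ?_).trans (Finset.card_map Function.Embedding.inl)
  ext w
  cases w <;> simp [nonNbrL, NonAdj, mem_adj_inr_iff]

theorem vBiplex_disjSum {k : ℕ} {X : Finset (Fin m)} {Y : Finset (Fin n)} :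
    VBiplex G k (X.disjSum Y) ↔ IsBiplex G k X Y := by
  simp only [VBiplex, IsBiplex, ← nonDeg_inl _ X, ← nonDeg_inr _ _ Y]
  constructor
  · exact fun h => ⟨fun v hv => h _ (by simpa using hv), fun u hu => h _ (by simpa using hu)⟩
  · rintro ⟨h1, h2⟩ (v | u) hv
    · exact h1 v (by simpa using hv)
    · exact h2 u (by simpa using hv)

theorem filter_isLeft_disjSum (X : Finset (Fin m)) (Y : Finset (Fin n)) :
    (X.disjSum Y).filter (·.isLeft = true) = X.map Function.Embedding.inl := by
  ext w
  cases w <;> simp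

theorem filter_isRight_disjSum (X : Finset (Fin m)) (Y : Finset (Fin n)) :
    (X.disjSum Y).filter (·.isLeft = false) = Y.map Function.Embedding.inr := by
  ext w
  cases w <;> simp

theorem sideCard_true_disjSum (X : Finset (Fin m)) (Y : Finset (Fin n)) :
    sideCard true (X.disjSum Y) = X.card := by
  rw [sideCard, filter_isLeft_disjSum, Finset.card_map]

theorem sideCard_false_disjSum (X : Finset (Fin m)) (Y : Finset (Fin n)) :
    sideCard false (X.disjSum Y) = Y.card := by
  rw [sideCard, filter_isRight_disjSum, Finset.card_map]

theorem vEdges_disjSum (X : Finset (Fin m)) (Y : Finset (Fin n)) :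
    vEdges G (X.disjSum Y) = numEdges G X Y := by
  rw [vEdges, filter_isLeft_disjSum, Finset.sum_map]
  exact Finset.sum_congr rfl fun v _ => degIn_inl v X Y

theorem exists_eq_disjSum (P : Finset (Vertex m n)) :
    ∃ (X : Finset (Fin m)) (Y : Finset (Fin n)), P = X.disjSum Y := by
  refine ⟨P.toLeft, P.toRight, ?_⟩
  ext w
  cases w <;> simp

theorem toFinset_eq_disjSum (T : List (Vertex m n)) :
    T.toFinset = (T.filterMap Sum.getLeft?).toFinset.disjSum
      (T.filterMap Sum.getRight?).toFinset := by
  ext w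
  cases w <;> simp [Sum.getLeft?_eq_some_iff, Sum.getRight?_eq_some_iff]

/-! ### Results of the elementary tests -/

theorem countP_eq_card {α : Type} [DecidableEq α] {l : List α} (hl : l.Nodup) (p : α → Prop)
    [DecidablePred p] : l.countP (fun a => decide (p a)) = (l.toFinset.filter p).card := by
  rw [List.countP_eq_length_filter, ← List.toFinset_card_of_nodup (hl.filter _),
    List.toFinset_filter]
  simp

variable (G)

@[simp] theorem memT_val (x : Vertex m n) (l : List (Vertex m n)) :
    (memT x l).val = decide (x ∈ l) := by
  simp only [memT, anyT_val, val_op]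
  rw [Bool.eq_iff_iff]
  simp

@[simp] theorem adjT_val (v w : Vertex m n) : (adjT G v w).val = decide (w ∈ G.adj v) :=
  memT_val _ _

@[simp] theorem nonAdjT_val (v w : Vertex m n) :
    (nonAdjT G v w).val = decide (NonAdj G v w) := by
  unfold nonAdjT NonAdj
  split_ifs with h <;> simp [h]

@[simp] theorem degT_val {v : Vertex m n} {T : List (Vertex m n)} (hT : T.Nodup) :
    (degT G v T).val = degIn G v T.toFinset := by
  simp only [degT, countT_val, adjT_val]
  exact countP_eq_card hT _

@[simp] theorem nonDegT_val {v : Vertex m n} {T : List (Vertex m n)} (hT : T.Nodup) :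
    (nonDegT G v T).val = nonDeg G v T.toFinset := by
  simp only [nonDegT, countT_val, nonAdjT_val]
  exact countP_eq_card hT _

theorem isBiplexT_val {k : ℕ} {T : List (Vertex m n)} (hT : T.Nodup) :
    (isBiplexT G k T).val = true ↔ VBiplex G k T.toFinset := by
  simp [isBiplexT, VBiplex, nonDegT_val G hT]

theorem sideT_val {side : Bool} {T : List (Vertex m n)} (hT : T.Nodup) :
    (sideT side T).val = sideCard side T.toFinset := by
  simp only [sideT, countT_val, val_op, sideCard]
  rw [← countP_eq_card hT]
  congr 1

theorem foldl_add_eq_sum {α : Type} [DecidableEq α] {l : List α} (hl : l.Nodup) (p : α → Prop)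
    [DecidablePred p] (f : α → ℕ) (e : ℕ) :
    l.foldl (fun e a => if p a then e + f a else e) e = e + ∑ a ∈ l.toFinset.filter p, f a := by
  induction l generalizing e with
  | nil => simp
  | cons a l ih =>
    rw [List.nodup_cons] at hl
    rw [List.foldl_cons, ih hl.2, List.toFinset_cons, Finset.filter_insert]
    split_ifs with h
    · rw [Finset.sum_insert (by simp [hl.1]), add_assoc]
    · rfl

theorem edgesT_val {T : List (Vertex m n)} (hT : T.Nodup) :
    (edgesT G T).val = vEdges G T.toFinset := by
  have h := foldl_add_eq_sum hT (fun v : Vertex m n => v.isLeft = true)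
    (fun v => degIn G v T.toFinset) 0
  rw [zero_add] at h
  rw [edgesT, foldT_val, vEdges, ← h]
  congr 1
  ext e v
  split_ifs with h <;> simp [degT_val G hT]

end VertexSets

section FastBB

variable {m n : ℕ} (G : BipGraph m n)

/-! ### Results of the parts of FastBB -/

/-- Only this half of the minimum matters: a lower bound valid for all its terms survives, and that
is all that soundness of the `τ` tests requires. -/
theorem le_tauT {k : ℕ} {side : Bool} {S T : List (Vertex m n)} (hT : T.Nodup) {x t : ℕ}
    (hx : ∀ v ∈ S, v.isLeft = side → x ≤ degIn G v T.toFinset + k)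
    (ht : (tauT G k side S T).val = some t) : x ≤ t := by
  revert t
  rw [tauT, foldT_val]
  -- The degrees refer to the fixed list `T`, while the induction runs over the list that is folded,
  -- with an arbitrary accumulator.
  suffices h : ∀ (l : List (Vertex m n)) (o : Option ℕ), (∀ t, o = some t → x ≤ t) →
      (∀ v ∈ l, v.isLeft = side → x ≤ degIn G v T.toFinset + k) →
      ∀ t, l.foldl (fun t v => (if v.isLeft = side then do
        let c ← degT G v T
        op (match t with
          | none => some (c + k)
          | some x => some (min x (c + k)))
      else op t : Timed (Option ℕ)).val) o = some t → x ≤ t from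
    fun {t} ht => h S none (by simp) hx t ht
  intro l
  induction l with
  | nil => exact fun o ho _ t ht => ho t ht
  | cons v l ih =>
    intro o ho hl t ht
    refine ih _ ?_ (fun v hv => hl v (List.mem_cons_of_mem _ hv)) t ht
    intro t' ht'
    beta_reduce at ht'
    split_ifs at ht' with hs
    · have hv := hl v List.mem_cons_self hs
      simp only [val_bind, val_op, degT_val G hT] at ht'
      cases o with
      | none => simp only [Option.some.injEq] at ht'; omega
      | some y =>
        have := ho y rfl
        simp only [Option.some.injEq] at ht'
        omega
    · exact ho t' ht'

theorem nonMaximalT_val {k : ℕ} {T D : List (Vertex m n)} (hT : T.Nodup) :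
    (nonMaximalT G k T D).val = true ↔ ∃ v ∈ D, nonDeg G v T.toFinset ≤ k ∧
      ∀ w ∈ T, v.isLeft ≠ w.isLeft → nonDeg G w T.toFinset < k ∨ w ∈ G.adj v := by
  simp only [nonMaximalT, anyT_val, val_bind, val_op, nonDegT_val G hT, allT_val, List.any_eq_true,
    Bool.and_eq_true, decide_eq_true_eq, List.all_eq_true]
  refine exists_congr fun v => and_congr_right fun _ => and_congr_right fun _ =>
    forall_congr' fun w => imp_congr_right fun _ => ?_
  split_ifs with h <;> simp [h, nonDegT_val G hT]

/-- That the pivot has the most non-neighbours plays no role in what follows. What counts is that it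
has more than `k`, and that in the absence of a pivot no vertex of the list violates the biplex
condition. -/
theorem pivotT_val {k : ℕ} {T l : List (Vertex m n)} (hT : T.Nodup) :
    (∀ p, (pivotT G k T l).val = some p → p.1 ∈ l ∧ k < nonDeg G p.1 T.toFinset) ∧
      ((pivotT G k T l).val = none → ∀ v ∈ l, nonDeg G v T.toFinset ≤ k) := by
  rw [pivotT, foldT_val]
  -- `l'` is the part already scanned. The stored number exceeds `k` from the moment it exists, so
  -- replacing it by a larger one is safe.
  suffices h : ∀ (l l' : List (Vertex m n)) (o : Option (Vertex m n × ℕ)),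
      (∀ p, o = some p → p.1 ∈ l' ∧ p.2 = nonDeg G p.1 T.toFinset ∧ k < p.2) →
      (o = none → ∀ v ∈ l', nonDeg G v T.toFinset ≤ k) →
      (∀ p, l.foldl (fun p v => (do
        let c ← nonDegT G v T
        op (match p with
          | none => if k < c then some (v, c) else none
          | some (w, c') => if c' < c then some (v, c) else some (w, c')) :
            Timed (Option (Vertex m n × ℕ))).val) o = some p →
          p.1 ∈ l' ++ l ∧ k < nonDeg G p.1 T.toFinset) ∧
      (l.foldl (fun p v => (do
        let c ← nonDegT G v T
        op (match p with
          | none => if k < c then some (v, c) else none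
          | some (w, c') => if c' < c then some (v, c) else some (w, c')) :
            Timed (Option (Vertex m n × ℕ))).val) o = none →
          ∀ v ∈ l' ++ l, nonDeg G v T.toFinset ≤ k) from
    h l [] none (by simp) (by simp)
  intro l
  induction l with
  | nil =>
    intro l' o h1 h2
    simp only [List.append_nil]
    exact ⟨fun p hp => ⟨(h1 p hp).1, (h1 p hp).2.1 ▸ (h1 p hp).2.2⟩, h2⟩
  | cons v l ih =>
    intro l' o h1 h2
    rw [List.foldl_cons, List.append_cons]
    apply ih
    · intro p hp
      simp only [val_bind, val_op, nonDegT_val G hT] at hp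
      cases o with
      | none =>
        simp only at hp
        split_ifs at hp with h
        simp only [Option.some.injEq] at hp
        subst hp
        exact ⟨by simp, rfl, h⟩
      | some q =>
        have hq := h1 q rfl
        simp only at hp
        split_ifs at hp with h <;> simp only [Option.some.injEq] at hp <;> subst hp
        · exact ⟨by simp, rfl, hq.2.2.trans h⟩
        · exact ⟨by simp [hq.1], hq.2⟩
    · intro hp
      simp only [val_bind, val_op, nonDegT_val G hT] at hp
      cases o with
      | none =>
        simp only at hp
        split_ifs at hp with h
        intro w hw
        rcases List.mem_append.1 hw with hw | hw
        · exact h2 rfl w hw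
        · rw [List.mem_singleton] at hw
          subst hw
          omega
      | some q =>
        simp only at hp
        split_ifs at hp

theorem mem_refineT {k : ℕ} {S l : List (Vertex m n)} (hS : S.Nodup) {x : Vertex m n}
    (hx : x ∉ S) : x ∈ (refineT G k S l).val ↔ x ∈ l ∧ VBiplex G k (insert x S.toFinset) := by
  rw [refineT, filterT_val, List.mem_filter, isBiplexT_val G (List.nodup_cons.2 ⟨hx, hS⟩),
    List.toFinset_cons]

theorem refineT_sublist {k : ℕ} {S l : List (Vertex m n)} : (refineT G k S l).val.Sublist l := by
  rw [refineT, filterT_val]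
  exact List.filter_sublist

/-- The vertices on which FastBB branches. -/
def orderT (k : ℕ) (S C T : List (Vertex m n)) : Timed (List (Vertex m n)) := do
  let pS ← pivotT G k T S
  match pS with
  | some (v, _) => do
    let s ← nonDegT G v S
    let U ← filterT (fun w => nonAdjT G v w) C
    takeT (k - s + 1) U
  | none => do
    let pC ← pivotT G k T C
    match pC with
    | some (v, _) => do
      let s ← nonDegT G v S
      let U ← filterT (fun w => nonAdjT G v w) C
      let us ← takeT (k - s + 1) U
      pure (v :: us)
    | none => pure []

theorem Timed.ext {α : Type} {x y : Timed α} (h1 : x.val = y.val) (h2 : x.cost = y.cost) :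
    x = y := by
  cases x; cases y; simp_all

theorem Timed.bind_assoc {α β γ : Type} (x : Timed α) (f : α → Timed β) (g : β → Timed γ) :
    x >>= f >>= g = x >>= fun a => f a >>= g :=
  Timed.ext rfl (Nat.add_assoc _ _ _)

theorem Timed.pure_bind {α β : Type} (a : α) (f : α → Timed β) : pure a >>= f = f a :=
  Timed.ext rfl (Nat.zero_add _)

/-- The two pivot cases end in the same branching procedure on different lists. Merging them into
`orderT` lets correctness and cost be argued once. -/
theorem fastBBRec_succ (k : ℕ) (B : Bounds) (fuel : ℕ) (S C D : List (Vertex m n))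
    (best : Sol m n) : fastBBRec G k B (fuel + 1) S C D best = (do
      let T ← appendT S C
      let done ← isBiplexT G k T
      if done then do
        let e ← edgesT G T
        let tL ← sideT true T
        let tR ← sideT false T
        op (if best.edges < e ∧ B.lbL ≤ tL ∧ B.lbR ≤ tR then ⟨T, e⟩ else best)
      else do
        let pruned ← pruneT G k B best S T D
        if pruned then op best
        else do
          let order ← orderT G k S C T
          symBKT G k (fastBBRec G k B fuel) order S C D best) := by
  rw [fastBBRec]
  refine congrArg _ (funext fun T => congrArg _ (funext fun done => ?_))
  split_ifs
  · rfl
  refine congrArg _ (funext fun pruned => ?_)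
  split_ifs
  · rfl
  rw [orderT, Timed.bind_assoc]
  refine congrArg _ (funext fun pS => ?_)
  rcases pS with _ | ⟨v, c⟩
  · simp only [Timed.bind_assoc]
    refine congrArg _ (funext fun pC => ?_)
    rcases pC with _ | ⟨v, c⟩
    · simp only [Timed.pure_bind]
      rfl
    · simp only [Timed.bind_assoc, Timed.pure_bind]
  · simp only [Timed.bind_assoc]

variable {G}

theorem nonDeg_append {v : Vertex m n} {S C : List (Vertex m n)} (h : (S ++ C).Nodup) :
    nonDeg G v (S ++ C).toFinset =
      nonDeg G v S.toFinset + (C.filter fun w => decide (NonAdj G v w)).length := by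
  rw [nonDeg, ← countP_eq_card h, List.countP_append, nonDeg,
    ← countP_eq_card (List.nodup_append.1 h).1, List.countP_eq_length_filter (l := C)]

/-- The `s` non-neighbours of `v` in `S` and the first `k - s + 1` in `C` are `k + 1` vertices, too
many if `P` contains all of them and `v`. If `C` has fewer to offer, or if `s > k` already, then the
count still exceeds `k`, because `v` has more than `k` non-neighbours in `S ∪ C`. -/
theorem not_order_subset {k : ℕ} {S C : List (Vertex m n)} (h : (S ++ C).Nodup) {v : Vertex m n}
    (hv : k < nonDeg G v (S ++ C).toFinset) {P : Finset (Vertex m n)} (hP : VBiplex G k P)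
    (hSP : S.toFinset ⊆ P) (hvP : v ∈ P)
    (hu : ∀ u ∈ (C.filter fun w => decide (NonAdj G v w)).take
      (k - nonDeg G v S.toFinset + 1), u ∈ P) : False := by
  rw [nonDeg_append h] at hv
  obtain ⟨hS, hC, hdisj⟩ := List.nodup_append.1 h
  set U := C.filter fun w => decide (NonAdj G v w) with hU
  set us := U.take (k - nonDeg G v S.toFinset + 1) with hus
  have hsub : us.Sublist C := (List.take_sublist _ _).trans List.filter_sublist
  have hadj : ∀ u ∈ us, NonAdj G v u := fun u hu => by
    have := List.mem_filter.1 ((List.take_sublist _ _).subset hu)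
    simpa using this.2
  have hd : Disjoint (S.toFinset.filter (NonAdj G v)) us.toFinset := by
    rw [Finset.disjoint_left]
    intro x hx hx'
    simp only [Finset.mem_filter, List.mem_toFinset] at hx hx'
    exact hdisj x hx.1 x (hsub.subset hx') rfl
  have h1 : (S.toFinset.filter (NonAdj G v)) ∪ us.toFinset ⊆ P.filter (NonAdj G v) := by
    intro x hx
    rcases Finset.mem_union.1 hx with hx | hx
    · exact Finset.filter_subset_filter _ hSP hx
    · rw [List.mem_toFinset] at hx
      exact Finset.mem_filter.2 ⟨hu x hx, hadj x hx⟩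
  have h2 := Finset.card_le_card h1
  rw [Finset.card_union_of_disjoint hd, List.toFinset_card_of_nodup (hC.sublist hsub)] at h2
  have h3 := hP v hvP
  have h4 : us.length = min (k - nonDeg G v S.toFinset + 1) U.length := List.length_take
  unfold nonDeg at *
  omega

variable (G) in
-- The last clause makes the branching exhaustive: no biplex above `S` contains the whole branching
-- list. The length is at most the pivot plus `k + 1` of its non-neighbours. If neither `S` nor `C`
-- provides a pivot, then `S ∪ C` is a biplex.
theorem orderT_val {k : ℕ} {S C : List (Vertex m n)} (h : (S ++ C).Nodup) :
    (orderT G k S C (S ++ C)).val.Nodup ∧ (orderT G k S C (S ++ C)).val ⊆ C ∧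
      (orderT G k S C (S ++ C)).val.length ≤ k + 2 ∧
      (¬ VBiplex G k (S ++ C).toFinset → ∀ P, VBiplex G k P → S.toFinset ⊆ P →
        ∃ v ∈ (orderT G k S C (S ++ C)).val, v ∉ P) := by
  obtain ⟨hS, hC, -⟩ := List.nodup_append.1 h
  obtain ⟨h1, h2⟩ := pivotT_val G (k := k) (l := S) h
  obtain ⟨h3, h4⟩ := pivotT_val G (k := k) (l := C) h
  have hsub : ∀ i v, (C.filter fun w => decide (NonAdj G v w)).take i |>.Sublist C :=
    fun i v => (List.take_sublist _ _).trans List.filter_sublist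
  rw [orderT]
  simp only [val_bind]
  rcases hpS : (pivotT G k (S ++ C) S).val with _ | ⟨v, c⟩
  · simp only [val_bind]
    rcases hpC : (pivotT G k (S ++ C) C).val with _ | ⟨v, c⟩
    · simp only [val_pure]
      refine ⟨List.nodup_nil, List.nil_subset _, by simp, fun hn => absurd (fun v hv => ?_) hn⟩
      rw [List.mem_toFinset, List.mem_append] at hv
      exact hv.elim (h2 hpS v) (h4 hpC v)
    · simp only [val_bind, val_pure, takeT_val, filterT_val, nonAdjT_val, nonDegT_val G hS]
      have hv := h3 _ hpC
      refine ⟨List.nodup_cons.2 ⟨fun hmem => ?_, hC.sublist (hsub _ _)⟩,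
        List.cons_subset.2 ⟨hv.1, (hsub _ _).subset⟩, ?_, fun _ P hP hSP => ?_⟩
      · have := List.mem_filter.1 ((List.take_sublist _ _).subset hmem)
        simp [NonAdj] at this
      · rw [List.length_cons, List.length_take]
        omega
      · by_contra! hcon
        exact not_order_subset h hv.2 hP hSP (hcon v (by simp))
          fun u hu => hcon u (List.mem_cons_of_mem _ hu)
  · simp only [val_bind, takeT_val, filterT_val, nonAdjT_val, nonDegT_val G hS]
    have hv := h1 _ hpS
    refine ⟨hC.sublist (hsub _ _), (hsub _ _).subset, ?_, fun _ P hP hSP => ?_⟩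
    · rw [List.length_take]
      omega
    · by_contra! hcon
      exact not_order_subset h hv.2 hP hSP (hSP (by simpa using hv.1)) hcon

/-! ### Correctness of FastBB -/

theorem nodup_append_filter_ne {S C : List (Vertex m n)} (h : (S ++ C).Nodup) {v : Vertex m n}
    (hv : v ∈ C) : ((v :: S) ++ C.filter fun x => decide (x ≠ v)).Nodup := by
  rw [List.cons_append, List.nodup_cons]
  obtain ⟨hS, hC, hd⟩ := List.nodup_append.1 h
  refine ⟨?_, h.sublist (List.Sublist.append_left List.filter_sublist S)⟩
  rw [List.mem_append]
  rintro (h' | h')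
  · exact hd v h' v hv rfl
  · simp at h'

theorem length_filter_ne_lt {C : List (Vertex m n)} {v : Vertex m n} (hv : v ∈ C) :
    (C.filter fun x => decide (x ≠ v)).length < C.length :=
  List.length_filter_lt_length_iff_exists.2 ⟨v, hv, by simp⟩

theorem subset_filter_ne {C vs : List (Vertex m n)} {v : Vertex m n} (hvs : (v :: vs).Nodup)
    (hsub : v :: vs ⊆ C) : vs ⊆ C.filter fun x => decide (x ≠ v) := by
  intro x hx
  rw [List.mem_filter]
  refine ⟨hsub (List.mem_cons_of_mem _ hx), ?_⟩
  rw [decide_eq_true_eq]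
  rintro rfl
  exact (List.nodup_cons.1 hvs).1 hx

/-- A property of the best biplex that is preserved in every branch is preserved by branching. -/
theorem symBKT_invariant {k : ℕ} {recur : List (Vertex m n) → List (Vertex m n) →
      List (Vertex m n) → Sol m n → Timed (Sol m n)} (I : Sol m n → Prop)
    (hrec : ∀ S C D b, (S ++ C).Nodup → I b → I (recur S C D b).val) :
    ∀ (vs S C D : List (Vertex m n)) (b : Sol m n), vs.Nodup → vs ⊆ C → (S ++ C).Nodup → I b →
      I (symBKT G k recur vs S C D b).val := by
  intro vs
  induction vs with
  | nil => exact fun S C D b _ _ _ hb => hb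
  | cons v vs ih =>
    intro S C D b hvs hsub hnd hb
    simp only [symBKT, val_bind, filterT_val, val_op]
    have hv : v ∈ C := hsub List.mem_cons_self
    refine ih _ _ _ _ (List.nodup_cons.1 hvs).2 (subset_filter_ne hvs hsub)
      (nodup_append_filter_ne hnd hv) (hrec _ _ _ _ ?_ hb)
    exact hnd.sublist (List.Sublist.append_left
      ((refineT_sublist G).trans List.filter_sublist) S)

/-- The record changes only at leaves, under the conditions listed in `hI`. Both the monotonicity of
the edge number and the soundness of the output are instances. -/
theorem fastBBRec_invariant {k : ℕ} {B : Bounds} (I : Sol m n → Prop)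
    (hI : ∀ (T : List (Vertex m n)) b, T.Nodup → VBiplex G k T.toFinset →
      b.edges < vEdges G T.toFinset → B.lbL ≤ sideCard true T.toFinset →
      B.lbR ≤ sideCard false T.toFinset → I b → I ⟨T, vEdges G T.toFinset⟩) :
    ∀ (fuel : ℕ) (S C D : List (Vertex m n)) (b : Sol m n), (S ++ C).Nodup → I b →
      I (fastBBRec G k B fuel S C D b).val := by
  intro fuel
  induction fuel with
  | zero => exact fun S C D b _ hb => hb
  | succ fuel ih =>
    intro S C D b hnd hb
    rw [fastBBRec_succ]
    simp only [val_bind, appendT_val]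
    split_ifs with h1
    · simp only [val_bind, val_op, edgesT_val G hnd, sideT_val hnd]
      split_ifs with h2
      · exact hI _ b hnd ((isBiplexT_val G hnd).1 h1) h2.1 h2.2.1 h2.2.2 hb
      · exact hb
    · rw [val_bind]
      split_ifs with h2
      · exact hb
      · obtain ⟨h3, h4, -⟩ := orderT_val G (k := k) hnd
        exact symBKT_invariant I ih _ _ _ _ _ h3 h4 hnd hb

theorem edges_le_fastBBRec {k : ℕ} {B : Bounds} {fuel : ℕ} {S C D : List (Vertex m n)}
    {b : Sol m n} (h : (S ++ C).Nodup) : b.edges ≤ (fastBBRec G k B fuel S C D b).val.edges :=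
  fastBBRec_invariant (fun s => b.edges ≤ s.edges)
    (fun _ _ _ _ h1 _ _ h2 => h2.trans h1.le) fuel S C D b h le_rfl

/-- `P` is a `k`-biplex that respects the bounds and cannot be extended by a vertex. -/
structure IsTarget (G : BipGraph m n) (k : ℕ) (B : Bounds) (P : Finset (Vertex m n)) : Prop where
  biplex : VBiplex G k P
  maximal : ∀ v, VBiplex G k (insert v P) → v ∈ P
  lbL : B.lbL ≤ sideCard true P
  ubL : sideCard true P ≤ B.ubL
  lbR : B.lbR ≤ sideCard false P
  ubR : sideCard false P ≤ B.ubR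

theorem vEdges_le_mul (P : Finset (Vertex m n)) :
    vEdges G P ≤ sideCard true P * sideCard false P := by
  obtain ⟨X, Y, rfl⟩ := exists_eq_disjSum P
  rw [vEdges_disjSum, sideCard_true_disjSum, sideCard_false_disjSum]
  exact numEdges_le_mul G X Y

theorem nonDeg_insert_le (w v : Vertex m n) (P : Finset (Vertex m n)) :
    nonDeg G w (insert v P) ≤ nonDeg G w P + if NonAdj G w v then 1 else 0 := by
  unfold nonDeg
  rw [Finset.filter_insert]
  split_ifs
  · exact Finset.card_insert_le _ _
  · exact le_rfl

/-- Since `S ⊆ P ⊆ T`, every quantity that is tested is controlled by `P`. A vertex of `S` misses at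
most `k` vertices of `P`, so `τ_L` and `τ_R` are at least the sizes of the two sides of `P`; their
product is then at least the number of edges of `P`, which beats the record. -/
theorem IsTarget.pruneT_eq_false {k : ℕ} {B : Bounds} {P : Finset (Vertex m n)}
    (hP : IsTarget G k B P) {best : Sol m n} (hbest : best.edges < vEdges G P)
    {S T D : List (Vertex m n)} (hS : S.Nodup) (hT : T.Nodup) (hSP : S.toFinset ⊆ P)
    (hPT : P ⊆ T.toFinset) (hD : ∀ v ∈ D, v ∉ T) :
    (pruneT G k B best S T D).val = false := by
  have htau : ∀ side t, (tauT G k side S T).val = some t → sideCard (!side) P ≤ t := by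
    intro side t ht
    refine le_tauT G hT (fun v hv hvs => ?_) ht
    have h1 := degIn_add_nonDeg (G := G) v P
    have h2 := hP.biplex v (hSP (by simpa using hv))
    have h3 := degIn_mono (G := G) v hPT
    rw [hvs] at h1
    omega
  have htauL := htau false
  have htauR := htau true
  have h1 : (isBiplexT G k S).val = true := (isBiplexT_val G hS).2 (hP.biplex.subset hSP)
  have h2 : ¬ B.ubL < ((sideT true S).val : ℚ) := by
    rw [sideT_val hS, not_lt]
    exact le_trans (by exact_mod_cast sideCard_mono true hSP) hP.ubL
  have h3 : ¬ B.ubR < ((sideT false S).val : ℚ) := by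
    rw [sideT_val hS, not_lt]
    exact le_trans (by exact_mod_cast sideCard_mono false hSP) hP.ubR
  have h4 : ¬ (edgesT G T).val ≤ best.edges := by
    rw [edgesT_val G hT]
    have := vEdges_mono (G := G) hPT
    omega
  have h5 : (nonMaximalT G k T D).val = false := by
    -- A vertex `v` of `D` passing the test could be added to `P`: it has at most `k` non-neighbours
    -- in `T`, and every vertex of `P` not adjacent to it has fewer than `k`, hence room for one
    -- more. But `D` is disjoint from `T`, so this contradicts maximality.
    rw [Bool.eq_false_iff, ne_eq, nonMaximalT_val G hT]
    rintro ⟨v, hv, hvk, hvw⟩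
    have hvP : v ∉ P := fun h => hD v hv (by simpa using hPT h)
    refine hvP (hP.maximal v fun w hw => ?_)
    rcases Finset.mem_insert.1 hw with rfl | hw
    · refine (nonDeg_insert_le w w P).trans ?_
      rw [if_neg (by simp [NonAdj])]
      exact (nonDeg_mono w hPT).trans hvk
    · refine (nonDeg_insert_le w v P).trans ?_
      split_ifs with h
      · rcases hvw w (by simpa using hPT hw) h.1.symm with h' | h'
        · have := nonDeg_mono (G := G) w hPT
          omega
        · exact absurd h' h.symm.2
      · exact hP.biplex w hw
  have hL : ∀ t, (tauT G k false S T).val = some t → ¬ (t : ℚ) < B.lbL := fun t ht => by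
    rw [not_lt]
    exact hP.lbL.trans (by exact_mod_cast htauL t ht)
  have hR : ∀ t, (tauT G k true S T).val = some t → ¬ (t : ℚ) < B.lbR := fun t ht => by
    rw [not_lt]
    exact hP.lbR.trans (by exact_mod_cast htauR t ht)
  have hLR : ∀ s t, (tauT G k false S T).val = some s → (tauT G k true S T).val = some t →
      ¬ s * t ≤ best.edges := fun s t hs ht => by
    have h6 := Nat.mul_le_mul (htauL s hs) (htauR t ht)
    have h7 := vEdges_le_mul (G := G) P
    simp only [Bool.not_false, Bool.not_true] at h6
    omega
  simp only [pruneT, val_bind, val_op, h1, h2, h3, h4, h5]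
  clear htau htauL htauR
  generalize (tauT G k false S T).val = s at hL hLR ⊢
  generalize (tauT G k true S T).val = t at hR hLR ⊢
  rcases s with _ | s <;> rcases t with _ | t <;> simp_all

/-- As long as the vertices of the list belong to `P`, including them keeps `S ⊆ P`. The first one
outside `P` is excluded by the next child, for which `S ⊆ P ⊆ S ∪ C` persists. -/
theorem symBKT_complete {k : ℕ} {P : Finset (Vertex m n)} (hP : VBiplex G k P) {e fuel : ℕ}
    {recur : List (Vertex m n) → List (Vertex m n) →
      List (Vertex m n) → Sol m n → Timed (Sol m n)}
    (hmono : ∀ S C D b, (S ++ C).Nodup → b.edges ≤ (recur S C D b).val.edges)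
    (hrec : ∀ S C D b, (S ++ C).Nodup → (∀ v ∈ D, v ∉ S ++ C) → S.toFinset ⊆ P →
      P ⊆ (S ++ C).toFinset → C.length < fuel → e ≤ (recur S C D b).val.edges) :
    ∀ (vs S C D : List (Vertex m n)) (b : Sol m n), vs.Nodup → vs ⊆ C → (∃ v ∈ vs, v ∉ P) →
      (S ++ C).Nodup → (∀ v ∈ D, v ∉ S ++ C) → S.toFinset ⊆ P → P ⊆ (S ++ C).toFinset →
      C.length < fuel + 1 → e ≤ (symBKT G k recur vs S C D b).val.edges := by
  intro vs
  induction vs with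
  | nil => rintro S C D b - - ⟨v, hv, -⟩; simp at hv
  | cons v vs ih =>
    intro S C D b hvs hsub hex hnd hD hSP hPT hlen
    simp only [symBKT, val_bind, filterT_val, val_op]
    have hv : v ∈ C := hsub List.mem_cons_self
    obtain ⟨hS, hC, hdisj⟩ := List.nodup_append.1 hnd
    have hvS : v ∉ S := fun h => hdisj v h v hv rfl
    have hlen' := length_filter_ne_lt hv
    have hnd' := nodup_append_filter_ne hnd hv
    have hsub' := subset_filter_ne hvs hsub
    have hDv : ∀ w ∈ D, w ∉ (v :: S) ++ C.filter fun x => decide (x ≠ v) := by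
      intro w hw hmem
      rw [List.cons_append, List.mem_cons, List.mem_append, List.mem_filter] at hmem
      refine hD w hw (List.mem_append.2 ?_)
      rcases hmem with rfl | h | h
      · exact Or.inr hv
      · exact Or.inl h
      · exact Or.inr h.1
    by_cases hvP : v ∈ P
    · refine ih _ _ _ _ (List.nodup_cons.1 hvs).2 hsub' ?_ hnd' hDv ?_ ?_ (by omega)
      · obtain ⟨w, hw, hwP⟩ := hex
        rcases List.mem_cons.1 hw with rfl | hw
        · exact absurd hvP hwP
        · exact ⟨w, hw, hwP⟩
      · rw [List.toFinset_cons]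
        exact Finset.insert_subset hvP hSP
      · intro x hx
        have := hPT hx
        simp only [List.mem_toFinset, List.mem_append] at this
        simp only [List.mem_toFinset, List.mem_append, List.mem_cons, List.mem_filter,
          decide_eq_true_eq]
        tauto
    -- This is the child to follow. Refinement drops no vertex `x` of `P`, because `S ∪ {x}` is
    -- contained in the biplex `P`; the later siblings cannot make the record worse.
    · have hsubl : ((refineT G k S (C.filter fun x => decide (x ≠ v))).val).Sublist
          (C.filter fun x => decide (x ≠ v)) := refineT_sublist G
      refine le_trans (hrec _ _ _ _ ?_ ?_ hSP ?_ ?_) (symBKT_invariant (fun s => _ ≤ s.edges)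
        (fun S C D b h1 h2 => h2.trans (hmono S C D b h1)) _ _ _ _ _ (List.nodup_cons.1 hvs).2
        hsub' hnd' le_rfl)
      · exact hnd.sublist (List.Sublist.append_left (hsubl.trans List.filter_sublist) S)
      · intro w hw hmem
        have hw' := (refineT_sublist G).subset hw
        rw [List.mem_append] at hmem
        rcases List.mem_cons.1 hw' with rfl | hw'
        · rcases hmem with h | h
          · exact hvS h
          · simpa using hsubl.subset h
        · refine hD w hw' (List.mem_append.2 (hmem.imp_right fun h => ?_))
          exact (List.mem_filter.1 (hsubl.subset h)).1
      · intro x hx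
        have hxT := hPT hx
        rw [List.mem_toFinset, List.mem_append] at hxT ⊢
        refine or_iff_not_imp_left.2 fun hxS => ?_
        rw [mem_refineT G hS hxS, List.mem_filter]
        refine ⟨⟨hxT.resolve_left hxS, ?_⟩, hP.subset (Finset.insert_subset hx hSP)⟩
        rw [decide_eq_true_eq]
        rintro rfl
        exact hvP hx
      · have := hsubl.length_le
        omega

/-- `P` itself need not be found, since the search may stop early when the record is as good; hence
the conclusion is about edge numbers only. At a leaf, `S ∪ C` contains `P`, so it meets the lower
bounds and has at least as many edges. -/
theorem IsTarget.le_fastBBRec {k : ℕ} {B : Bounds} {P : Finset (Vertex m n)}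
    (hP : IsTarget G k B P) :
    ∀ (fuel : ℕ) (S C D : List (Vertex m n)) (b : Sol m n), (S ++ C).Nodup →
      (∀ v ∈ D, v ∉ S ++ C) → S.toFinset ⊆ P → P ⊆ (S ++ C).toFinset → C.length < fuel →
      vEdges G P ≤ (fastBBRec G k B fuel S C D b).val.edges := by
  intro fuel
  induction fuel with
  | zero => intro S C D b _ _ _ _ h; omega
  | succ fuel ih =>
    intro S C D b hnd hD hSP hPT hlen
    rcases le_or_gt (vEdges G P) b.edges with hb | hb
    · exact hb.trans (edges_le_fastBBRec hnd)
    rw [fastBBRec_succ]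
    simp only [val_bind, appendT_val]
    split_ifs with h1
    · simp only [val_bind, val_op, edgesT_val G hnd, sideT_val hnd]
      have h3 := vEdges_mono (G := G) hPT
      rw [if_pos]
      · exact h3
      · refine ⟨by omega, hP.lbL.trans ?_, hP.lbR.trans ?_⟩
        · exact_mod_cast sideCard_mono true hPT
        · exact_mod_cast sideCard_mono false hPT
    · rw [val_bind, hP.pruneT_eq_false hb (List.nodup_append.1 hnd).1 hnd hSP hPT hD]
      obtain ⟨h3, h4, -, h5⟩ := orderT_val G (k := k) hnd
      rw [isBiplexT_val G hnd] at h1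
      exact symBKT_complete hP.biplex (fun S C D b => edges_le_fastBBRec)
        ih _ _ _ _ _ h3 h4 (h5 h1 P hP.biplex hSP) hnd hD hSP hPT hlen

end FastBB

/-! ### Invariants and progress of folds -/

section Folds

variable {α β : Type}

theorem foldl_invariant {f : β → α → β} (I : β → Prop) {l : List α}
    (h : ∀ b, ∀ a ∈ l, I b → I (f b a)) {b : β} (hb : I b) : I (l.foldl f b) := by
  induction l generalizing b with
  | nil => exact hb
  | cons a l ih =>
    exact ih (fun b a ha => h b a (List.mem_cons_of_mem _ ha)) (h b a List.mem_cons_self hb)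

theorem le_foldl {f : β → α → β} (μ : β → ℕ) {l : List α} {c : ℕ}
    (hmono : ∀ b, ∀ a ∈ l, μ b ≤ μ (f b a)) (h : ∃ a ∈ l, ∀ b, c ≤ μ (f b a)) (b : β) :
    c ≤ μ (l.foldl f b) := by
  induction l generalizing b with
  | nil => simp at h
  | cons a l ih =>
    have hmono' : ∀ b, ∀ a ∈ l, μ b ≤ μ (f b a) := fun b a ha =>
      hmono b a (List.mem_cons_of_mem _ ha)
    rw [List.foldl_cons]
    obtain ⟨a', ha', hc⟩ := h
    rcases List.mem_cons.1 ha' with rfl | ha'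
    · exact foldl_invariant (fun x => c ≤ μ x) (fun b a ha hb => hb.trans (hmono' b a ha)) (hc b)
    · exact ih hmono' ⟨a', ha', hc⟩ _

end Folds

section Framework

variable {m n : ℕ} {G : BipGraph m n}

/-! ### The core -/

/-- While the neighbours in `l` of a removed vertex are still to be updated, `mem` keeps `P`. -/
structure CoreMem.Keeps (G : BipGraph m n) (P : Finset (Vertex m n)) (mem : CoreMem m n)
    (l : List (Vertex m n)) : Prop where
  removed : ∀ w ∈ P, mem.removed w = false
  lost : ∀ w ∈ P, mem.lost w + l.countP (fun x => decide (x = w)) ≤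
    (G.adj w).countP fun x => mem.removed x

/-- The counter `lost` never exceeds the number of removed neighbours, and these all lie outside
`P`; so the apparent degree is at least the degree inside `P`. -/
theorem CoreMem.Keeps.lowT_eq_false {P : Finset (Vertex m n)} {mem : CoreMem m n}
    {l : List (Vertex m n)} (h : mem.Keeps G P l) {α β : ℚ} {w : Vertex m n} (hw : w ∈ P)
    (hdeg : (if w.isLeft then α else β) ≤ degIn G w P) : (lowT G α β mem w).val = false := by
  simp only [lowT, val_bind, lengthT_val, val_op, decide_eq_false_iff_not, not_lt]
  refine hdeg.trans ?_
  have h1 := h.lost w hw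
  have h2 := List.length_eq_countP_add_countP (fun x => mem.removed x) (l := G.adj w)
  have h3 : degIn G w P ≤ (G.adj w).countP fun x => decide ¬ mem.removed x = true := by
    rw [countP_eq_card (G.nodup w)]
    refine Finset.card_le_card fun x hx => ?_
    rw [Finset.mem_filter] at hx ⊢
    simp [hx.2, h.removed x hx.1]
  have h4 : degIn G w P + mem.lost w ≤ (G.adj w).length := by omega
  have h5 : (degIn G w P : ℚ) + mem.lost w ≤ (G.adj w).length := by exact_mod_cast h4
  linarith

/-- Correctness needs only that `P` survives, not that peeling has reached the core. Therefore any
number of rounds is acceptable. -/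
theorem peelT_keeps {P : Finset (Vertex m n)} {α β : ℚ}
    (hP : ∀ w ∈ P, (if w.isLeft then α else β) ≤ degIn G w P) :
    ∀ (fuel : ℕ) (stack : List (Vertex m n)) (mem : CoreMem m n), (∀ x ∈ stack, x ∉ P) →
      mem.Keeps G P [] → ∀ w ∈ P, (peelT G α β fuel stack mem).val.removed w = false := by
  intro fuel
  induction fuel with
  | zero => exact fun _ _ _ h => h.removed
  | succ fuel ih =>
    intro stack mem hstack hmem
    cases stack with
    | nil => exact hmem.removed
    | cons v stack =>
      rw [peelT, val_op_bind]
      have hst : ∀ x ∈ stack, x ∉ P := fun x hx => hstack x (List.mem_cons_of_mem _ hx)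
      have hv : v ∉ P := hstack v List.mem_cons_self
      split_ifs with hr
      · exact ih _ _ hst hmem
      simp only [val_op_bind]
      simp only [val_bind, val_op, foldT_val]
      set mem' : CoreMem m n := ⟨Function.update mem.removed v true, mem.lost⟩ with hmem'
      -- Marking `v` raises the number of removed neighbours of each `w` adjacent to `v` by one, and
      -- exactly these `w` still await an update. By symmetry and absence of repetitions, `w` occurs
      -- in the list of `v` as often as `v` in that of `w`.
      have hkeep : mem'.Keeps G P (G.adj v) := by
        refine ⟨fun w hw => ?_, fun w hw => ?_⟩
        · have : w ≠ v := fun h => hv (h ▸ hw)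
          simp [hmem', this, hmem.removed w hw]
        · have h1 := hmem.lost w hw
          simp only [List.countP_nil, add_zero] at h1
          have h2 : ((G.adj v).countP fun x => decide (x = w)) =
              (G.adj w).countP fun x => decide (x = v) := by
            rw [countP_eq_card (G.nodup v), countP_eq_card (G.nodup w), Finset.filter_eq',
              Finset.filter_eq']
            simp only [List.mem_toFinset]
            by_cases h : w ∈ G.adj v
            · rw [if_pos h, if_pos (G.symm _ _ h), Finset.card_singleton, Finset.card_singleton]
            · rw [if_neg h, if_neg fun h' => h (G.symm _ _ h')]
          have h3 : ∀ l : List (Vertex m n), l.countP (fun x => mem.removed x) +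
              l.countP (fun x => decide (x = v)) ≤ l.countP fun x => mem'.removed x := by
            intro l
            induction l with
            | nil => simp
            | cons x l ihl =>
              simp only [List.countP_cons]
              by_cases hx : x = v
              · subst hx
                simp only [hmem'] at ihl ⊢
                simp only [hr, Function.update_self, if_true, decide_true]
                simp only [Bool.false_eq_true, if_false]
                omega
              · simp only [hmem', Function.update_of_ne hx, hx, decide_false] at ihl ⊢
                simp only [Bool.false_eq_true, if_false]
                omega
          rw [h2]
          exact (Nat.add_le_add_right h1 _).trans (h3 _)
      -- Each processed neighbour turns one pending update into one unit of `lost`. The invariant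
      -- then shows that no vertex of `P` is pushed on the stack.
      have key : ∀ (l : List (Vertex m n)) (q : List (Vertex m n) × CoreMem m n),
          (∀ x ∈ q.1, x ∉ P) → q.2.Keeps G P l →
          (∀ x ∈ (l.foldl (fun (q : List (Vertex m n) × CoreMem m n) w =>
            if (lowT G α β ⟨q.2.removed, Function.update q.2.lost w (q.2.lost w + 1)⟩ w).val = true
            then (w :: q.1, (⟨q.2.removed, Function.update q.2.lost w (q.2.lost w + 1)⟩ :
              CoreMem m n))
            else (q.1, ⟨q.2.removed, Function.update q.2.lost w (q.2.lost w + 1)⟩)) q).1, x ∉ P) ∧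
          (l.foldl (fun (q : List (Vertex m n) × CoreMem m n) w =>
            if (lowT G α β ⟨q.2.removed, Function.update q.2.lost w (q.2.lost w + 1)⟩ w).val = true
            then (w :: q.1, (⟨q.2.removed, Function.update q.2.lost w (q.2.lost w + 1)⟩ :
              CoreMem m n))
            else (q.1, ⟨q.2.removed, Function.update q.2.lost w (q.2.lost w + 1)⟩)) q).2.Keeps
              G P [] := by
        intro l
        induction l with
        | nil => exact fun q h1 h2 => ⟨h1, h2⟩
        | cons w l ihl =>
          intro q h1 h2
          rw [List.foldl_cons]
          have h3 : (⟨q.2.removed, Function.update q.2.lost w (q.2.lost w + 1)⟩ :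
              CoreMem m n).Keeps G P l := by
            refine ⟨h2.removed, fun x hx => ?_⟩
            have h4 := h2.lost x hx
            rw [List.countP_cons] at h4
            by_cases hxw : w = x
            · subst hxw
              simp only [Function.update_self]
              simp only [decide_true, if_true] at h4
              omega
            · simp only [Function.update_of_ne (Ne.symm hxw)]
              simp only [hxw, decide_false, Bool.false_eq_true, if_false] at h4
              omega
          split_ifs with hlow
          · refine ihl _ ?_ h3
            intro x hx
            rcases List.mem_cons.1 hx with rfl | hx
            · intro hxP
              rw [h3.lowT_eq_false hxP (hP x hxP)] at hlow
              exact Bool.false_ne_true hlow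
            · exact h1 x hx
          · exact ihl _ h1 h3
      have h5 := key (G.adj v) (stack, mem') hst hkeep
      exact ih _ _ h5.1 h5.2

/-- Peeling removes no vertex of a subgraph with the required degrees. -/
theorem coreT_keeps {P : Finset (Vertex m n)} {α β : ℚ}
    (hP : ∀ w ∈ P, (if w.isLeft then α else β) ≤ degIn G w P) :
    ∀ w ∈ P, (coreT G α β).val.removed w = false := by
  rw [coreT]
  simp only [val_bind, val_op, foldT_val]
  have h0 : (⟨fun _ => false, fun _ => 0⟩ : CoreMem m n).Keeps G P [] :=
    ⟨fun _ _ => rfl, fun _ _ => by simp⟩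
  have hstep : ∀ (st : List (Vertex m n)) (x : Vertex m n), (∀ x ∈ st, x ∉ P) →
      ∀ y ∈ (if (lowT G α β ⟨fun _ => false, fun _ => 0⟩ x).val = true then x :: st else st),
        y ∉ P := by
    intro st x hst y hy
    split_ifs at hy with hlow
    · rcases List.mem_cons.1 hy with rfl | hy
      · intro hyP
        rw [h0.lowT_eq_false hyP (hP y hyP)] at hlow
        exact Bool.false_ne_true hlow
      · exact hst y hy
    · exact hst y hy
  refine peelT_keeps hP _ _ _ ?_ h0
  refine foldl_invariant (fun st : List (Vertex m n) => ∀ x ∈ st, x ∉ P) ?_ (by simp)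
  intro st v _ hst
  exact foldl_invariant (fun st : List (Vertex m n) => ∀ x ∈ st, x ∉ P)
    (fun st x _ hst => hstep st x hst) (hstep st v hst)

/-! ### The subgraph around a vertex -/

theorem insertT_val (x : Vertex m n) (l : List (Vertex m n)) :
    (insertT x l).val = if x ∈ l then l else x :: l := by
  simp [insertT]

theorem addNbrsT_val {mem : CoreMem m n} {acc : List (Vertex m n)} {v : Vertex m n} :
    (∀ x, x ∈ (addNbrsT G mem acc v).val ↔
      x ∈ acc ∨ x ∈ G.adj v ∧ mem.removed x = false) ∧
      (acc.Nodup → (addNbrsT G mem acc v).val.Nodup) := by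
  rw [addNbrsT, foldT_val]
  generalize G.adj v = l
  induction l generalizing acc with
  | nil => simp
  | cons u l ih =>
    rw [List.foldl_cons]
    simp only [val_op_bind] at ih ⊢
    split_ifs with hu
    · refine ⟨fun x => ?_, ih.2⟩
      rw [val_op, ih.1, List.mem_cons]
      constructor
      · tauto
      · rintro (h | ⟨rfl | h, h'⟩)
        · exact Or.inl h
        · simp [hu] at h'
        · exact Or.inr ⟨h, h'⟩
    · rw [insertT_val]
      split_ifs with hmem
      · refine ⟨fun x => ?_, ih.2⟩
        rw [ih.1, List.mem_cons]
        constructor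
        · tauto
        · rintro (h | ⟨rfl | h, h'⟩)
          · exact Or.inl h
          · exact Or.inl hmem
          · exact Or.inr ⟨h, h'⟩
      · refine ⟨fun x => ?_, fun h => ih.2 (List.nodup_cons.2 ⟨hmem, h⟩)⟩
        rw [ih.1, List.mem_cons, List.mem_cons]
        constructor
        · rintro ((rfl | h) | h)
          · exact Or.inr ⟨Or.inl rfl, by simpa using hu⟩
          · exact Or.inl h
          · exact Or.inr ⟨Or.inr h.1, h.2⟩
        · tauto

/-- Repeated `addNbrsT` lists the remaining neighbours of all vertices of `l`. -/
theorem foldl_addNbrsT {mem : CoreMem m n} {l : List (Vertex m n)} :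
    (∀ x, x ∈ (foldT (fun acc u => addNbrsT G mem acc u) [] l).val ↔
      ∃ v ∈ l, x ∈ G.adj v ∧ mem.removed x = false) ∧
      (foldT (fun acc u => addNbrsT G mem acc u) [] l).val.Nodup := by
  rw [foldT_val]
  suffices h : ∀ acc : List (Vertex m n), (∀ x, x ∈ l.foldl (fun b a => (addNbrsT G mem b a).val) acc
      ↔ x ∈ acc ∨ ∃ v ∈ l, x ∈ G.adj v ∧ mem.removed x = false) ∧
      (acc.Nodup → (l.foldl (fun b a => (addNbrsT G mem b a).val) acc).Nodup) by
    obtain ⟨h1, h2⟩ := h []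
    exact ⟨fun x => by rw [h1]; simp, h2 List.nodup_nil⟩
  induction l with
  | nil => simp
  | cons v l ih =>
    intro acc
    rw [List.foldl_cons]
    refine ⟨fun x => ?_, fun h => (ih _).2 (addNbrsT_val.2 h)⟩
    rw [(ih _).1, addNbrsT_val.1]
    simp only [List.mem_cons, exists_eq_or_imp]
    tauto

variable (G)

/-- The candidates and the excluded vertices of the branch in which `v_j` is included. -/
def ieSetT (k : ℕ) (B : Bounds) (mem : CoreMem m n) (j : Fin m) (v : Vertex m n) :
    Timed (List (Vertex m n) × List (Vertex m n)) := do
  let near ← addNbrsT G mem [] v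
  let hop ← foldT (fun acc u => addNbrsT G mem acc u) [] near
  let later ← filterT (fun w => op (match w with
    | Sum.inl i => decide (j < i)
    | Sum.inr _ => false)) hop
  let D ← filterT (fun w => op (match w with
    | Sum.inl i => decide (i < j)
    | Sum.inr _ => false)) hop
  let Lj ← op (v :: later)
  let Rj ← foldT (fun acc w => addNbrsT G mem acc w) [] Lj
  let CL ← filterT (fun w => do
    let c ← degT G w Rj
    let c' ← countT (fun u => do
      let b ← adjT G w u
      let b' ← adjT G v u
      op (b && b')) Rj
    op (decide (B.lbR - k ≤ c) && decide (B.lbR - 2 * k ≤ c'))) later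
  let CR ← filterT (fun u => do
    let c ← degT G u Lj
    op (decide (B.lbL - k ≤ c))) Rj
  let C ← appendT CL CR
  pure (C, D)

theorem ieStepT_eq (k : ℕ) (B : Bounds) (mem : CoreMem m n) (best : Sol m n) (j : Fin m) :
    ieStepT G k B mem best j = (do
      let v ← op (Sum.inl j : Vertex m n)
      let r ← op (mem.removed v)
      if r then op best
      else do
        let CD ← ieSetT G k B mem j v
        fastBBRec G k B (CD.1.length + 1) [v] CD.1 CD.2 best) := by
  rw [ieStepT]
  refine congrArg _ (funext fun v => congrArg _ (funext fun r => ?_))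
  split_ifs
  · rfl
  · simp only [ieSetT, Timed.bind_assoc, Timed.pure_bind]

variable {G}

/-- The subgraph around `v_j`, pruned by degrees. -/
structure IsSetup (G : BipGraph m n) (k : ℕ) (B : Bounds) (mem : CoreMem m n) (j : Fin m)
    (hop later Rj C D : List (Vertex m n)) : Prop where
  hop_nodup : hop.Nodup
  mem_hop : ∀ x, x ∈ hop ↔ ∃ u, (u ∈ G.adj (Sum.inl j) ∧ mem.removed u = false) ∧
    x ∈ G.adj u ∧ mem.removed x = false
  later_nodup : later.Nodup
  mem_later : ∀ x, x ∈ later ↔ x ∈ hop ∧ ∃ i, x = Sum.inl i ∧ j < i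
  Rj_nodup : Rj.Nodup
  mem_Rj : ∀ x, x ∈ Rj ↔ ∃ v ∈ (Sum.inl j :: later : List (Vertex m n)),
    x ∈ G.adj v ∧ mem.removed x = false
  C_nodup : C.Nodup
  mem_C : ∀ x, x ∈ C ↔ (x ∈ later ∧ B.lbR - k ≤ degIn G x Rj.toFinset ∧
      B.lbR - 2 * k ≤ (Rj.toFinset.filter fun u => u ∈ G.adj x ∧ u ∈ G.adj (Sum.inl j)).card) ∨
    x ∈ Rj ∧ B.lbL - k ≤ degIn G x (Sum.inl j :: later : List (Vertex m n)).toFinset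
  D_nodup : D.Nodup
  mem_D : ∀ x, x ∈ D ↔ x ∈ hop ∧ ∃ i, x = Sum.inl i ∧ i < j

theorem isLeft_of_mem_later {k : ℕ} {B : Bounds} {mem : CoreMem m n} {j : Fin m}
    {hop later Rj C D : List (Vertex m n)} (h : IsSetup G k B mem j hop later Rj C D)
    {x : Vertex m n} (hx : x ∈ (Sum.inl j :: later : List (Vertex m n))) : x.isLeft = true := by
  rcases List.mem_cons.1 hx with rfl | hx
  · rfl
  · obtain ⟨-, i, rfl, -⟩ := (h.mem_later x).1 hx
    rfl

theorem isLeft_of_mem_Rj {k : ℕ} {B : Bounds} {mem : CoreMem m n} {j : Fin m}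
    {hop later Rj C D : List (Vertex m n)} (h : IsSetup G k B mem j hop later Rj C D)
    {x : Vertex m n} (hx : x ∈ Rj) : x.isLeft = false := by
  obtain ⟨v, hv, hxv, -⟩ := (h.mem_Rj x).1 hx
  have h1 := G.bip _ _ hxv
  rw [isLeft_of_mem_later h hv] at h1
  simpa using h1.symm

/-- From here on, the candidates and excluded vertices are known only through membership and absence
of repetitions; the order in which the lists were built is irrelevant. -/
theorem ieSetT_isSetup (k : ℕ) (B : Bounds) (mem : CoreMem m n) (j : Fin m) :
    ∃ hop later Rj, IsSetup G k B mem j hop later Rj (ieSetT G k B mem j (Sum.inl j)).val.1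
      (ieSetT G k B mem j (Sum.inl j)).val.2 := by
  obtain ⟨hn1, -⟩ := addNbrsT_val (G := G) (mem := mem) (acc := []) (v := Sum.inl j)
  set near := (addNbrsT G mem [] (Sum.inl j)).val with hnear
  obtain ⟨hh1, hh2⟩ := foldl_addNbrsT (G := G) (mem := mem) (l := near)
  set hop := (foldT (fun acc u => addNbrsT G mem acc u) [] near).val with hhop
  set later := hop.filter fun w => (match w with
    | Sum.inl i => decide (j < i)
    | Sum.inr _ => false) with hlater
  have hmem_hop : ∀ x, x ∈ hop ↔ ∃ u, (u ∈ G.adj (Sum.inl j) ∧ mem.removed u = false) ∧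
      x ∈ G.adj u ∧ mem.removed x = false := by
    intro x
    rw [hh1]
    refine exists_congr fun u => and_congr_left fun _ => ?_
    rw [hn1]
    simp
  have hlater_mem : ∀ x, x ∈ later ↔ x ∈ hop ∧ ∃ i, x = Sum.inl i ∧ j < i := by
    intro x
    rw [hlater, List.mem_filter]
    cases x <;> simp
  have hlater_nd : later.Nodup := hh2.filter _
  have hj : (Sum.inl j : Vertex m n) ∉ later := by
    rw [hlater_mem]
    rintro ⟨-, i, hi, hlt⟩
    simp only [Sum.inl.injEq] at hi
    exact hlt.ne hi
  have hLj_nd : (Sum.inl j :: later : List (Vertex m n)).Nodup :=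
    List.nodup_cons.2 ⟨hj, hlater_nd⟩
  obtain ⟨hr1, hr2⟩ := foldl_addNbrsT (G := G) (mem := mem) (l := Sum.inl j :: later)
  set Rj := (foldT (fun acc u => addNbrsT G mem acc u) [] (Sum.inl j :: later)).val with hRj
  have hval : (ieSetT G k B mem j (Sum.inl j)).val =
      ((later.filter fun w => decide (B.lbR - k ≤ (degIn G w Rj.toFinset : ℚ)) &&
          decide (B.lbR - 2 * k ≤ ((Rj.toFinset.filter fun u =>
            u ∈ G.adj w ∧ u ∈ G.adj (Sum.inl j)).card : ℚ))) ++
        (Rj.filter fun u => decide (B.lbL - k ≤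
          (degIn G u (Sum.inl j :: later : List (Vertex m n)).toFinset : ℚ))),
      hop.filter fun w => (match w with
        | Sum.inl i => decide (i < j)
        | Sum.inr _ => false)) := by
    simp only [ieSetT, val_bind, val_pure, filterT_val, val_op, appendT_val, countT_val,
      adjT_val, ← Bool.decide_and]
    simp only [← hnear, ← hhop, ← hlater, ← hRj, degT_val G hr2, degT_val G hLj_nd,
      countP_eq_card hr2]
  have hset : ∀ x, x ∈ (ieSetT G k B mem j (Sum.inl j)).val.1 ↔
      (x ∈ later ∧ B.lbR - k ≤ degIn G x Rj.toFinset ∧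
        B.lbR - 2 * k ≤ (Rj.toFinset.filter fun u => u ∈ G.adj x ∧ u ∈ G.adj (Sum.inl j)).card) ∨
      x ∈ Rj ∧ B.lbL - k ≤ degIn G x (Sum.inl j :: later : List (Vertex m n)).toFinset := by
    intro x
    rw [hval]
    simp only [List.mem_append, List.mem_filter, Bool.and_eq_true, decide_eq_true_eq]
  have hLR : ∀ x ∈ later, x ∉ Rj := by
    intro x hx hx'
    obtain ⟨-, i, rfl, -⟩ := (hlater_mem x).1 hx
    obtain ⟨v, hv, hxv, -⟩ := (hr1 _).1 hx'
    have h1 := G.bip _ _ hxv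
    rcases List.mem_cons.1 hv with rfl | hv
    · exact h1 rfl
    · obtain ⟨-, i', rfl, -⟩ := (hlater_mem v).1 hv
      exact h1 rfl
  refine ⟨hop, later, Rj, hh2, hmem_hop, hlater_nd, hlater_mem, hr2, hr1, ?_, hset, ?_, ?_⟩
  · rw [hval]
    refine List.nodup_append.2 ⟨hlater_nd.filter _, hr2.filter _, fun x hx y hy => ?_⟩
    rintro rfl
    exact hLR x (List.mem_filter.1 hx).1 (List.mem_filter.1 hy).1
  · rw [hval]
    exact hh2.filter _
  · intro x
    rw [hval]
    rw [List.mem_filter]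
    cases x <;> simp

theorem IsSetup.nodup {k : ℕ} {B : Bounds} {mem : CoreMem m n} {j : Fin m}
    {hop later Rj C D : List (Vertex m n)} (h : IsSetup G k B mem j hop later Rj C D) :
    ([Sum.inl j] ++ C).Nodup := by
  rw [List.singleton_append, List.nodup_cons]
  refine ⟨fun hj => ?_, h.C_nodup⟩
  rcases (h.mem_C _).1 hj with hj | hj
  · obtain ⟨-, i, hi, hlt⟩ := (h.mem_later _).1 hj.1
    simp only [Sum.inl.injEq] at hi
    exact hlt.ne hi
  · simpa using isLeft_of_mem_Rj h hj.1

theorem IsSetup.not_mem {k : ℕ} {B : Bounds} {mem : CoreMem m n} {j : Fin m}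
    {hop later Rj C D : List (Vertex m n)} (h : IsSetup G k B mem j hop later Rj C D) :
    ∀ v ∈ D, v ∉ [Sum.inl j] ++ C := by
  intro v hv hmem
  obtain ⟨-, i, rfl, hi⟩ := (h.mem_D v).1 hv
  rw [List.singleton_append, List.mem_cons] at hmem
  rcases hmem with hmem | hmem
  · simp only [Sum.inl.injEq] at hmem
    exact hi.ne hmem
  · rcases (h.mem_C _).1 hmem with hj | hj
    · obtain ⟨-, i', hi', hlt⟩ := (h.mem_later _).1 hj.1
      simp only [Sum.inl.injEq] at hi'
      subst hi'
      exact lt_asymm hi hlt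
    · simpa using isLeft_of_mem_Rj h hj.1

/-- Connecting paths run inside the biplex: a common neighbour of `v_j` and `i` can be chosen in
`Y`, so the core computation has not removed it. Thus `X` and `Y` lie in the unfiltered lists, and
degrees and common neighbours inside the biplex are already numerous enough for the filters. -/
theorem IsSetup.subset {k : ℕ} {B : Bounds} {mem : CoreMem m n} {j : Fin m}
    {hop later Rj C D : List (Vertex m n)} (h : IsSetup G k B mem j hop later Rj C D)
    {X : Finset (Fin m)} {Y : Finset (Fin n)} (hb : IsBiplex G k X Y) (hX : k + 1 ≤ X.card)
    (hY : 2 * k + 1 ≤ Y.card) (hj : j ∈ X) (hmin : ∀ i ∈ X, j ≤ i)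
    (hmem : ∀ x ∈ X.disjSum Y, mem.removed x = false) (hLB : B.lbL ≤ X.card)
    (hRB : B.lbR ≤ Y.card) : X.disjSum Y ⊆ ([Sum.inl j] ++ C).toFinset := by
  have hXL : ∀ i ∈ X, (Sum.inl i : Vertex m n) ∈ (Sum.inl j :: later : List (Vertex m n)) := by
    intro i hi
    rw [List.mem_cons]
    by_cases hij : i = j
    · exact Or.inl (by rw [hij])
    · refine Or.inr ((h.mem_later _).2 ⟨(h.mem_hop _).2 ?_, i, rfl,
        lt_of_le_of_ne (hmin i hi) (Ne.symm hij)⟩)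
      obtain ⟨u, hu, hju, hiu⟩ := hb.exists_common hY hj hi
      exact ⟨Sum.inr u, ⟨hju, hmem _ (by simpa using hu)⟩, G.symm _ _ hiu,
        hmem _ (by simpa using hi)⟩
  have hYR : ∀ u ∈ Y, (Sum.inr u : Vertex m n) ∈ Rj := by
    intro u hu
    obtain ⟨v, hv, hvu⟩ := hb.exists_nbrL hX hu
    exact (h.mem_Rj _).2 ⟨_, hXL v hv, hvu, hmem _ (by simpa using hu)⟩
  have hYR' : Y.map Function.Embedding.inr ⊆ Rj.toFinset := by
    intro x hx
    obtain ⟨u, hu, rfl⟩ := Finset.mem_map.1 hx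
    exact List.mem_toFinset.2 (hYR u hu)
  have hXL' : X.map Function.Embedding.inl ⊆
      (Sum.inl j :: later : List (Vertex m n)).toFinset := by
    intro x hx
    obtain ⟨i, hi, rfl⟩ := Finset.mem_map.1 hx
    exact List.mem_toFinset.2 (hXL i hi)
  have hd := hb.hasMinDegs (p := X.card) (q := Y.card) le_rfl le_rfl
  intro x hx
  rw [List.mem_toFinset, List.singleton_append, List.mem_cons]
  rcases x with i | u
  · have hi : i ∈ X := by simpa using hx
    refine (List.mem_cons.1 (hXL i hi)).imp_right fun hl => (h.mem_C _).2 (Or.inl ⟨hl, ?_, ?_⟩)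
    · have h1 := hd.1 i hi
      have h2 : (nbrR G i Y).card ≤ degIn G (Sum.inl i) Rj.toFinset := by
        rw [← Finset.card_map Function.Embedding.inr]
        refine Finset.card_le_card fun y hy => ?_
        obtain ⟨u, hu, rfl⟩ := Finset.mem_map.1 hy
        rw [nbrR, Finset.mem_filter] at hu
        exact Finset.mem_filter.2 ⟨hYR' (Finset.mem_map_of_mem _ hu.1), hu.2⟩
      have h3 : (Y.card : ℚ) ≤ degIn G (Sum.inl i) Rj.toFinset + k := by
        exact_mod_cast (by omega : Y.card ≤ degIn G (Sum.inl i) Rj.toFinset + k)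
      linarith
    · have h1 := hb.card_common hi hj
      have h2 : (nbrR G i Y ∩ nbrR G j Y).card ≤ (Rj.toFinset.filter fun u =>
          u ∈ G.adj (Sum.inl i) ∧ u ∈ G.adj (Sum.inl j)).card := by
        rw [← Finset.card_map Function.Embedding.inr]
        refine Finset.card_le_card fun y hy => ?_
        obtain ⟨u, hu, rfl⟩ := Finset.mem_map.1 hy
        simp only [nbrR, Finset.mem_inter, Finset.mem_filter] at hu
        exact Finset.mem_filter.2 ⟨hYR' (Finset.mem_map_of_mem _ hu.1.1), hu.1.2, hu.2.2⟩
      have h3 : (Y.card : ℚ) ≤ (Rj.toFinset.filter fun u =>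
          u ∈ G.adj (Sum.inl i) ∧ u ∈ G.adj (Sum.inl j)).card + 2 * k := by
        exact_mod_cast h1.trans (Nat.add_le_add_right h2 _)
      linarith
  · have hu : u ∈ Y := by simpa using hx
    refine Or.inr ((h.mem_C _).2 (Or.inr ⟨hYR u hu, ?_⟩))
    have h1 := hd.2 u hu
    have h2 : (nbrL G u X).card ≤
        degIn G (Sum.inr u) (Sum.inl j :: later : List (Vertex m n)).toFinset := by
      rw [← Finset.card_map Function.Embedding.inl]
      refine Finset.card_le_card fun y hy => ?_
      obtain ⟨i, hi, rfl⟩ := Finset.mem_map.1 hy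
      rw [nbrL, Finset.mem_filter] at hi
      exact Finset.mem_filter.2 ⟨hXL' (Finset.mem_map_of_mem _ hi.1), G.symm _ _ hi.2⟩
    have h3 : (X.card : ℚ) ≤
        degIn G (Sum.inr u) (Sum.inl j :: later : List (Vertex m n)).toFinset + k := by
      exact_mod_cast (by omega : X.card ≤
        degIn G (Sum.inr u) (Sum.inl j :: later : List (Vertex m n)).toFinset + k)
    linarith

/-! ### Correctness of PBIE -/

theorem ieStepT_val (k : ℕ) (B : Bounds) (mem : CoreMem m n) (best : Sol m n) (j : Fin m) :
    (ieStepT G k B mem best j).val = if mem.removed (Sum.inl j) = true then best else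
      (fastBBRec G k B ((ieSetT G k B mem j (Sum.inl j)).val.1.length + 1) [Sum.inl j]
        (ieSetT G k B mem j (Sum.inl j)).val.1 (ieSetT G k B mem j (Sum.inl j)).val.2 best).val := by
  rw [ieStepT_eq]
  simp only [val_op_bind]
  split_ifs <;> rfl

theorem ieStepT_invariant {k : ℕ} {B : Bounds} {mem : CoreMem m n} (I : Sol m n → Prop)
    (hI : ∀ (T : List (Vertex m n)) b, T.Nodup → VBiplex G k T.toFinset →
      b.edges < vEdges G T.toFinset → B.lbL ≤ sideCard true T.toFinset →
      B.lbR ≤ sideCard false T.toFinset → I b → I ⟨T, vEdges G T.toFinset⟩)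
    {best : Sol m n} (j : Fin m) (hb : I best) : I (ieStepT G k B mem best j).val := by
  obtain ⟨_, _, _, h⟩ := ieSetT_isSetup (G := G) k B mem j
  rw [ieStepT_val]
  split_ifs
  · exact hb
  · exact fastBBRec_invariant I hI _ _ _ _ _ h.nodup hb

/-- `H` is empty, or it is a `k`-biplex that is large enough. -/
def Sol.Sound (G : BipGraph m n) (k θL θR : ℕ) (H : Sol m n) : Prop :=
  H.verts = [] ∧ H.edges = 0 ∨
    H.verts.Nodup ∧ VBiplex G k H.verts.toFinset ∧ H.edges = vEdges G H.verts.toFinset ∧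
      θL ≤ sideCard true H.verts.toFinset ∧ θR ≤ sideCard false H.verts.toFinset

theorem round_sound {k θL θR : ℕ} {B : Bounds} (hL : θL ≤ B.lbL) (hR : θR ≤ B.lbR)
    {mem : CoreMem m n} {best : Sol m n} (hbest : best.Sound G k θL θR) :
    ((List.finRange m).foldl (fun b j => (ieStepT G k B mem b j).val) best).Sound G k θL θR := by
  refine foldl_invariant (fun s : Sol m n => s.Sound G k θL θR) (fun b j _ hb => ?_) hbest
  refine ieStepT_invariant _ (fun T b hT hbi _ hL' hR' _ => Or.inr ⟨hT, hbi, rfl, ?_, ?_⟩) j hb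
  · exact_mod_cast hL.trans hL'
  · exact_mod_cast hR.trans hR'

theorem pbLoopT_sound {k θL θR dL : ℕ} : ∀ (fuel : ℕ) (lbL : ℚ) (best : Sol m n),
    best.Sound G k θL θR → (pbLoopT G k θL θR dL fuel lbL best).val.Sound G k θL θR := by
  intro fuel
  induction fuel with
  | zero => exact fun _ _ h => h
  | succ fuel ih =>
    intro lbL best hbest
    rw [pbLoopT]
    simp only [val_op_bind]
    rw [val_bind, val_bind, foldT_val, val_op_bind]
    set B : Bounds := ⟨max (lbL / 2) θL, lbL, max ((best.edges : ℚ) / lbL) θR, (dL : ℚ) + k⟩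
    have h1 := round_sound (G := G) (k := k) (B := B) (le_max_right _ _) (le_max_right _ _)
      (mem := (coreT G (B.lbR - k) (B.lbL - k)).val) hbest
    split_ifs
    · exact h1
    · exact ih _ _ h1

theorem edges_le_ieStepT {k : ℕ} {B : Bounds} {mem : CoreMem m n} (best : Sol m n) (j : Fin m) :
    best.edges ≤ (ieStepT G k B mem best j).val.edges :=
  ieStepT_invariant (fun s => best.edges ≤ s.edges)
    (fun _ _ _ _ h1 _ _ h2 => h2.trans h1.le) j le_rfl

theorem edges_le_round {k : ℕ} {B : Bounds} {mem : CoreMem m n} (best : Sol m n) :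
    best.edges ≤
      ((List.finRange m).foldl (fun b j => (ieStepT G k B mem b j).val) best).edges :=
  foldl_invariant (fun s : Sol m n => best.edges ≤ s.edges)
    (fun b j _ hb => hb.trans (edges_le_ieStepT b j)) le_rfl

theorem edges_le_pbLoopT {k θL θR dL : ℕ} : ∀ (fuel : ℕ) (lbL : ℚ) (best : Sol m n),
    best.edges ≤ (pbLoopT G k θL θR dL fuel lbL best).val.edges := by
  intro fuel
  induction fuel with
  | zero => exact fun _ _ => le_rfl
  | succ fuel ih =>
    intro lbL best
    rw [pbLoopT]
    simp only [val_op_bind]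
    rw [val_bind, val_bind, foldT_val, val_op_bind]
    split_ifs
    · exact edges_le_round best
    · exact (edges_le_round best).trans (ih _ _)

/-- `(X, Y)` has the most edges among all `k`-biplexes that are large enough. -/
structure IsOptimal (G : BipGraph m n) (k θL θR : ℕ) (X : Finset (Fin m)) (Y : Finset (Fin n)) :
    Prop where
  biplex : IsBiplex G k X Y
  left : θL ≤ X.card
  right : θR ≤ Y.card
  edges : ∀ X' Y', IsBiplex G k X' Y' → θL ≤ X'.card → θR ≤ Y'.card →
    numEdges G X' Y' ≤ numEdges G X Y

/-- Edge optimality yields the inclusion maximality on which pruning by excluded vertices depends: a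
proper extension would be a large biplex with strictly more edges. -/
theorem IsOptimal.mem_of_vBiplex_insert {k θL θR : ℕ} {X : Finset (Fin m)} {Y : Finset (Fin n)}
    (h : IsOptimal G k θL θR X Y) (hL : k + 1 ≤ θL) (hR : k + 1 ≤ θR) {v : Vertex m n}
    (hv : VBiplex G k (insert v (X.disjSum Y))) : v ∈ X.disjSum Y := by
  obtain ⟨X', Y', he⟩ := exists_eq_disjSum (insert v (X.disjSum Y))
  rw [he, vBiplex_disjSum] at hv
  have hX : X ⊆ X' := fun i hi => by
    have : (Sum.inl i : Vertex m n) ∈ X'.disjSum Y' := by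
      rw [← he]
      exact Finset.mem_insert_of_mem (by simpa using hi)
    simpa using this
  have hY : Y ⊆ Y' := fun i hi => by
    have : (Sum.inr i : Vertex m n) ∈ X'.disjSum Y' := by
      rw [← he]
      exact Finset.mem_insert_of_mem (by simpa using hi)
    simpa using this
  obtain ⟨rfl, rfl⟩ := hv.eq_of_numEdges_le hX hY (hL.trans h.left) (hR.trans h.right)
    (h.edges _ _ hv (h.left.trans (Finset.card_le_card hX))
      (h.right.trans (Finset.card_le_card hY)))
  rw [← he]
  exact Finset.mem_insert_self _ _

/-- The round whose bounds fit an optimal biplex finds a biplex that is as good. -/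
theorem IsOptimal.le_round {k θL θR : ℕ} {X : Finset (Fin m)} {Y : Finset (Fin n)}
    (h : IsOptimal G k θL θR X Y) (hL : 2 * k + 1 ≤ θL) (hR : 2 * k + 1 ≤ θR) {B : Bounds}
    (h1 : B.lbL ≤ X.card) (h2 : X.card ≤ B.ubL) (h3 : B.lbR ≤ Y.card) (h4 : Y.card ≤ B.ubR)
    (best : Sol m n) : numEdges G X Y ≤ ((List.finRange m).foldl
      (fun b j => (ieStepT G k B (coreT G (B.lbR - k) (B.lbL - k)).val b j).val) best).edges := by
  have hXc := h.left
  have hYc := h.right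
  have hd := h.biplex.hasMinDegs (p := X.card) (q := Y.card) le_rfl le_rfl
  have hkeep := coreT_keeps (G := G) (P := X.disjSum Y) (α := B.lbR - k) (β := B.lbL - k) (by
    rintro (v | u) hw
    · have h5 := hd.1 v (by simpa using hw)
      have h6 : (Y.card : ℚ) ≤ (nbrR G v Y).card + k := by
        exact_mod_cast (by omega : Y.card ≤ (nbrR G v Y).card + k)
      rw [degIn_inl]
      simp only [Sum.isLeft_inl, if_true]
      linarith
    · have h5 := hd.2 u (by simpa using hw)
      have h6 : (X.card : ℚ) ≤ (nbrL G u X).card + k := by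
        exact_mod_cast (by omega : X.card ≤ (nbrL G u X).card + k)
      rw [degIn_inr]
      simp only [Sum.isLeft_inr, Bool.false_eq_true, if_false]
      linarith)
  -- The step of the first vertex of `X` does the work. The other steps of the round only have to
  -- keep the edge number from falling.
  obtain ⟨j, hj, hmin⟩ : ∃ j ∈ X, ∀ i ∈ X, j ≤ i := by
    have hne : X.Nonempty := by rw [← Finset.card_pos]; omega
    exact ⟨X.min' hne, X.min'_mem hne, fun w hw => X.min'_le w hw⟩
  refine le_foldl Sol.edges (fun b j _ => edges_le_ieStepT b j)
    ⟨j, List.mem_finRange j, fun b => ?_⟩ best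
  obtain ⟨hop, later, Rj, hs⟩ :=
    ieSetT_isSetup (G := G) k B (coreT G (B.lbR - k) (B.lbL - k)).val j
  have hjP : (Sum.inl j : Vertex m n) ∈ X.disjSum Y := by simpa using hj
  rw [ieStepT_val, if_neg (by simp [hkeep _ hjP]), ← vEdges_disjSum]
  have ht : IsTarget G k B (X.disjSum Y) := by
    refine ⟨vBiplex_disjSum.2 h.biplex,
      fun v hv => h.mem_of_vBiplex_insert (by omega) (by omega) hv, ?_, ?_, ?_, ?_⟩
    · rwa [sideCard_true_disjSum]
    · rwa [sideCard_true_disjSum]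
    · rwa [sideCard_false_disjSum]
    · rwa [sideCard_false_disjSum]
  refine ht.le_fastBBRec _ _ _ _ _ hs.nodup hs.not_mem ?_ ?_ (Nat.lt_succ_self _)
  · simpa using hj
  · exact hs.subset h.biplex (by omega) (by omega) hj hmin hkeep h1 h3

theorem IsOptimal.edges_le_of_sound {k θL θR : ℕ} {X : Finset (Fin m)} {Y : Finset (Fin n)}
    (h : IsOptimal G k θL θR X Y) {s : Sol m n} (hs : s.Sound G k θL θR) :
    s.edges ≤ numEdges G X Y := by
  rcases hs with ⟨-, h0⟩ | ⟨hnd, hb, he, hL, hR⟩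
  · omega
  · rw [he]
    rw [toFinset_eq_disjSum] at hb hL hR ⊢
    rw [vBiplex_disjSum] at hb
    rw [sideCard_true_disjSum] at hL
    rw [sideCard_false_disjSum] at hR
    rw [vEdges_disjSum]
    exact h.edges _ _ hb hL hR

/-- The invariant is that `|X|` does not exceed the current upper bound. Either `|X|` reaches the
new lower bound and this round succeeds, or `|X|` lies below it and the invariant passes to the next
round. The condition on `fuel` ensures that the lower bound comes down to `θ_L` in time. -/
theorem IsOptimal.le_pbLoopT {k θL θR dL : ℕ} {X : Finset (Fin m)} {Y : Finset (Fin n)}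
    (h : IsOptimal G k θL θR X Y) (hL : 2 * k + 1 ≤ θL) (hR : 2 * k + 1 ≤ θR)
    (hY : Y.card ≤ dL + k) :
    ∀ (fuel : ℕ) (lbL : ℚ) (best : Sol m n), fuel ≠ 0 → best.Sound G k θL θR → X.card ≤ lbL →
      lbL ≤ 2 ^ fuel * (θL : ℚ) →
      numEdges G X Y ≤ (pbLoopT G k θL θR dL fuel lbL best).val.edges := by
  intro fuel
  induction fuel with
  | zero => intro _ _ h0; exact absurd rfl h0
  | succ fuel ih =>
    intro lbL best _ hbest hX hfuel
    rw [pbLoopT]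
    simp only [val_op_bind]
    rw [val_bind, val_bind, foldT_val, val_op_bind]
    set B : Bounds := ⟨max (lbL / 2) θL, lbL, max ((best.edges : ℚ) / lbL) θR, (dL : ℚ) + k⟩
      with hB
    have hsound := round_sound (G := G) (k := k) (B := B) (le_max_right _ _) (le_max_right _ _)
      (mem := (coreT G (B.lbR - k) (B.lbL - k)).val) hbest
    have hXL : (θL : ℚ) ≤ X.card := by exact_mod_cast h.left
    have hθ : (0 : ℚ) < θL := by exact_mod_cast (by omega : 0 < θL)
    have hlb : 0 < lbL := by linarith
    have hround : B.lbL ≤ X.card → numEdges G X Y ≤ ((List.finRange m).foldl (fun b j =>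
        (ieStepT G k B (coreT G (B.lbR - k) (B.lbL - k)).val b j).val) best).edges := by
      intro hle
      refine h.le_round hL hR hle hX (max_le ?_ (by exact_mod_cast h.right))
        (by simp only [hB]; exact_mod_cast hY) best
      -- The record is a large biplex or empty, so its edge number is at most that of the optimum,
      -- hence at most `|X| |Y| ≤ UB_L |Y|`. This makes `LB_R ≤ |Y|`.
      rw [div_le_iff₀ hlb]
      have h1 : (best.edges : ℚ) ≤ X.card * Y.card := by
        exact_mod_cast (h.edges_le_of_sound hbest).trans (numEdges_le_mul G X Y)
      calc (best.edges : ℚ) ≤ X.card * Y.card := h1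
        _ ≤ lbL * Y.card := by gcongr
        _ = Y.card * lbL := mul_comm _ _
    split_ifs with hfin
    · exact hround ((of_decide_eq_true hfin).trans hXL)
    · rcases le_or_gt B.lbL X.card with hle | hlt
      · exact (hround hle).trans (edges_le_pbLoopT _ _ _)
      · have hhalf : B.lbL ≤ 2 ^ fuel * (θL : ℚ) := by
          refine max_le ?_ ?_
          · rw [div_le_iff₀ two_pos]
            calc lbL ≤ 2 ^ (fuel + 1) * (θL : ℚ) := hfuel
              _ = 2 ^ fuel * (θL : ℚ) * 2 := by ring
          · exact le_mul_of_one_le_left hθ.le (one_le_pow₀ (by norm_num))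
        refine ih _ _ ?_ hsound hlt.le hhalf
        -- With no fuel left the new lower bound would be at most `θ_L`, and this round would have
        -- been the last one.
        rintro rfl
        rw [pow_zero, one_mul] at hhalf
        exact hfin (decide_eq_true hhalf)

variable (G) in
/-- The scan for the maximum degree of `L`. -/
def scanLT : Timed ℕ :=
  foldT (fun x v => do
    let c ← lengthT (G.adj v)
    op (max x c)) 0 (leftList m n)

variable (G) in
/-- The scan for the maximum degree of `R`. -/
def scanRT : Timed ℕ :=
  foldT (fun x v =>
    foldT (fun x u => do
      let c ← lengthT (G.adj u)
      op (max x c)) x (G.adj v)) 0 (leftList m n)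

theorem pbieT_eq (k θL θR : ℕ) : pbieT G k θL θR = (do
    let dL ← scanLT G
    let dR ← scanRT G
    pbLoopT G k θL θR dL (dR + k + 1) ((dR : ℚ) + k) ⟨[], 0⟩) := rfl

theorem length_adj_inl (v : Fin m) :
    (G.adj (Sum.inl v)).length = (nbrR G v Finset.univ).card := by
  rw [← List.toFinset_card_of_nodup (G.nodup _)]
  refine (congrArg Finset.card (Finset.ext fun w => ?_)).trans
    (Finset.card_map Function.Embedding.inr)
  rw [List.mem_toFinset, mem_adj_inl_iff]
  simp [nbrR, eq_comm]

theorem length_adj_inr (u : Fin n) :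
    (G.adj (Sum.inr u)).length = (nbrL G u Finset.univ).card := by
  rw [← List.toFinset_card_of_nodup (G.nodup _)]
  refine (congrArg Finset.card (Finset.ext fun w => ?_)).trans
    (Finset.card_map Function.Embedding.inl)
  rw [List.mem_toFinset, mem_adj_inr_iff]
  simp [nbrL, eq_comm]

theorem length_adj_le_scanLT (v : Fin m) : (G.adj (Sum.inl v)).length ≤ (scanLT G).val := by
  rw [scanLT, foldT_val]
  refine le_foldl id (fun b a _ => ?_) ⟨Sum.inl v, by simp [leftList], fun b => ?_⟩ 0 <;> simp

/-- The scan reaches right vertices only through edges, so isolated ones must be left out. -/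
theorem length_adj_le_scanRT {v : Fin m} {u : Fin n} (h : Edge G v u) :
    (G.adj (Sum.inr u)).length ≤ (scanRT G).val := by
  rw [scanRT, foldT_val]
  have hmono : ∀ (l : List (Vertex m n)) (b : ℕ), b ≤ (foldT (fun x u => do
      let c ← lengthT (G.adj u)
      op (max x c)) b l).val := by
    intro l b
    rw [foldT_val]
    exact foldl_invariant (fun x => b ≤ x) (fun x a _ hx => by simp [hx]) le_rfl
  refine le_foldl id (fun b a _ => hmono _ _) ⟨Sum.inl v, by simp [leftList], fun b => ?_⟩ 0
  simp only [foldT_val, id]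
  refine le_foldl id (fun b a _ => ?_) ⟨Sum.inr u, h, fun b => ?_⟩ b <;> simp

theorem scanRT_le : (scanRT G).val ≤ maxDegR G := by
  rw [scanRT, foldT_val]
  refine foldl_invariant (fun x => x ≤ maxDegR G) (fun x v hv hx => ?_) (Nat.zero_le _)
  rw [foldT_val]
  refine foldl_invariant (fun x => x ≤ maxDegR G) (fun x u hu hx => ?_) hx
  simp only [leftList, List.mem_map] at hv
  obtain ⟨i, -, rfl⟩ := hv
  obtain ⟨u, -, rfl⟩ := (mem_adj_inl_iff _ _).1 hu
  simp only [val_bind, lengthT_val, val_op]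
  refine max_le hx ?_
  rw [length_adj_inr]
  exact Finset.le_sup (f := fun u : Fin n => (nbrL G u Finset.univ).card) (Finset.mem_univ u)

theorem pbieT_sound (k θL θR : ℕ) : (pbieT G k θL θR).val.Sound G k θL θR := by
  rw [pbieT_eq]
  exact pbLoopT_sound _ _ _ (Or.inl ⟨rfl, rfl⟩)

/-- The initial upper bounds are valid because a vertex of the biplex is adjacent to all but `k`
vertices of the other side. An edge inside the biplex provides a right vertex that the scan has
seen. -/
theorem IsOptimal.le_pbieT {k θL θR : ℕ} {X : Finset (Fin m)} {Y : Finset (Fin n)}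
    (h : IsOptimal G k θL θR X Y) (hL : 2 * k + 1 ≤ θL) (hR : 2 * k + 1 ≤ θR) :
    numEdges G X Y ≤ (pbieT G k θL θR).val.edges := by
  have hXc := h.left
  have hYc := h.right
  obtain ⟨v, hv⟩ : X.Nonempty := by rw [← Finset.card_pos]; omega
  obtain ⟨u, hu, hvu⟩ := h.biplex.exists_nbrR (by omega) hv
  have hd := h.biplex.hasMinDegs (p := X.card) (q := Y.card) le_rfl le_rfl
  have h1 : Y.card ≤ (scanLT G).val + k := by
    have h2 := length_adj_le_scanLT (G := G) v
    have h3 := Finset.card_le_card (nbrR_mono G v (Finset.subset_univ Y))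
    have h4 := hd.1 v hv
    rw [length_adj_inl] at h2
    omega
  have h2 : X.card ≤ (scanRT G).val + k := by
    have h2 := length_adj_le_scanRT hvu
    have h3 := Finset.card_le_card (nbrL_mono G u (Finset.subset_univ X))
    have h4 := hd.2 u hu
    rw [length_adj_inr] at h2
    omega
  rw [pbieT_eq]
  refine h.le_pbLoopT hL hR h1 _ _ _ (Nat.succ_ne_zero _) (Or.inl ⟨rfl, rfl⟩)
    (by exact_mod_cast h2) ?_
  have h5 : (scanRT G).val + k ≤ 2 ^ ((scanRT G).val + k + 1) * θL :=
    (Nat.lt_two_pow_self.le.trans (Nat.pow_le_pow_right two_pos (Nat.le_succ _))).trans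
      (Nat.le_mul_of_pos_right _ (by omega))
  exact_mod_cast h5

theorem pbieT_correct {k θL θR : ℕ} (hL : 2 * k + 1 ≤ θL) (hR : 2 * k + 1 ≤ θR) :
    IsMaxBP G k θL θR (pbieT G k θL θR).val.left (pbieT G k θL θR).val.right ∨
      ((¬ ∃ X Y, IsMaxBP G k θL θR X Y) ∧ (pbieT G k θL θR).val.verts = []) := by
  have hs := pbieT_sound (G := G) k θL θR
  by_cases hex : ∃ X Y, IsBiplex G k X Y ∧ θL ≤ X.card ∧ θR ≤ Y.card
  -- There are finitely many vertex sets, so a large biplex with the most edges exists. It has at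
  -- least one edge, which rules out the empty output.
  · obtain ⟨X, Y, hopt⟩ : ∃ X Y, IsOptimal G k θL θR X Y := by
      classical
      obtain ⟨X₀, Y₀, h₀⟩ := hex
      obtain ⟨⟨X, Y⟩, hmem, hmax⟩ := Finset.exists_max_image
        ((Finset.univ : Finset (Finset (Fin m) × Finset (Fin n))).filter fun p =>
          IsBiplex G k p.1 p.2 ∧ θL ≤ p.1.card ∧ θR ≤ p.2.card)
        (fun p => numEdges G p.1 p.2) ⟨(X₀, Y₀), by simpa using h₀⟩
      simp only [Finset.mem_filter, Finset.mem_univ, true_and] at hmem hmax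
      exact ⟨X, Y, hmem.1, hmem.2.1, hmem.2.2, fun X' Y' h1 h2 h3 => hmax (X', Y') ⟨h1, h2, h3⟩⟩
    have hle := hopt.le_pbieT hL hR
    have hpos := hopt.biplex.numEdges_pos (by have := hopt.left; omega)
      (by have := hopt.right; omega)
    rcases hs with ⟨-, h0⟩ | ⟨hnd, hb, he, h1, h2⟩
    · omega
    · left
      rw [toFinset_eq_disjSum] at hb h1 h2 he
      rw [vBiplex_disjSum] at hb
      rw [sideCard_true_disjSum] at h1
      rw [sideCard_false_disjSum] at h2
      rw [vEdges_disjSum] at he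
      refine isMaxBP_of_forall_le (by omega) (by omega) hb h1 h2 fun X' Y' h3 h4 h5 => ?_
      have h6 := hopt.edges X' Y' h3 h4 h5
      rw [Sol.left, Sol.right, ← he]
      omega
  · right
    refine ⟨?_, ?_⟩
    · rintro ⟨X, Y, h⟩
      exact hex ⟨X, Y, h.1.1.1, h.1.2.1, h.1.2.2⟩
    · rcases hs with ⟨h0, -⟩ | ⟨-, hb, -, h1, h2⟩
      · exact h0
      · exfalso
        rw [toFinset_eq_disjSum] at hb h1 h2
        rw [vBiplex_disjSum] at hb
        rw [sideCard_true_disjSum] at h1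
        rw [sideCard_false_disjSum] at h2
        exact hex ⟨_, _, hb, h1, h2⟩

end Framework

section FastBBCost

variable {m n : ℕ} {G : BipGraph m n} {N : ℕ}

/-! ### The cost of the parts of FastBB -/

theorem length_mul_le {α : Type} {l : List α} {K : ℕ} (h : l.length ≤ N) :
    l.length * K + 1 ≤ N * K + 1 :=
  Nat.add_le_add_right (Nat.mul_le_mul_right _ h) 1

theorem le_sq_of_one_le (hN : 1 ≤ N) : N ≤ N ^ 2 ∧ N ^ 2 ≤ N ^ 3 ∧ N ^ 3 ≤ N ^ 4 :=
  ⟨by nlinarith, Nat.pow_le_pow_right hN (by norm_num), Nat.pow_le_pow_right hN (by norm_num)⟩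

theorem memT_cost_le (hN : 1 ≤ N) (x : Vertex m n) {l : List (Vertex m n)} (hl : l.length ≤ N) :
    (memT x l).cost ≤ 3 * N := by
  have h := anyT_cost_le (p := fun y => op (decide (x = y))) (l := l) (K := 1)
    fun _ _ => le_rfl
  rw [memT]
  omega

theorem adjT_cost_le (hN : 1 ≤ N) (hG : ∀ v, (G.adj v).length ≤ N) (v w : Vertex m n) :
    (adjT G v w).cost ≤ 3 * N :=
  memT_cost_le hN w (hG v)

theorem nonAdjT_cost_le (hN : 1 ≤ N) (hG : ∀ v, (G.adj v).length ≤ N) (v w : Vertex m n) :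
    (nonAdjT G v w).cost ≤ 4 * N := by
  have h := adjT_cost_le hN hG v w
  rw [nonAdjT]
  split_ifs
  · rw [cost_op]
    omega
  · simp only [cost_bind, cost_op]
    omega

theorem degT_cost_le (hN : 1 ≤ N) (hG : ∀ v, (G.adj v).length ≤ N) (v : Vertex m n)
    {T : List (Vertex m n)} (hT : T.length ≤ N) : (degT G v T).cost ≤ 5 * N ^ 2 := by
  have h1 := (countT_cost_le (l := T) fun w _ => adjT_cost_le hN hG v w).trans (length_mul_le hT)
  obtain ⟨h2, -, -⟩ := le_sq_of_one_le hN
  rw [degT]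
  linarith

theorem nonDegT_cost_le (hN : 1 ≤ N) (hG : ∀ v, (G.adj v).length ≤ N) (v : Vertex m n)
    {T : List (Vertex m n)} (hT : T.length ≤ N) : (nonDegT G v T).cost ≤ 6 * N ^ 2 := by
  have h1 := (countT_cost_le (l := T) fun w _ => nonAdjT_cost_le hN hG v w).trans
    (length_mul_le hT)
  obtain ⟨h2, -, -⟩ := le_sq_of_one_le hN
  rw [nonDegT]
  linarith

theorem isBiplexT_cost_le (hN : 1 ≤ N) (hG : ∀ v, (G.adj v).length ≤ N) (k : ℕ)
    {T : List (Vertex m n)} (hT : T.length ≤ N) : (isBiplexT G k T).cost ≤ 9 * N ^ 3 := by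
  have h1 := (allT_cost_le (p := fun v => do
      let c ← nonDegT G v T
      op (decide (c ≤ k))) (l := T) (K := 6 * N ^ 2 + 1)
    fun v _ => Nat.add_le_add_right (nonDegT_cost_le hN hG v hT) 1).trans (length_mul_le hT)
  obtain ⟨h2, h3, -⟩ := le_sq_of_one_le hN
  rw [isBiplexT]
  linarith

theorem edgesT_cost_le (hN : 1 ≤ N) (hG : ∀ v, (G.adj v).length ≤ N)
    {T : List (Vertex m n)} (hT : T.length ≤ N) : (edgesT G T).cost ≤ 8 * N ^ 3 := by
  have h1 := (foldT_cost_le_const (f := fun e v =>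
      if v.isLeft then do
        let c ← degT G v T
        op (e + c)
      else op e) (l := T) (K := 5 * N ^ 2 + 1) (fun e v _ => by
    split_ifs
    · exact Nat.add_le_add_right (degT_cost_le hN hG v hT) 1
    · exact Nat.le_add_left _ _) 0).trans (length_mul_le hT)
  obtain ⟨h2, h3, -⟩ := le_sq_of_one_le hN
  rw [edgesT]
  linarith

theorem sideT_cost_le (hN : 1 ≤ N) (side : Bool) {T : List (Vertex m n)} (hT : T.length ≤ N) :
    (sideT side T).cost ≤ 3 * N := by
  have h1 := (countT_cost_le (p := fun v : Vertex m n => op (v.isLeft == side)) (l := T) (K := 1)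
    fun _ _ => le_rfl).trans (length_mul_le hT)
  rw [sideT]
  linarith

theorem tauT_cost_le (hN : 1 ≤ N) (hG : ∀ v, (G.adj v).length ≤ N) (k : ℕ) (side : Bool)
    {S T : List (Vertex m n)} (hS : S.length ≤ N) (hT : T.length ≤ N) :
    (tauT G k side S T).cost ≤ 8 * N ^ 3 := by
  have h1 := (foldT_cost_le_const (f := fun t v =>
      if v.isLeft = side then do
        let c ← degT G v T
        op (match t with
          | none => some (c + k)
          | some x => some (min x (c + k)))
      else op t) (l := S) (K := 5 * N ^ 2 + 1) (fun e v _ => by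
    split_ifs
    · exact Nat.add_le_add_right (degT_cost_le hN hG v hT) 1
    · exact Nat.le_add_left _ _) none).trans (length_mul_le hS)
  obtain ⟨h2, h3, -⟩ := le_sq_of_one_le hN
  refine le_trans h1 ?_
  linarith

theorem nonMaximalT_cost_le (hN : 1 ≤ N) (hG : ∀ v, (G.adj v).length ≤ N) (k : ℕ)
    {T D : List (Vertex m n)} (hT : T.length ≤ N) (hD : D.length ≤ N) :
    (nonMaximalT G k T D).cost ≤ 21 * N ^ 4 := by
  obtain ⟨h2, h3, h4⟩ := le_sq_of_one_le hN
  have h5 : ∀ v, (allT (fun w =>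
      if v.isLeft = w.isLeft then op true
      else do
        let cw ← nonDegT G w T
        let e ← adjT G v w
        op (decide (cw < k) || e)) T).cost ≤ 12 * N ^ 3 := by
    intro v
    refine ((allT_cost_le (K := 6 * N ^ 2 + (3 * N + 1)) fun w _ => ?_).trans
      (length_mul_le hT)).trans (by linarith)
    split_ifs
    · rw [cost_op]
      omega
    · simp only [cost_bind, cost_op]
      have := nonDegT_cost_le hN hG w hT
      have := adjT_cost_le hN hG v w
      omega
  rw [nonMaximalT]
  refine ((anyT_cost_le (K := 6 * N ^ 2 + (12 * N ^ 3 + 1)) fun v _ => ?_).trans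
    (length_mul_le hD)).trans (by linarith)
  simp only [cost_bind, cost_op]
  exact Nat.add_le_add (nonDegT_cost_le hN hG v hT) (Nat.add_le_add_right (h5 v) 1)

theorem pruneT_cost_le (hN : 1 ≤ N) (hG : ∀ v, (G.adj v).length ≤ N) (k : ℕ) (B : Bounds)
    (best : Sol m n) {S T D : List (Vertex m n)} (hS : S.length ≤ N) (hT : T.length ≤ N)
    (hD : D.length ≤ N) : (pruneT G k B best S T D).cost ≤ 65 * N ^ 4 := by
  obtain ⟨h2, h3, h4⟩ := le_sq_of_one_le hN
  have h5 := isBiplexT_cost_le hN hG k hS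
  have h6 := sideT_cost_le hN true hS
  have h7 := sideT_cost_le hN false hS
  have h8 := tauT_cost_le hN hG k false hS hT
  have h9 := tauT_cost_le hN hG k true hS hT
  have h10 := edgesT_cost_le hN hG hT
  have h11 := nonMaximalT_cost_le hN hG k hT hD
  simp only [pruneT, cost_bind, cost_op]
  linarith

theorem pivotT_cost_le (hN : 1 ≤ N) (hG : ∀ v, (G.adj v).length ≤ N) (k : ℕ)
    {T l : List (Vertex m n)} (hT : T.length ≤ N) (hl : l.length ≤ N) :
    (pivotT G k T l).cost ≤ 9 * N ^ 3 := by
  obtain ⟨h2, h3, -⟩ := le_sq_of_one_le hN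
  rw [pivotT]
  refine ((foldT_cost_le_const (K := 6 * N ^ 2 + 1) (fun p v _ => ?_) none).trans
    (length_mul_le hl)).trans (by linarith)
  exact Nat.add_le_add_right (nonDegT_cost_le hN hG v hT) 1

theorem refineT_cost_le (hN : 1 ≤ N) (hG : ∀ v, (G.adj v).length ≤ N) (k : ℕ)
    {S l : List (Vertex m n)} (hS : S.length + 1 ≤ N) (hl : l.length ≤ N) :
    (refineT G k S l).cost ≤ 11 * N ^ 4 := by
  obtain ⟨h2, h3, h4⟩ := le_sq_of_one_le hN
  rw [refineT]
  exact ((filterT_cost_le fun c _ => isBiplexT_cost_le hN hG k (T := c :: S) hS).trans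
    (length_mul_le hl)).trans (by linarith)

theorem orderT_cost_le (hN : 1 ≤ N) (hG : ∀ v, (G.adj v).length ≤ N) (k : ℕ)
    {S C T : List (Vertex m n)} (hS : S.length ≤ N) (hC : C.length ≤ N) (hT : T.length ≤ N) :
    (orderT G k S C T).cost ≤ 32 * N ^ 3 := by
  obtain ⟨h2, h3, -⟩ := le_sq_of_one_le hN
  have h5 := pivotT_cost_le hN hG k hT hS
  have h6 := pivotT_cost_le hN hG k hT hC
  have h7 := fun v => nonDegT_cost_le hN hG v hS
  have h8 : ∀ v, (filterT (fun w => nonAdjT G v w) C).cost ≤ 6 * N ^ 2 := fun v =>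
    ((filterT_cost_le fun w _ => nonAdjT_cost_le hN hG v w).trans (length_mul_le hC)).trans
      (by linarith)
  have h9 : ∀ v i, (takeT i (filterT (fun w => nonAdjT G v w) C).val).cost ≤ 2 * N := fun v i => by
    have h := takeT_cost_le i (filterT (fun w => nonAdjT G v w) C).val
    have h' : (filterT (fun w => nonAdjT G v w) C).val.length ≤ C.length := by
      rw [filterT_val]
      exact List.length_filter_le _ _
    omega
  rw [orderT, cost_bind]
  rcases (pivotT G k T S).val with _ | ⟨v, c⟩
  · simp only [cost_bind]
    rcases (pivotT G k T C).val with _ | ⟨v, c⟩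
    · have : (pure [] : Timed (List (Vertex m n))).cost = 0 := rfl
      simp only [this]
      linarith
    · simp only [cost_bind]
      have h10 : ∀ l : List (Vertex m n), (pure (v :: l) : Timed (List (Vertex m n))).cost = 0 :=
        fun _ => rfl
      simp only [h10]
      linarith [h7 v, h8 v, h9 v (k - (nonDegT G v S).val + 1)]
  · simp only [cost_bind]
    linarith [h7 v, h8 v, h9 v (k - (nonDegT G v S).val + 1)]

/-! ### The number of branches of FastBB -/

/-- Only branches whose partial set is a biplex have children; this is what bounds the number of
inclusions along a path. -/
theorem isBiplexT_of_pruneT {k : ℕ} {B : Bounds} {best : Sol m n} {S T D : List (Vertex m n)}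
    (h : ¬ (pruneT G k B best S T D).val = true) : (isBiplexT G k S).val = true := by
  by_contra hS
  simp [pruneT, hS] at h

/-- An upper bound of the cost of a branch with `c` candidates and `l` included vertices, if a node
costs `P` and at most `M` vertices are ever included: the tree of the binary decisions to include or
to exclude a candidate has at most `(11 / 10) ^ c * 10 ^ (M - l)` leaves. -/
noncomputable def branchBound (P M c l : ℕ) : ℝ :=
  (2 * P + 1) * 10 ^ M * (11 / 10) ^ c * (1 / 10) ^ l

theorem le_branchBound (P : ℕ) {M : ℕ} (c : ℕ) {l : ℕ} (hl : l ≤ M) :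
    2 * (P : ℝ) + 1 ≤ branchBound P M c l := by
  have h1 : (1 : ℝ) ≤ (11 / 10) ^ c := one_le_pow₀ (by norm_num)
  have h2 : (1 : ℝ) ≤ 10 ^ M * (1 / 10) ^ l := by
    rw [one_div, inv_pow, ← div_eq_mul_inv, le_div_iff₀ (by positivity), one_mul]
    exact pow_le_pow_right₀ (by norm_num) hl
  have h3 : branchBound P M c l = (2 * P + 1) * ((11 / 10) ^ c * (10 ^ M * (1 / 10) ^ l)) := by
    rw [branchBound]; ring
  rw [h3]
  exact le_mul_of_one_le_right (by positivity) (one_le_mul_of_one_le_of_one_le h1 h2)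

theorem branchBound_mono (P M l : ℕ) {c c' : ℕ} (h : c ≤ c') :
    branchBound P M c l ≤ branchBound P M c' l := by
  unfold branchBound
  gcongr
  norm_num

/-- Deciding one candidate leaves `l` unchanged or raises it by one, with relative weights `1` and
`1 / 10`. Their sum is the factor `11 / 10` paid per candidate. -/
theorem branchBound_succ (P M c l : ℕ) :
    branchBound P M c l + branchBound P M c (l + 1) = branchBound P M (c + 1) l := by
  unfold branchBound
  ring

/-- Every step of the loop is a binary decision: the recursive call excludes `v`, the rest of the
loop includes it. The subtracted terms are reserves for local work: `P` left over by the call and `2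
* P` by the rest of the loop leave `2 * P` after one filtering and two refinements, which cost at
most `P`. The end of the list costs one step, covered by the summand `1` in `2 * P + 1`. -/
theorem symBKT_cost_le (hN : 1 ≤ N) (hG : ∀ v, (G.adj v).length ≤ N) {k : ℕ}
    {U : List (Vertex m n)} {v₀ : Vertex m n} {P M : ℕ} (hP : 25 * N ^ 4 ≤ P)
    {recur : List (Vertex m n) → List (Vertex m n) →
      List (Vertex m n) → Sol m n → Timed (Sol m n)}
    (hrec : ∀ S C D b, (S ++ C).Nodup → S ++ C ⊆ U → v₀ ∈ S →
      S.length + C.length + D.length + 1 ≤ N → S.length ≤ M →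
      ((recur S C D b).cost : ℝ) ≤ branchBound P M C.length S.length - P) :
    ∀ (vs S C D : List (Vertex m n)) (b : Sol m n), vs.Nodup → vs ⊆ C → (S ++ C).Nodup →
      S ++ C ⊆ U → v₀ ∈ S → S.length + C.length + D.length + 1 ≤ N → S.length + vs.length ≤ M →
      ((symBKT G k recur vs S C D b).cost : ℝ) ≤
        branchBound P M C.length S.length - 2 * P := by
  intro vs
  induction vs with
  | nil =>
    intro S C D b _ _ _ _ _ _ hM
    have := le_branchBound P C.length (l := S.length) (M := M) (by simpa using hM)
    rw [symBKT, cost_op]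
    push_cast
    linarith
  | cons v vs ih =>
    intro S C D b hvs hsub hnd hU hv₀ hlen hM
    rw [List.length_cons] at hM
    have hv : v ∈ C := hsub List.mem_cons_self
    have hlt := length_filter_ne_lt hv
    have hC' : (filterT (fun x => op (decide (x ≠ v))) C).val =
        C.filter fun x => decide (x ≠ v) := filterT_val _ _
    have hc1 : (filterT (fun x => op (decide (x ≠ v))) C).cost ≤ 3 * N := by
      have h := filterT_cost_le (p := fun x => op (decide (x ≠ v))) (l := C) (K := 1)
        fun _ _ => le_rfl
      omega
    simp only [symBKT, cost_bind, hC']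
    set C' := C.filter fun x => decide (x ≠ v) with hC'def
    have hl1 : (refineT G k S C').val.length ≤ C'.length := (refineT_sublist G).length_le
    have hl2 : (refineT G k S (v :: D)).val.length ≤ D.length + 1 :=
      (refineT_sublist G).length_le
    have hc2 := refineT_cost_le hN hG k (S := S) (l := C') (by omega) (by omega)
    have hc3 := refineT_cost_le hN hG k (S := S) (l := v :: D) (by omega)
      (by rw [List.length_cons]; omega)
    have hsubl : (S ++ (refineT G k S C').val).Sublist (S ++ C) :=
      List.Sublist.append_left ((refineT_sublist G).trans List.filter_sublist) S
    -- The vertex `v` moves from the candidates to `D` here, and to `S` in the rest of the loop. So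
    -- the total length of the three lists never grows and `N` bounds all of them throughout.
    have hr := hrec S (refineT G k S C').val (refineT G k S (v :: D)).val b
      (hnd.sublist hsubl) (fun x hx => hU (hsubl.subset hx)) hv₀ (by omega) (by omega)
    have hs := ih (v :: S) C' D (recur S (refineT G k S C').val
      (refineT G k S (v :: D)).val b).val (List.nodup_cons.1 hvs).2 (subset_filter_ne hvs hsub)
      (nodup_append_filter_ne hnd hv) ?_ (List.mem_cons_of_mem _ hv₀)
      (by rw [List.length_cons]; omega) (by rw [List.length_cons]; omega)
    · have h1 := branchBound_mono P M S.length (hl1.trans (Nat.le_sub_one_of_lt hlt))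
      have h2 := branchBound_mono P M (S.length + 1) (Nat.le_sub_one_of_lt hlt)
      have h3 := branchBound_succ P M (C.length - 1) S.length
      rw [Nat.sub_add_cancel (by omega : 1 ≤ C.length)] at h3
      rw [List.length_cons] at hs
      obtain ⟨h4, h5, h6⟩ := le_sq_of_one_le hN
      have h7 : (((filterT (fun x => op (decide (x ≠ v))) C).cost + (refineT G k S C').cost +
          (refineT G k S (v :: D)).cost : ℕ) : ℝ) ≤ P := by
        exact_mod_cast (by linarith : (filterT (fun x => op (decide (x ≠ v))) C).cost +
          (refineT G k S C').cost + (refineT G k S (v :: D)).cost ≤ P)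
      push_cast at h7 ⊢
      linarith
    · intro x hx
      refine hU ?_
      rw [List.cons_append, List.mem_cons, List.mem_append] at hx
      rw [List.mem_append]
      rcases hx with rfl | hx | hx
      · exact Or.inr hv
      · exact Or.inl hx
      · exact Or.inr (List.mem_filter.1 hx).1

/-- A branching list has at most `k + 2` vertices, hence the requirement that every biplex `S` have
size at most `M - k - 2`. The distinguished vertex `v₀`, which all partial sets contain, is what
makes such an `M` available. `120 * N ^ 4` pays for all work at one node outside the branching loop.
-/
theorem fastBBRec_cost_le (hN : 1 ≤ N) (hG : ∀ v, (G.adj v).length ≤ N) {k : ℕ} {B : Bounds}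
    {U : List (Vertex m n)} {v₀ : Vertex m n} {M : ℕ}
    (hM : ∀ S : List (Vertex m n), S.Nodup → S ⊆ U → v₀ ∈ S → VBiplex G k S.toFinset →
      S.length + k + 2 ≤ M) :
    ∀ (fuel : ℕ) (S C D : List (Vertex m n)) (b : Sol m n), (S ++ C).Nodup → S ++ C ⊆ U →
      v₀ ∈ S → S.length + C.length + D.length + 1 ≤ N → S.length ≤ M →
      ((fastBBRec G k B fuel S C D b).cost : ℝ) ≤
        branchBound (120 * N ^ 4) M C.length S.length - (120 * N ^ 4 : ℕ) := by
  intro fuel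
  induction fuel with
  | zero =>
    intro S C D b _ _ _ _ hSM
    have := le_branchBound (120 * N ^ 4) C.length hSM
    have h0 : (0 : ℝ) ≤ ((120 * N ^ 4 : ℕ) : ℝ) := Nat.cast_nonneg _
    rw [fastBBRec, cost_op]
    push_cast at this h0 ⊢
    linarith
  | succ fuel ih =>
    intro S C D b hnd hU hv₀ hlen hSM
    obtain ⟨h4, h5, h6⟩ := le_sq_of_one_le hN
    have hTlen : (S ++ C).length ≤ N := by rw [List.length_append]; omega
    have hbase := le_branchBound (120 * N ^ 4) C.length hSM
    have happ := appendT_cost_le S C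
    have hbi := isBiplexT_cost_le hN hG k hTlen
    have hpr := pruneT_cost_le hN hG k B b (S := S) (D := D) (by omega) hTlen (by omega)
    have hord := orderT_cost_le hN hG k (S := S) (C := C) (by omega) (by omega) hTlen
    rw [fastBBRec_succ]
    simp only [cost_bind, appendT_val]
    have hsmall : ∀ x : ℕ, x ≤ 120 * N ^ 4 →
        (x : ℝ) ≤ branchBound (120 * N ^ 4) M C.length S.length - (120 * N ^ 4 : ℕ) := by
      intro x hx
      have : (x : ℝ) ≤ (120 * N ^ 4 : ℕ) := by exact_mod_cast hx
      linarith
    split_ifs with h1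
    · refine hsmall _ ?_
      have he := edgesT_cost_le hN hG hTlen
      have hs1 := sideT_cost_le hN true hTlen
      have hs2 := sideT_cost_le hN false hTlen
      simp only [cost_bind, cost_op]
      linarith
    · rw [cost_bind]
      split_ifs with h2
      · refine hsmall _ ?_
        rw [cost_op]
        linarith
      · rw [cost_bind]
        obtain ⟨hS, -, -⟩ := List.nodup_append.1 hnd
        have hSbi := (isBiplexT_val G hS).1 (isBiplexT_of_pruneT h2)
        have hSM' := hM S hS (fun x hx => hU (List.mem_append_left _ hx)) hv₀ hSbi
        obtain ⟨h7, h8, h9, -⟩ := orderT_val G (k := k) hnd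
        have hsym := symBKT_cost_le hN hG (k := k) (P := 120 * N ^ 4) (by linarith) ih _ S C D b
          h7 h8 hnd hU hv₀ hlen (by omega)
        have hloc : (((appendT S C).cost + (isBiplexT G k (S ++ C)).cost +
            (pruneT G k B b S (S ++ C) D).cost + (orderT G k S C (S ++ C)).cost : ℕ) : ℝ) ≤
            (120 * N ^ 4 : ℕ) := by
          exact_mod_cast (by linarith : (appendT S C).cost + (isBiplexT G k (S ++ C)).cost +
            (pruneT G k B b S (S ++ C) D).cost + (orderT G k S C (S ++ C)).cost ≤ 120 * N ^ 4)
        push_cast at hloc hsym ⊢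
        linarith

end FastBBCost

section FrameworkCost

variable {m n : ℕ} {G : BipGraph m n} {N : ℕ}

/-! ### The cost of the subgraph around a vertex -/

theorem length_adj_le_maxDeg (v : Vertex m n) : (G.adj v).length ≤ maxDeg G := by
  rcases v with v | u
  · rw [length_adj_inl]
    exact card_nbrR_le_maxDeg G v
  · rw [length_adj_inr]
    exact card_nbrL_le_maxDeg G u

theorem length_le_of_nodup_subset {α : Type} {l l' : List α} (h : l.Nodup) (hs : l ⊆ l') :
    l.length ≤ l'.length :=
  (List.subperm_of_subset h hs).length_le

/-- `W` is a reservoir that contains everything ever collected; without repetitions the accumulator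
is no longer than `W`, so each membership search costs `O(N)`. -/
theorem addNbrsT_cost_le (hN : 1 ≤ N) (hG : ∀ v, (G.adj v).length ≤ N) (mem : CoreMem m n)
    {W acc : List (Vertex m n)} (hW : W.length ≤ N) (hnd : acc.Nodup) (hacc : acc ⊆ W)
    {v : Vertex m n} (hv : G.adj v ⊆ W) : (addNbrsT G mem acc v).cost ≤ 7 * N ^ 2 ∧
      (addNbrsT G mem acc v).val.Nodup ∧ (addNbrsT G mem acc v).val ⊆ W := by
  refine ⟨?_, addNbrsT_val.2 hnd, fun x hx => ?_⟩
  · obtain ⟨h2, -, -⟩ := le_sq_of_one_le hN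
    rw [addNbrsT]
    refine ((foldT_cost_le (K := 3 * N + 2) (fun b : List (Vertex m n) => b.Nodup ∧ b ⊆ W)
      (fun b u hu hb => ?_) ⟨hnd, hacc⟩).1.trans (length_mul_le (hG v))).trans (by linarith)
    rw [cost_op_bind, val_op_bind]
    split_ifs with hr
    · exact ⟨by rw [cost_op]; omega, hb⟩
    · refine ⟨?_, ?_⟩
      · have := memT_cost_le hN u ((length_le_of_nodup_subset hb.1 hb.2).trans hW)
        simp only [insertT, cost_bind, cost_op]
        omega
      · rw [insertT_val]
        split_ifs with hmem
        · exact hb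
        · exact ⟨List.nodup_cons.2 ⟨hmem, hb.1⟩, List.cons_subset.2 ⟨hv hu, hb.2⟩⟩
  · rcases (addNbrsT_val.1 x).1 hx with h | h
    · exact hacc h
    · exact hv h.1

theorem foldT_addNbrsT_cost_le (hN : 1 ≤ N) (hG : ∀ v, (G.adj v).length ≤ N) (mem : CoreMem m n)
    {l : List (Vertex m n)} (hl : l.length ≤ N) (hW : (l.flatMap G.adj).length ≤ N) :
    (foldT (fun acc u => addNbrsT G mem acc u) [] l).cost ≤ 9 * N ^ 3 := by
  obtain ⟨h2, h3, -⟩ := le_sq_of_one_le hN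
  refine ((foldT_cost_le (K := 7 * N ^ 2)
    (fun b : List (Vertex m n) => b.Nodup ∧ b ⊆ l.flatMap G.adj) (fun b u hu hb => ?_)
    ⟨List.nodup_nil, List.nil_subset _⟩).1.trans (length_mul_le hl)).trans (by linarith)
  exact addNbrsT_cost_le hN hG mem hW hb.1 hb.2 fun x hx => List.mem_flatMap.2 ⟨u, hu, hx⟩

theorem length_flatMap_adj_le (l : List (Vertex m n)) :
    (l.flatMap G.adj).length ≤ l.length * maxDeg G := by
  rw [List.length_flatMap]
  induction l with
  | nil => simp
  | cons v l ih =>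
    simp only [List.map_cons, List.sum_cons, List.length_cons, Nat.succ_mul]
    have := length_adj_le_maxDeg (G := G) v
    omega

theorem foldT_addNbrsT_length_le (mem : CoreMem m n) (l : List (Vertex m n)) :
    (foldT (fun acc u => addNbrsT G mem acc u) [] l).val.length ≤ l.length * maxDeg G := by
  obtain ⟨h1, h2⟩ := foldl_addNbrsT (G := G) (mem := mem) (l := l)
  refine (length_le_of_nodup_subset h2 fun x hx => ?_).trans (length_flatMap_adj_le l)
  obtain ⟨v, hv, hx, -⟩ := (h1 x).1 hx
  exact List.mem_flatMap.2 ⟨v, hv, hx⟩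

theorem addNbrsT_nil_length_le (mem : CoreMem m n) (v : Vertex m n) :
    (addNbrsT G mem [] v).val.length ≤ maxDeg G := by
  refine (length_le_of_nodup_subset (addNbrsT_val.2 List.nodup_nil) fun x hx => ?_).trans
    (length_adj_le_maxDeg v)
  simpa using ((addNbrsT_val.1 x).1 hx).resolve_left (by simp) |>.1

theorem ieSetT_cost_le (hd : 1 ≤ maxDeg G) (hN : 8 * maxDeg G ^ 3 ≤ N) (k : ℕ) (B : Bounds)
    (mem : CoreMem m n) (j : Fin m) : (ieSetT G k B mem j (Sum.inl j)).cost ≤ 60 * N ^ 3 := by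
  obtain ⟨hd2, hd3, -⟩ := le_sq_of_one_le hd
  have hN1 : 1 ≤ N := by omega
  obtain ⟨h2, h3, -⟩ := le_sq_of_one_le hN1
  have hG : ∀ v, (G.adj v).length ≤ N := fun v => (length_adj_le_maxDeg v).trans (by omega)
  have hnear := addNbrsT_nil_length_le (G := G) mem (Sum.inl j)
  have hnearc := (addNbrsT_cost_le hN1 hG mem (hG (Sum.inl j)) List.nodup_nil
    (List.nil_subset _) (List.Subset.refl _)).1
  simp only [ieSetT, cost_bind, filterT_val, val_op, cost_op]
  set near := (addNbrsT G mem [] (Sum.inl j)).val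
  have hhop := foldT_addNbrsT_length_le (G := G) mem near
  have hmul : near.length * maxDeg G ≤ maxDeg G ^ 2 := by
    rw [pow_two]
    exact Nat.mul_le_mul_right _ hnear
  have hhopc := foldT_addNbrsT_cost_le hN1 hG mem (l := near) (by omega)
    ((length_flatMap_adj_le near).trans (by omega))
  set hop := (foldT (fun acc u => addNbrsT G mem acc u) [] near).val
  have hfc : ∀ p : Vertex m n → Bool, (filterT (fun w => op (p w)) hop).cost ≤ 3 * N := by
    intro p
    have h := filterT_cost_le (p := fun w => op (p w)) (l := hop) (K := 1) fun _ _ => le_rfl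
    omega
  set later := hop.filter fun w => (match w with
    | Sum.inl i => decide (j < i)
    | Sum.inr _ => false)
  have hlater : later.length ≤ hop.length := List.length_filter_le _ _
  have hLj : (Sum.inl j :: later : List (Vertex m n)).length ≤ 2 * maxDeg G ^ 2 := by
    rw [List.length_cons]
    omega
  have hLjN : (Sum.inl j :: later : List (Vertex m n)).length ≤ N := by omega
  have hmul2 : (Sum.inl j :: later : List (Vertex m n)).length * maxDeg G ≤
      2 * maxDeg G ^ 3 := by
    rw [pow_succ, ← mul_assoc]
    exact Nat.mul_le_mul_right _ hLj
  have hRj := foldT_addNbrsT_length_le (G := G) mem (Sum.inl j :: later)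
  have hRjc := foldT_addNbrsT_cost_le hN1 hG mem (l := Sum.inl j :: later) hLjN
    ((length_flatMap_adj_le _).trans (by omega))
  set Rj := (foldT (fun acc u => addNbrsT G mem acc u) [] (Sum.inl j :: later)).val
  have hRjN : Rj.length ≤ N := by omega
  have hCL : (filterT (fun w => do
      let c ← degT G w Rj
      let c' ← countT (fun u => do
        let b ← adjT G w u
        let b' ← adjT G (Sum.inl j) u
        op (b && b')) Rj
      op (decide (B.lbR - k ≤ c) && decide (B.lbR - 2 * k ≤ c'))) later).cost ≤ 17 * N ^ 3 := by
    refine ((filterT_cost_le (K := 5 * N ^ 2 + (9 * N ^ 2 + 1)) fun w _ => ?_).trans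
      (length_mul_le (by omega : later.length ≤ N))).trans (by linarith)
    simp only [cost_bind, cost_op]
    have h4 := degT_cost_le hN1 hG w hRjN
    have h5 : (countT (fun u => do
        let b ← adjT G w u
        let b' ← adjT G (Sum.inl j) u
        op (b && b')) Rj).cost ≤ 9 * N ^ 2 := by
      refine ((countT_cost_le (K := 3 * N + (3 * N + 1)) fun u _ => ?_).trans
        (length_mul_le hRjN)).trans (by linarith)
      simp only [cost_bind, cost_op]
      have := adjT_cost_le hN1 hG w u
      have := adjT_cost_le hN1 hG (Sum.inl j) u
      omega
    omega
  have hCR : (filterT (fun u => do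
      let c ← degT G u (Sum.inl j :: later : List (Vertex m n))
      op (decide (B.lbL - k ≤ c))) Rj).cost ≤ 8 * N ^ 3 := by
    refine ((filterT_cost_le (K := 5 * N ^ 2 + 1) fun u _ => ?_).trans
      (length_mul_le hRjN)).trans (by linarith)
    exact Nat.add_le_add_right (degT_cost_le hN1 hG u hLjN) 1
  have happ : ∀ (p : Vertex m n → Bool) (l : List (Vertex m n)),
      (appendT (later.filter p) l).cost ≤ 2 * N := by
    intro p l
    have h4 := appendT_cost_le (later.filter p) l
    have h5 := List.length_filter_le p later
    omega
  have hpure : ∀ x : List (Vertex m n) × List (Vertex m n), (pure x : Timed _).cost = 0 :=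
    fun _ => rfl
  rw [hpure]
  refine le_trans (Nat.add_le_add hnearc (Nat.add_le_add hhopc (Nat.add_le_add (hfc _)
    (Nat.add_le_add (hfc _) (Nat.add_le_add_left (Nat.add_le_add hRjc (Nat.add_le_add hCL
    (Nat.add_le_add hCR (Nat.add_le_add_right (happ _ _) 0)))) 1))))) ?_
  linarith

/-! ### The cost of a round -/

theorem IsSetup.length_le {k : ℕ} {B : Bounds} {mem : CoreMem m n} {j : Fin m}
    {hop later Rj C D : List (Vertex m n)} (h : IsSetup G k B mem j hop later Rj C D)
    (hd : 1 ≤ maxDeg G) : later.length ≤ maxDeg G ^ 2 ∧ C.length ≤ 3 * maxDeg G ^ 3 ∧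
      D.length ≤ maxDeg G ^ 2 := by
  obtain ⟨hd2, hd3, -⟩ := le_sq_of_one_le hd
  have h1 : hop.length ≤ maxDeg G ^ 2 := by
    refine (length_le_of_nodup_subset (l' := (G.adj (Sum.inl j)).flatMap G.adj) h.hop_nodup
      fun x hx => ?_).trans ((length_flatMap_adj_le _).trans ?_)
    · obtain ⟨u, hu, hx, -⟩ := (h.mem_hop x).1 hx
      exact List.mem_flatMap.2 ⟨u, hu.1, hx⟩
    · rw [pow_two]
      exact Nat.mul_le_mul_right _ (length_adj_le_maxDeg _)
  have h2 : later.length ≤ hop.length :=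
    length_le_of_nodup_subset h.later_nodup fun x hx => ((h.mem_later x).1 hx).1
  have h3 : D.length ≤ hop.length :=
    length_le_of_nodup_subset h.D_nodup fun x hx => ((h.mem_D x).1 hx).1
  have h4 : Rj.length ≤ (later.length + 1) * maxDeg G := by
    refine (length_le_of_nodup_subset (l' := (Sum.inl j :: later : List _).flatMap G.adj)
      h.Rj_nodup fun x hx => ?_).trans (length_flatMap_adj_le _)
    obtain ⟨v, hv, hx, -⟩ := (h.mem_Rj x).1 hx
    exact List.mem_flatMap.2 ⟨v, hv, hx⟩
  have h5 : C.length ≤ (later ++ Rj).length :=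
    length_le_of_nodup_subset h.C_nodup fun x hx => List.mem_append.2
      (((h.mem_C x).1 hx).imp (fun h => h.1) fun h => h.1)
  rw [List.length_append] at h5
  refine ⟨h2.trans h1, ?_, h3.trans h1⟩
  have h6 : (later.length + 1) * maxDeg G ≤ (maxDeg G ^ 2 + 1) * maxDeg G :=
    Nat.mul_le_mul_right _ (Nat.succ_le_succ (h2.trans h1))
  have h7 : (maxDeg G ^ 2 + 1) * maxDeg G = maxDeg G ^ 3 + maxDeg G := by ring
  omega

/-- If `k` is at least the maximum degree, then no candidates are left. -/
theorem IsSetup.eq_nil {k : ℕ} {B : Bounds} {mem : CoreMem m n} {j : Fin m}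
    {hop later Rj C D : List (Vertex m n)} (h : IsSetup G k B mem j hop later Rj C D)
    (hk : maxDeg G ≤ k) (hL : ((2 * k + 1 : ℕ) : ℚ) ≤ B.lbL)
    (hR : ((2 * k + 1 : ℕ) : ℚ) ≤ B.lbR) : C = [] := by
  have hdeg : ∀ (x : Vertex m n) (P : Finset (Vertex m n)), degIn G x P ≤ k := by
    intro x P
    refine le_trans ?_ ((length_adj_le_maxDeg (G := G) x).trans hk)
    rw [← List.toFinset_card_of_nodup (G.nodup x)]
    refine Finset.card_le_card fun y hy => ?_
    rw [List.mem_toFinset]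
    exact (Finset.mem_filter.1 hy).2
  have hdegq : ∀ (x : Vertex m n) (P : Finset (Vertex m n)), (degIn G x P : ℚ) ≤ k :=
    fun x P => by exact_mod_cast hdeg x P
  push_cast at hL hR
  rw [List.eq_nil_iff_forall_not_mem]
  intro x hx
  -- To survive, a vertex needs degree at least `lbR - k` or `lbL - k`, and both are at least `k + 1
  -- > d`.
  rcases (h.mem_C x).1 hx with ⟨-, h1, -⟩ | ⟨-, h1⟩
  · linarith [hdegq x Rj.toFinset]
  · linarith [hdegq x (Sum.inl j :: later : List (Vertex m n)).toFinset]

/-- Left vertices come from the two-hop neighbourhood of `v_j`. Right vertices are neighbours of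
`v_j`, at most `d`, or non-neighbours, at most `k`. That this is quadratic in `d` for `k < d`,
against cubically many candidates, is the core of the running time bound. -/
theorem IsSetup.length_biplex_le {k : ℕ} {B : Bounds} {mem : CoreMem m n} {j : Fin m}
    {hop later Rj C D : List (Vertex m n)} (h : IsSetup G k B mem j hop later Rj C D)
    (hd : 1 ≤ maxDeg G) {S : List (Vertex m n)} (hS : S.Nodup) (hSC : S ⊆ [Sum.inl j] ++ C)
    (hj : (Sum.inl j : Vertex m n) ∈ S) (hb : VBiplex G k S.toFinset) :
    S.length ≤ maxDeg G ^ 2 + 1 + (maxDeg G + k) := by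
  have h1 : S.length = sideCard true S.toFinset + sideCard false S.toFinset := by
    rw [toFinset_eq_disjSum, sideCard_true_disjSum, sideCard_false_disjSum, ← Finset.card_disjSum,
      ← toFinset_eq_disjSum, List.toFinset_card_of_nodup hS]
  have h2 : sideCard true S.toFinset ≤ maxDeg G ^ 2 + 1 := by
    have h3 : S.toFinset.filter (·.isLeft = true) ⊆
        (Sum.inl j :: later : List (Vertex m n)).toFinset := by
      intro x hx
      rw [Finset.mem_filter, List.mem_toFinset] at hx
      rw [List.mem_toFinset, List.mem_cons]
      rcases List.mem_append.1 (hSC hx.1) with h4 | h4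
      · exact Or.inl (List.mem_singleton.1 h4)
      · rcases (h.mem_C x).1 h4 with h5 | h5
        · exact Or.inr h5.1
        · have := isLeft_of_mem_Rj h h5.1
          rw [hx.2] at this
          exact absurd this (by decide)
    refine (Finset.card_le_card h3).trans ((List.toFinset_card_le _).trans ?_)
    rw [List.length_cons]
    exact Nat.succ_le_succ (h.length_le hd).1
  have h3 : sideCard false S.toFinset ≤ maxDeg G + k := by
    have h4 := degIn_add_nonDeg (G := G) (Sum.inl j) S.toFinset
    rw [Sum.isLeft_inl, Bool.not_true] at h4
    rw [← h4]
    refine Nat.add_le_add ?_ (hb _ (by simpa using hj))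
    refine le_trans ?_ (length_adj_le_maxDeg (G := G) (Sum.inl j))
    rw [← List.toFinset_card_of_nodup (G.nodup _)]
    refine Finset.card_le_card fun y hy => ?_
    rw [List.mem_toFinset]
    exact (Finset.mem_filter.1 hy).2
  omega

/-- The bound of the cost of an inclusion-exclusion step. -/
noncomputable def stepBound (d : ℕ) : ℝ :=
  2 + 60 * (8 * d ^ 3) ^ 3 +
    (2 * (120 * (8 * d ^ 3) ^ 4) + 1) * 10 ^ (8 * d ^ 2) * (11 / 10) ^ (3 * d ^ 3)

theorem ieStepT_cost_le {k : ℕ} {B : Bounds} (hd : 1 ≤ maxDeg G)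
    (hL : ((2 * k + 1 : ℕ) : ℚ) ≤ B.lbL) (hR : ((2 * k + 1 : ℕ) : ℚ) ≤ B.lbR)
    (mem : CoreMem m n) (best : Sol m n) (j : Fin m) :
    ((ieStepT G k B mem best j).cost : ℝ) ≤ stepBound (maxDeg G) := by
  set d := maxDeg G with hddef
  obtain ⟨hd2, hd3, -⟩ := le_sq_of_one_le hd
  have hN1 : 1 ≤ 8 * d ^ 3 := by omega
  have hG : ∀ v, (G.adj v).length ≤ 8 * d ^ 3 := fun v =>
    (length_adj_le_maxDeg v).trans (by omega)
  have hset := ieSetT_cost_le hd le_rfl k B mem j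
  obtain ⟨hop, later, Rj, hs⟩ := ieSetT_isSetup (G := G) k B mem j
  rw [ieStepT_eq, cost_op_bind, cost_op_bind]
  have hone : (1 : ℝ) ≤ (11 / 10) ^ (3 * d ^ 3) := one_le_pow₀ (by norm_num)
  have hten : (1 : ℝ) ≤ 10 ^ (8 * d ^ 2) := one_le_pow₀ (by norm_num)
  have hP0 : (0 : ℝ) ≤ 2 * (120 * (8 * d ^ 3) ^ 4) + 1 := by positivity
  have hmain : (2 * (120 * (8 * d ^ 3) ^ 4) + 1 : ℝ) ≤
      (2 * (120 * (8 * d ^ 3) ^ 4) + 1) * 10 ^ (8 * d ^ 2) * (11 / 10) ^ (3 * d ^ 3) := by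
    rw [mul_assoc]
    exact le_mul_of_one_le_right hP0 (one_le_mul_of_one_le_of_one_le hten hone)
  split_ifs with hr
  · rw [cost_op, stepBound]
    have : (0 : ℝ) ≤ 120 * (8 * d ^ 3) ^ 4 := by positivity
    have : (0 : ℝ) ≤ 60 * (8 * d ^ 3) ^ 3 := by positivity
    push_cast
    linarith
  rw [cost_bind]
  have hsetR : ((ieSetT G k B mem j (Sum.inl j)).cost : ℝ) ≤ 60 * (8 * d ^ 3) ^ 3 := by
    exact_mod_cast hset
  set C := (ieSetT G k B mem j (Sum.inl j)).val.1
  set D := (ieSetT G k B mem j (Sum.inl j)).val.2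
  obtain ⟨hl1, hl2, hl3⟩ := hs.length_le hd
  rw [← hddef] at hl1 hl2 hl3
  have hrec : ((fastBBRec G k B (C.length + 1) [Sum.inl j] C D best).cost : ℝ) ≤
      (2 * (120 * (8 * d ^ 3) ^ 4) + 1) * 10 ^ (8 * d ^ 2) * (11 / 10) ^ (3 * d ^ 3) := by
    -- For `k ≥ d` the candidate list is empty and the single vertex `v_j` is a biplex, so the
    -- recursion ends at its root. This case is separate because the size of biplexes is not bounded
    -- by `d` alone.
    rcases le_or_gt d k with hk | hk
    · have hC : C = [] := hs.eq_nil hk hL hR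
      rw [hC, fastBBRec_succ]
      have hb : (isBiplexT G k [Sum.inl j]).val = true := by
        rw [isBiplexT_val G (List.nodup_singleton _)]
        intro v hv
        rw [List.mem_toFinset, List.mem_singleton] at hv
        subst hv
        refine le_trans (le_of_eq ?_) (Nat.zero_le k)
        rw [nonDeg, Finset.card_eq_zero, Finset.filter_eq_empty_iff]
        intro x hx
        rw [List.mem_toFinset, List.mem_singleton] at hx
        subst hx
        simp [NonAdj]
      have h1 : ([Sum.inl j] : List (Vertex m n)).length ≤ 8 * d ^ 3 := by simpa using hN1
      have h2 := appendT_cost_le ([Sum.inl j] : List (Vertex m n)) []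
      have h3 := isBiplexT_cost_le hN1 hG k h1
      have h4 := edgesT_cost_le hN1 hG h1
      have h5 := sideT_cost_le hN1 true h1
      have h6 := sideT_cost_le hN1 false h1
      obtain ⟨h7, h8, h9⟩ := le_sq_of_one_le hN1
      simp only [List.length_singleton] at h2
      refine le_trans ?_ hmain
      simp only [cost_bind, appendT_val, List.append_nil, hb, if_true, cost_op]
      exact_mod_cast (by linarith : (appendT [Sum.inl j] ([] : List (Vertex m n))).cost +
        ((isBiplexT G k [Sum.inl j]).cost + ((edgesT G [Sum.inl j]).cost +
          ((sideT true ([Sum.inl j] : List (Vertex m n))).cost +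
            ((sideT false ([Sum.inl j] : List (Vertex m n))).cost + 1)))) ≤
              2 * (120 * (8 * d ^ 3) ^ 4) + 1)
    -- With `k ≤ d - 1`, a biplex and the `k + 2` reserved vertices number at most `d ^ 2 + 3 * d +
    -- 1 ≤ 8 * d ^ 2`. The lengths `1`, `3 * d ^ 3` and `d ^ 2` together stay below `8 * d ^ 3`.
    · have h1 := fastBBRec_cost_le hN1 hG (k := k) (B := B) (U := [Sum.inl j] ++ C)
        (v₀ := Sum.inl j) (M := 8 * d ^ 2) (fun S hS hSU hj hb => by
          have := hs.length_biplex_le hd hS hSU hj hb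
          rw [← hddef] at this
          omega) (C.length + 1) [Sum.inl j] C D best hs.nodup (List.Subset.refl _) (by simp)
        (by rw [List.length_singleton]; omega) (by rw [List.length_singleton]; omega)
      have h2 := branchBound_mono (120 * (8 * d ^ 3) ^ 4) (8 * d ^ 2) 1 hl2
      have h3 : branchBound (120 * (8 * d ^ 3) ^ 4) (8 * d ^ 2) (3 * d ^ 3) 1 ≤
          (2 * (120 * (8 * d ^ 3) ^ 4) + 1) * 10 ^ (8 * d ^ 2) * (11 / 10) ^ (3 * d ^ 3) := by
        rw [branchBound]
        push_cast
        exact mul_le_of_le_one_right (by positivity) (by norm_num)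
      have h4 : (0 : ℝ) ≤ ((120 * (8 * d ^ 3) ^ 4 : ℕ) : ℝ) := Nat.cast_nonneg _
      rw [List.length_singleton] at h1
      linarith
  rw [stepBound]
  push_cast
  linarith

/-! ### The cost of the core computation -/

theorem lowT_cost_le (α β : ℚ) (mem : CoreMem m n) (v : Vertex m n) :
    (lowT G α β mem v).cost ≤ 2 * maxDeg G + 2 := by
  have h1 := lengthT_cost_le (G.adj v)
  have h2 := length_adj_le_maxDeg (G := G) v
  simp only [lowT, cost_bind, cost_op]
  omega

/-- The sum of the degrees of the remaining vertices. -/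
def restDeg (G : BipGraph m n) (removed : Vertex m n → Bool) : ℕ :=
  ∑ v ∈ Finset.univ.filter (fun v => removed v = false), (G.adj v).length

theorem restDeg_update {removed : Vertex m n → Bool} {v : Vertex m n} (hv : removed v = false) :
    restDeg G (Function.update removed v true) + (G.adj v).length = restDeg G removed := by
  have h1 : Finset.univ.filter (fun w => Function.update removed v true w = false) =
      (Finset.univ.filter fun w => removed w = false).erase v := by
    ext w
    by_cases hw : w = v
    · subst hw
      simp
    · simp [hw]
  rw [restDeg, h1, Finset.sum_erase_add]
  · rfl
  · simpa using hv

/-- Every edge is counted twice, and the edges are counted from the left; so the size of `R` does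
not enter. -/
theorem restDeg_le (removed : Vertex m n → Bool) : restDeg G removed ≤ 2 * (m * maxDeg G) := by
  have h1 : restDeg G removed ≤ ∑ v : Vertex m n, (G.adj v).length :=
    Finset.sum_le_sum_of_subset (Finset.filter_subset _ _)
  have h2 : ∑ v : Fin m, (nbrR G v Finset.univ).card ≤ m * maxDeg G := by
    have := Finset.sum_le_card_nsmul Finset.univ (fun v : Fin m => (nbrR G v Finset.univ).card)
      (maxDeg G) fun v _ => card_nbrR_le_maxDeg G v
    simpa using this
  have h3 : ∑ u : Fin n, (nbrL G u Finset.univ).card = ∑ v : Fin m, (nbrR G v Finset.univ).card := by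
    simp only [nbrL, nbrR, Finset.card_filter]
    exact Finset.sum_comm
  rw [Fintype.sum_sum_type] at h1
  simp only [length_adj_inl, length_adj_inr] at h1
  omega

theorem foldl_length_le {α β : Type} {f : List α → β → List α} {K : ℕ} {l : List β}
    (h : ∀ b, ∀ a ∈ l, (f b a).length ≤ b.length + K) (b : List α) :
    (l.foldl f b).length ≤ b.length + l.length * K := by
  induction l generalizing b with
  | nil => simp
  | cons a l ih =>
    have h1 := h b a List.mem_cons_self
    have h2 := ih (fun b a ha => h b a (List.mem_cons_of_mem _ ha)) (f b a)
    rw [List.foldl_cons, List.length_cons, Nat.succ_mul]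
    omega

/-- Amortisation, independent of the fuel: a stack entry carries `4` units, and removing `v`
releases `2 * d + 9` units per neighbour, namely `2 * d + 5` for its update and `4` for a possible
new stack entry. -/
theorem peelT_cost_le (α β : ℚ) : ∀ (fuel : ℕ) (stack : List (Vertex m n)) (mem : CoreMem m n),
    (peelT G α β fuel stack mem).cost ≤
      4 * stack.length + restDeg G mem.removed * (2 * maxDeg G + 9) + 1 := by
  intro fuel
  induction fuel with
  | zero =>
    intro stack mem
    rw [peelT, cost_op]
    omega
  | succ fuel ih =>
    intro stack mem
    cases stack with
    | nil =>
      rw [peelT, cost_op]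
      omega
    | cons v stack =>
      rw [peelT, cost_op_bind]
      split_ifs with hr
      · have := ih stack mem
        rw [List.length_cons]
        omega
      · rw [cost_op_bind, cost_bind]
        set mem' : CoreMem m n := ⟨Function.update mem.removed v true, mem.lost⟩ with hmem'
        have hc := foldT_cost_le_const (f := fun (q : List (Vertex m n) × CoreMem m n) w => do
            let mem'' ← op (⟨q.2.removed, Function.update q.2.lost w (q.2.lost w + 1)⟩ :
              CoreMem m n)
            let b ← lowT G α β mem'' w
            op (if b then (w :: q.1, mem'') else (q.1, mem''))) (l := G.adj v)
          (K := 2 * maxDeg G + 4) (fun q w _ => by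
            rw [cost_op_bind, cost_bind, cost_op]
            have := lowT_cost_le (G := G) α β
              ⟨q.2.removed, Function.update q.2.lost w (q.2.lost w + 1)⟩ w
            omega) (stack, mem')
        have key : ∀ (l : List (Vertex m n)) (q : List (Vertex m n) × CoreMem m n),
            (foldT (fun (q : List (Vertex m n) × CoreMem m n) w => do
              let mem'' ← op (⟨q.2.removed, Function.update q.2.lost w (q.2.lost w + 1)⟩ :
                CoreMem m n)
              let b ← lowT G α β mem'' w
              op (if b then (w :: q.1, mem'') else (q.1, mem''))) q l).val.1.length ≤
                q.1.length + l.length ∧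
            (foldT (fun (q : List (Vertex m n) × CoreMem m n) w => do
              let mem'' ← op (⟨q.2.removed, Function.update q.2.lost w (q.2.lost w + 1)⟩ :
                CoreMem m n)
              let b ← lowT G α β mem'' w
              op (if b then (w :: q.1, mem'') else (q.1, mem''))) q l).val.2.removed =
                q.2.removed := by
          intro l
          induction l with
          | nil => exact fun q => ⟨le_rfl, rfl⟩
          | cons w l ihl =>
            intro q
            rw [foldT, val_bind, val_op_bind, val_op_bind, val_bind, val_op]
            split_ifs
            · have := ihl (w :: q.1, ⟨q.2.removed, Function.update q.2.lost w (q.2.lost w + 1)⟩)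
              refine ⟨this.1.trans ?_, this.2⟩
              simp only [List.length_cons]
              omega
            · have := ihl (q.1, ⟨q.2.removed, Function.update q.2.lost w (q.2.lost w + 1)⟩)
              refine ⟨this.1.trans ?_, this.2⟩
              simp only [List.length_cons]
              omega
        obtain ⟨h1, h2⟩ := key (G.adj v) (stack, mem')
        generalize foldT (fun (q : List (Vertex m n) × CoreMem m n) w => do
            let mem'' ← op (⟨q.2.removed, Function.update q.2.lost w (q.2.lost w + 1)⟩ :
              CoreMem m n)
            let b ← lowT G α β mem'' w
            op (if b then (w :: q.1, mem'') else (q.1, mem''))) (stack, mem') (G.adj v) = q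
          at hc h1 h2 ⊢
        have h3 := ih q.val.1 q.val.2
        have h4 := restDeg_update (G := G) (removed := mem.removed) (v := v) (by simpa using hr)
        rw [h2] at h3
        rw [List.length_cons, ← h4]
        simp only [hmem'] at h3 h1
        nlinarith

theorem coreT_cost_le (hm : 1 ≤ m) (hd : 1 ≤ maxDeg G) (α β : ℚ) :
    (coreT G α β).cost ≤ 60 * (m * maxDeg G ^ 2) := by
  obtain ⟨hd2, -, -⟩ := le_sq_of_one_le hd
  rw [coreT, cost_op_bind, cost_bind]
  have hll : (leftList m n).length = m := by simp [leftList]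
  have hc := foldT_cost_le_const (f := fun stack v => do
      let b ← lowT G α β ⟨fun _ => false, fun _ => 0⟩ v
      let stack' ← op (if b then v :: stack else stack)
      foldT (fun stack u => do
        let b ← lowT G α β ⟨fun _ => false, fun _ => 0⟩ u
        op (if b then u :: stack else stack)) stack' (G.adj v)) (l := leftList m n)
    (K := (2 * maxDeg G + 2) + (1 + (maxDeg G * (2 * maxDeg G + 2 + 1 + 1) + 1)))
    (fun st v _ => by
      rw [cost_bind, cost_op_bind]
      refine Nat.add_le_add (lowT_cost_le _ _ _ _) (Nat.add_le_add_left ?_ 1)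
      refine (foldT_cost_le_const (K := 2 * maxDeg G + 2 + 1) (fun st u _ => ?_) _).trans
        (length_mul_le (length_adj_le_maxDeg v))
      rw [cost_bind, cost_op]
      exact Nat.add_le_add_right (lowT_cost_le _ _ _ _) 1) []
  have hlen : (foldT (fun stack v => do
      let b ← lowT G α β ⟨fun _ => false, fun _ => 0⟩ v
      let stack' ← op (if b then v :: stack else stack)
      foldT (fun stack u => do
        let b ← lowT G α β ⟨fun _ => false, fun _ => 0⟩ u
        op (if b then u :: stack else stack)) stack' (G.adj v)) [] (leftList m n)).val.length ≤
      m * (maxDeg G + 1) := by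
    rw [foldT_val]
    refine (foldl_length_le (K := maxDeg G + 1) (fun st v _ => ?_) []).trans
      (by rw [hll, List.length_nil, zero_add])
    rw [val_bind, val_op_bind, foldT_val]
    refine (foldl_length_le (K := 1) (fun st u _ => ?_) _).trans ?_
    · rw [val_bind, val_op]
      split_ifs <;> simp
    · have := length_adj_le_maxDeg (G := G) v
      split_ifs
      · rw [List.length_cons]
        omega
      · omega
  have hpeel := peelT_cost_le (G := G) α β (m + 3 * m * n + 1) (foldT (fun stack v => do
      let b ← lowT G α β ⟨fun _ => false, fun _ => 0⟩ v
      let stack' ← op (if b then v :: stack else stack)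
      foldT (fun stack u => do
        let b ← lowT G α β ⟨fun _ => false, fun _ => 0⟩ u
        op (if b then u :: stack else stack)) stack' (G.adj v)) [] (leftList m n)).val
    ⟨fun _ => false, fun _ => 0⟩
  have hrest := Nat.mul_le_mul_right (2 * maxDeg G + 9)
    (restDeg_le (G := G) (m := m) (n := n) fun _ => false)
  rw [hll] at hc
  have h1 : m * maxDeg G ≤ m * maxDeg G ^ 2 := Nat.mul_le_mul_left _ hd2
  have h2 : m ≤ m * maxDeg G := Nat.le_mul_of_pos_right _ hd
  refine (Nat.add_le_add_left (Nat.add_le_add hc hpeel) 1).trans ?_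
  nlinarith

end FrameworkCost

section RunningTime

variable {m n : ℕ} {G : BipGraph m n}

/-! ### The running time -/

theorem scanLT_cost_le (hd : 1 ≤ maxDeg G) :
    (scanLT G).cost ≤ 5 * (m * maxDeg G ^ 2) + 1 := by
  obtain ⟨hd2, -, -⟩ := le_sq_of_one_le hd
  rw [scanLT]
  refine (foldT_cost_le_const (K := 2 * maxDeg G + 2) (fun x v _ => ?_) 0).trans ?_
  · have h1 := lengthT_cost_le (G.adj v)
    have h2 := length_adj_le_maxDeg (G := G) v
    rw [cost_bind, cost_op]
    omega
  · have h1 : 2 * maxDeg G + 2 + 1 ≤ 5 * maxDeg G ^ 2 := by omega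
    have h2 := Nat.mul_le_mul_left m h1
    simp only [leftList, List.length_map, List.length_finRange]
    linarith

theorem scanRT_cost_le (hd : 1 ≤ maxDeg G) :
    (scanRT G).cost ≤ 7 * (m * maxDeg G ^ 2) + 1 := by
  obtain ⟨hd2, -, -⟩ := le_sq_of_one_le hd
  rw [scanRT]
  refine (foldT_cost_le_const (K := maxDeg G * (2 * maxDeg G + 2 + 1) + 1)
    (fun x v _ => ?_) 0).trans ?_
  · refine (foldT_cost_le_const (K := 2 * maxDeg G + 2) (fun x u _ => ?_) x).trans
      (length_mul_le (length_adj_le_maxDeg v))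
    have h1 := lengthT_cost_le (G.adj u)
    have h2 := length_adj_le_maxDeg (G := G) u
    rw [cost_bind, cost_op]
    omega
  · have h1 : maxDeg G * (2 * maxDeg G + 2 + 1) + 1 + 1 ≤ 7 * maxDeg G ^ 2 := by nlinarith
    have h2 := Nat.mul_le_mul_left m h1
    simp only [leftList, List.length_map, List.length_finRange]
    linarith

/-- The fuel is far larger than the number of rounds. The latter is bounded by `r`, because the
lower bound is halved until it meets `θ_L`. -/
theorem pbLoopT_cost_le {k θL θR dL E : ℕ} (hm : 1 ≤ m) (hd : 1 ≤ maxDeg G)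
    (hL : 2 * k + 1 ≤ θL) (hR : 2 * k + 1 ≤ θR)
    (hE : ∀ B : Bounds, ((2 * k + 1 : ℕ) : ℚ) ≤ B.lbL → ((2 * k + 1 : ℕ) : ℚ) ≤ B.lbR →
      ∀ (mem : CoreMem m n) (best : Sol m n) (j : Fin m), (ieStepT G k B mem best j).cost ≤ E) :
    ∀ (fuel : ℕ) (lbL : ℚ) (best : Sol m n) (r : ℕ), 1 ≤ r → lbL ≤ 2 ^ r * (θL : ℚ) →
      (pbLoopT G k θL θR dL fuel lbL best).cost ≤
        r * (m * (60 * maxDeg G ^ 2 + E + 5)) + 1 := by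
  intro fuel
  induction fuel with
  | zero =>
    intro lbL best r _ _
    rw [pbLoopT, cost_op]
    omega
  | succ fuel ih =>
    intro lbL best r hr hlb
    rw [pbLoopT, cost_op_bind, cost_bind, cost_bind, cost_op_bind]
    set B : Bounds := ⟨max (lbL / 2) θL, lbL, max ((best.edges : ℚ) / lbL) θR, (dL : ℚ) + k⟩
      with hB
    have hcore := coreT_cost_le (G := G) hm hd (B.lbR - k) (B.lbL - k)
    have hfold := foldT_cost_le_const
      (f := fun b j => ieStepT G k B (coreT G (B.lbR - k) (B.lbL - k)).val b j)
      (l := List.finRange m) (fun b j _ => hE B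
        (le_trans (by exact_mod_cast hL) (le_max_right _ _))
        (le_trans (by exact_mod_cast hR) (le_max_right _ _)) _ b j) best
    rw [List.length_finRange] at hfold
    set Q := m * (60 * maxDeg G ^ 2 + E + 5) with hQ
    have hQ' : 60 * (m * maxDeg G ^ 2) + (m * (E + 1) + 1) + 3 ≤ Q := by
      rw [hQ]
      nlinarith
    obtain ⟨r, rfl⟩ : ∃ r', r = r' + 1 := ⟨r - 1, by omega⟩
    have hhalf : B.lbL ≤ 2 ^ r * (θL : ℚ) := by
      refine max_le ?_ ?_
      · rw [div_le_iff₀ two_pos]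
        calc lbL ≤ 2 ^ (r + 1) * (θL : ℚ) := hlb
          _ = 2 ^ r * (θL : ℚ) * 2 := by ring
      · exact le_mul_of_one_le_left (Nat.cast_nonneg _) (one_le_pow₀ (by norm_num))
    rw [Nat.succ_mul]
    split_ifs with hfin
    · rw [cost_op]
      omega
    · have hr1 : 1 ≤ r := by
        rcases Nat.eq_zero_or_pos r with rfl | h
        · rw [pow_zero, one_mul] at hhalf
          exact absurd (decide_eq_true hhalf) hfin
        · exact h
      have := ih B.lbL (foldT (fun b j => ieStepT G k B (coreT G (B.lbR - k)
        (B.lbL - k)).val b j) best (List.finRange m)).val r hr1 hhalf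
      omega

/-- For `x ≥ 2` the additive `1` is at most `Nat.log 2 x`, and changing to the natural logarithm
costs another factor `2` since `Real.log 2 ≥ 1 / 2`. -/
theorem natCast_log_succ_le {x : ℕ} (hx : 2 ≤ x) :
    ((Nat.log 2 x + 1 : ℕ) : ℝ) ≤ 4 * Real.log x := by
  have h1 : 1 ≤ Nat.log 2 x := Nat.log_pos (by norm_num) hx
  have h2 : ((2 ^ Nat.log 2 x : ℕ) : ℝ) ≤ x := by
    exact_mod_cast Nat.pow_log_le_self 2 (by omega)
  have h3 : (Nat.log 2 x : ℝ) * Real.log 2 ≤ Real.log x := by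
    rw [← Real.log_pow]
    push_cast at h2
    exact Real.log_le_log (by positivity) h2
  have h4 : (1 : ℝ) / 2 ≤ Real.log 2 := by linarith [Real.log_two_gt_d9]
  have h5 : (1 : ℝ) ≤ (Nat.log 2 x : ℝ) := by exact_mod_cast h1
  push_cast
  nlinarith

theorem pos_of_maxDeg_pos (hd : 1 ≤ maxDeg G) : 1 ≤ m ∧ 1 ≤ maxDegR G := by
  obtain ⟨v, u, hvu⟩ : ∃ v u, Edge G v u := by
    by_contra! hno
    have h1 : maxDegL G = 0 := by
      refine Nat.le_zero.1 (Finset.sup_le fun v _ => ?_)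
      rw [nbrR, Finset.filter_false_of_mem fun u _ => hno v u, Finset.card_empty]
    have h2 : maxDegR G = 0 := by
      refine Nat.le_zero.1 (Finset.sup_le fun u _ => ?_)
      rw [nbrL, Finset.filter_false_of_mem fun v _ => hno v u, Finset.card_empty]
    rw [maxDeg, h1, h2] at hd
    omega
  refine ⟨v.pos, le_trans (Finset.card_pos.2 ⟨v, ?_⟩) (Finset.le_sup
    (f := fun u : Fin n => (nbrL G u Finset.univ).card) (Finset.mem_univ u))⟩
  exact Finset.mem_filter.2 ⟨Finset.mem_univ v, hvu⟩

theorem pbieT_cost_le {k θL θR : ℕ} (hk : 1 ≤ k) (hL : 2 * k + 1 ≤ θL) (hR : 2 * k + 1 ≤ θR)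
    (hd : 1 ≤ maxDeg G) : ((pbieT G k θL θR).cost : ℝ) ≤
      4 * Real.log ((maxDegR G : ℝ) + k) * (m * (80 * (maxDeg G : ℝ) ^ 2 +
        stepBound (maxDeg G))) := by
  obtain ⟨hm, hdR⟩ := pos_of_maxDeg_pos hd
  obtain ⟨hd2, -, -⟩ := le_sq_of_one_le hd
  have hE0 : 0 ≤ stepBound (maxDeg G) := by
    rw [stepBound]
    positivity
  -- Costs are natural numbers, so the real bound may be rounded down and the loop handled in `ℕ`.
  set E := ⌊stepBound (maxDeg G)⌋₊ with hEdef
  have hElt : (E : ℝ) ≤ stepBound (maxDeg G) := Nat.floor_le hE0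
  have hE : ∀ B : Bounds, ((2 * k + 1 : ℕ) : ℚ) ≤ B.lbL → ((2 * k + 1 : ℕ) : ℚ) ≤ B.lbR →
      ∀ (mem : CoreMem m n) (best : Sol m n) (j : Fin m),
        (ieStepT G k B mem best j).cost ≤ E :=
    fun B h1 h2 mem best j => Nat.le_floor (ieStepT_cost_le hd h1 h2 mem best j)
  set x := maxDegR G + k with hx
  set r := Nat.log 2 x + 1 with hr
  have hlb : (((scanRT G).val : ℚ) + k) ≤ 2 ^ r * (θL : ℚ) := by
    have h1 : (scanRT G).val + k ≤ 2 ^ r * θL := by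
      refine le_trans (Nat.add_le_add_right scanRT_le k) ?_
      exact (Nat.lt_pow_succ_log_self (by norm_num) x).le.trans
        (Nat.le_mul_of_pos_right _ (by omega))
    exact_mod_cast h1
  have hloop := pbLoopT_cost_le (G := G) (dL := (scanLT G).val) hm hd hL hR hE
    ((scanRT G).val + k + 1) _ ⟨[], 0⟩ r (by omega) hlb
  have h1 := scanLT_cost_le (G := G) hd
  have h2 := scanRT_cost_le (G := G) hd
  have hcost : (pbieT G k θL θR).cost ≤ r * (m * (80 * maxDeg G ^ 2 + E)) := by
    rw [pbieT_eq, cost_bind, cost_bind]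
    have h3 : m * (12 * maxDeg G ^ 2 + 3) ≤ r * (m * (12 * maxDeg G ^ 2 + 3)) :=
      Nat.le_mul_of_pos_left _ (by omega)
    have h4 : r * (m * (60 * maxDeg G ^ 2 + E + 5)) + r * (m * (12 * maxDeg G ^ 2 + 3)) ≤
        r * (m * (80 * maxDeg G ^ 2 + E)) := by
      rw [← Nat.mul_add, ← Nat.mul_add]
      exact Nat.mul_le_mul_left _ (Nat.mul_le_mul_left _ (by omega))
    nlinarith
  have hlog := natCast_log_succ_le (x := x) (by omega)
  have hcR : ((pbieT G k θL θR).cost : ℝ) ≤ r * (m * (80 * (maxDeg G : ℝ) ^ 2 + E)) := by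
    exact_mod_cast hcost
  have hxR : (x : ℝ) = (maxDegR G : ℝ) + k := by rw [hx]; push_cast; rfl
  rw [hxR] at hlog
  have hlog0 := (Nat.cast_nonneg (α := ℝ) r).trans hlog
  refine hcR.trans ?_
  gcongr

/-! ### Comparison with the power of `γ_k` -/

theorem natCast_le_two_pow_sq (d : ℕ) : (d : ℝ) ≤ 2 ^ d ^ 2 := by
  have h1 : d < 2 ^ d := Nat.lt_two_pow_self
  have h2 : 2 ^ d ≤ 2 ^ d ^ 2 := 
    Nat.pow_le_pow_right two_pos (Nat.le_self_pow two_ne_zero d)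
  exact_mod_cast h1.le.trans h2

/-- A power with exponent `d ^ 2` is smaller than a power with exponent `d ^ 3`. -/
theorem exists_pow_sq_le (Z q : ℝ) (hZ : 1 ≤ Z) (hq : 1 < q) :
    ∃ K : ℝ, 0 < K ∧ ∀ d : ℕ, Z ^ d ^ 2 ≤ K * q ^ d ^ 3 := by
  -- From `D` on, `Z ≤ q ^ d` and the `d ^ 2`-th power settles the claim; the finitely many smaller
  -- `d` are absorbed in the constant `Z ^ D ^ 2`.
  obtain ⟨D, hD⟩ := pow_unbounded_of_one_lt Z hq
  refine ⟨Z ^ D ^ 2, by positivity, fun d => ?_⟩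
  have hZ1 : 1 ≤ Z ^ D ^ 2 := one_le_pow₀ hZ
  rcases le_or_gt D d with h | h
  · have h1 : Z ≤ q ^ d := hD.le.trans (pow_le_pow_right₀ hq.le h)
    calc Z ^ d ^ 2 ≤ (q ^ d) ^ d ^ 2 := pow_le_pow_left₀ (by linarith) h1 _
      _ = q ^ d ^ 3 := by rw [← pow_mul]; ring_nf
      _ ≤ Z ^ D ^ 2 * q ^ d ^ 3 := le_mul_of_one_le_left (by positivity) hZ1
  · calc Z ^ d ^ 2 ≤ Z ^ D ^ 2 := pow_le_pow_right₀ hZ (Nat.pow_le_pow_left h.le 2)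
      _ ≤ Z ^ D ^ 2 * q ^ d ^ 3 := le_mul_of_one_le_right (by positivity)
        (one_le_pow₀ hq.le)

/-- `(11 / 10) ^ 3 = 1331 / 1000` is below `3 / 2`, and the gap `(1500 / 1331) ^ (d ^ 3)` swallows
`10 ^ (8 * d ^ 2)` together with the polynomial factors, which are at most constant multiples of `(2
^ 12) ^ (d ^ 2)`. -/
theorem exists_stepBound_le : ∃ K : ℝ, 0 < K ∧ ∀ d : ℕ, stepBound d ≤ K * (3 / 2) ^ d ^ 3 := by
  obtain ⟨K, hK, hle⟩ := exists_pow_sq_le (2 ^ 12 * 10 ^ 8) (1500 / 1331) (by norm_num)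
    (by norm_num)
  refine ⟨2000000 * K, by positivity, fun d => ?_⟩
  set t : ℝ := 2 ^ d ^ 2 with ht
  set w : ℝ := 10 ^ (8 * d ^ 2) with hw
  set y : ℝ := (1331 / 1000) ^ d ^ 3 with hy
  have ht1 : 1 ≤ t := one_le_pow₀ (by norm_num)
  have hw1 : 1 ≤ w := one_le_pow₀ (by norm_num)
  have hy1 : 1 ≤ y := one_le_pow₀ (by norm_num)
  have hdt : (d : ℝ) ≤ t := natCast_le_two_pow_sq d
  have hd9 : ((d : ℝ) ^ 3) ^ 3 ≤ t ^ 12 := by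
    rw [← pow_mul]
    exact (pow_le_pow_left₀ (Nat.cast_nonneg d) hdt _).trans
      (pow_le_pow_right₀ ht1 (by norm_num))
  have hd12 : ((d : ℝ) ^ 3) ^ 4 ≤ t ^ 12 := by
    rw [← pow_mul]
    exact pow_le_pow_left₀ (Nat.cast_nonneg d) hdt _
  have ht12 : 1 ≤ t ^ 12 := one_le_pow₀ ht1
  have hwy : 1 ≤ w * y := one_le_mul_of_one_le_of_one_le hw1 hy1
  have hyy : ((11 : ℝ) / 10) ^ (3 * d ^ 3) = y := by
    rw [pow_mul, hy]
    norm_num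
  have hZ : t ^ 12 * w = (2 ^ 12 * 10 ^ 8) ^ d ^ 2 := by
    rw [ht, hw, mul_pow, ← pow_mul, ← pow_mul, ← pow_mul, mul_comm 12]
  have hsplit : ((3 : ℝ) / 2) ^ d ^ 3 = (1500 / 1331) ^ d ^ 3 * y := by
    rw [hy, ← mul_pow]
    norm_num
  -- The constants are `2 + 60 * 8 ^ 3 ≤ 40000` and `2 * 120 * 8 ^ 4 + 1 ≤ 1000000`.
  have h1 : stepBound d ≤ 2000000 * (t ^ 12 * w * y) := by
    rw [stepBound, hyy]
    have h2 : (2 : ℝ) + 60 * (8 * d ^ 3) ^ 3 ≤ 40000 * (t ^ 12 * (w * y)) := by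
      rw [mul_pow]
      have : t ^ 12 ≤ t ^ 12 * (w * y) := le_mul_of_one_le_right (by positivity) hwy
      linarith
    have h3 : (2 * (120 * (8 * (d : ℝ) ^ 3) ^ 4) + 1) ≤ 1000000 * t ^ 12 := by
      rw [mul_pow]
      linarith
    have h4 : (2 * (120 * (8 * (d : ℝ) ^ 3) ^ 4) + 1) * w * y ≤ 1000000 * t ^ 12 * w * y := by
      gcongr
    have h5 : 0 ≤ t ^ 12 * (w * y) := by positivity
    linarith
  rw [hZ] at h1
  calc stepBound d ≤ 2000000 * ((2 ^ 12 * 10 ^ 8) ^ d ^ 2 * y) := h1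
    _ ≤ 2000000 * (K * (1500 / 1331) ^ d ^ 3 * y) := by gcongr; exact hle d
    _ = 2000000 * K * (3 / 2) ^ d ^ 3 := by rw [hsplit]; ring

theorem exists_pbieT_cost_le : ∃ c : ℝ, 0 < c ∧
    ∀ (m n : ℕ) (G : BipGraph m n) (k θL θR : ℕ),
      1 ≤ k → 2 * k + 1 ≤ θL → 2 * k + 1 ≤ θR → 1 ≤ maxDeg G →
      ((pbieT G k θL θR).cost : ℝ) ≤
        c * (Real.log ((maxDegR G : ℝ) + (k : ℝ)) * (m : ℝ) * (maxDeg G : ℝ) ^ 4 *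
          gammaRoot k ^ (maxDeg G ^ 3)) := by
  obtain ⟨K, hK, hle⟩ := exists_stepBound_le
  refine ⟨4 * (80 + K), by positivity, fun m n G k θL θR hk hL hR hd => ?_⟩
  obtain ⟨hm, hdR⟩ := pos_of_maxDeg_pos hd
  refine (pbieT_cost_le hk hL hR hd).trans ?_
  set d := maxDeg G
  have hd1 : (1 : ℝ) ≤ d := by exact_mod_cast hd
  have hlog : 0 ≤ Real.log ((maxDegR G : ℝ) + k) := by
    refine Real.log_nonneg ?_
    have : (1 : ℝ) ≤ maxDegR G := by exact_mod_cast hdR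
    have : (0 : ℝ) ≤ k := Nat.cast_nonneg k
    linarith
  -- This is the only place where the running time meets `γ_k`. The factor `d ^ 4` is needed only
  -- for the quadratic cost of scans and cores, not for the branching.
  have hγ : ((3 : ℝ) / 2) ^ d ^ 3 ≤ gammaRoot k ^ d ^ 3 :=
    pow_le_pow_left₀ (by norm_num) (gammaRoot_isGreatest k hk).2.2 _
  have hγ1 : 1 ≤ gammaRoot k ^ d ^ 3 := le_trans (one_le_pow₀ (by norm_num)) hγ
  have h1 : (d : ℝ) ^ 2 ≤ d ^ 4 * gammaRoot k ^ d ^ 3 :=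
    (pow_le_pow_right₀ hd1 (by norm_num)).trans (le_mul_of_one_le_right (by positivity) hγ1)
  have h2 : gammaRoot k ^ d ^ 3 ≤ d ^ 4 * gammaRoot k ^ d ^ 3 :=
    le_mul_of_one_le_left (by linarith) (one_le_pow₀ hd1)
  have h3 : stepBound d ≤ K * (d ^ 4 * gammaRoot k ^ d ^ 3) :=
    (hle d).trans (mul_le_mul_of_nonneg_left (hγ.trans h2) hK.le)
  have h4 : 80 * (d : ℝ) ^ 2 + stepBound d ≤ (80 + K) * (d ^ 4 * gammaRoot k ^ d ^ 3) := by
    linarith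
  calc 4 * Real.log ((maxDegR G : ℝ) + k) * (m * (80 * (d : ℝ) ^ 2 + stepBound d))
      ≤ 4 * Real.log ((maxDegR G : ℝ) + k) *
        (m * ((80 + K) * (d ^ 4 * gammaRoot k ^ d ^ 3))) := by gcongr
    _ = _ := by ring

end RunningTime

end PBIE

/-! ### The theorem -/

theorem mainTheorem3 :
    -- `γ_k` is well defined and smaller than 2
    (∀ k : ℕ, 1 ≤ k →
      IsGreatest {x : ℝ | 0 < x ∧ x ^ (k + 4) - 2 * x ^ (k + 3) + x ^ 2 - x + 1 = 0}
        (PBIE.gammaRoot k) ∧ PBIE.gammaRoot k < 2) ∧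
    -- the core contains every biplex that is large enough
    (∀ (m n : ℕ) (G : PBIE.BipGraph m n) (k p q : ℕ) (A X : Finset (Fin m)) (B Y : Finset (Fin n)),
      PBIE.IsCore G (q - k) (p - k) A B → PBIE.IsBiplex G k X Y → p ≤ X.card → q ≤ Y.card →
        X ⊆ A ∧ Y ⊆ B) ∧
    -- each of the subgraphs has at most `d ^ 3` vertices
    (∀ (m n : ℕ) (G : PBIE.BipGraph m n), 2 ≤ PBIE.maxDeg G → ∀ i : Fin m,
      (PBIE.subL G i).card + (PBIE.subR G i).card ≤ PBIE.maxDeg G ^ 3) ∧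
    -- each MaxBP lies in one of the subgraphs, and none of its vertices is pruned there
    (∀ (m n : ℕ) (G : PBIE.BipGraph m n) (k θL θR : ℕ),
      1 ≤ k → 2 * k + 1 ≤ θL → 2 * k + 1 ≤ θR →
      ∀ (X : Finset (Fin m)) (Y : Finset (Fin n)), PBIE.IsMaxBP G k θL θR X Y →
        ∃ i ∈ X, X ⊆ PBIE.subL G i ∧ Y ⊆ PBIE.subR G i ∧
          (∀ v ∈ X, θR ≤ (PBIE.nbrR G v (PBIE.subR G i)).card + k ∧
            θR ≤ (PBIE.nbrR G v (PBIE.subR G i) ∩ PBIE.nbrR G i Finset.univ).card + 2 * k) ∧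
          (∀ u ∈ Y, θL ≤ (PBIE.nbrL G u (PBIE.subL G i)).card + k)) ∧
    -- PBIE with FastBB returns a MaxBP, or the empty subgraph if there is none
    (∀ (m n : ℕ) (G : PBIE.BipGraph m n) (k θL θR : ℕ),
      1 ≤ k → 2 * k + 1 ≤ θL → 2 * k + 1 ≤ θR →
      PBIE.IsMaxBP G k θL θR (PBIE.pbieT G k θL θR).val.left (PBIE.pbieT G k θL θR).val.right ∨
      ((¬ ∃ X Y, PBIE.IsMaxBP G k θL θR X Y) ∧ (PBIE.pbieT G k θL θR).val.verts = [])) ∧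
    -- the running time
    (∃ c : ℝ, 0 < c ∧ ∀ (m n : ℕ) (G : PBIE.BipGraph m n) (k θL θR : ℕ),
      1 ≤ k → 2 * k + 1 ≤ θL → 2 * k + 1 ≤ θR → 1 ≤ PBIE.maxDeg G →
      ((PBIE.pbieT G k θL θR).cost : ℝ) ≤
        c * (Real.log ((PBIE.maxDegR G : ℝ) + (k : ℝ)) * (m : ℝ) * (PBIE.maxDeg G : ℝ) ^ 4 *
          PBIE.gammaRoot k ^ (PBIE.maxDeg G ^ 3))) := by
  refine ⟨fun k hk => ?_, fun m n G k p q A X B Y hc hb hp hq => hb.subset_core hc hp hq,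
    fun m n G hd i => PBIE.card_subL_add_card_subR_le G hd i,
    fun m n G k θL θR _ hL hR X Y h => h.exists_sub hL hR,
    fun m n G k θL θR _ hL hR => PBIE.pbieT_correct hL hR, PBIE.exists_pbieT_cost_le⟩
  obtain ⟨h1, h2, -⟩ := PBIE.gammaRoot_isGreatest k hk
  exact ⟨h1, h2⟩
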